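/- Let $d\ge 1$ be an integer and $Y_d=\{(l_1,l_2)\in\mathbb{Z}^2: 0\le l_2<l_1\le d\}$. Let $\mathbb{G}_0^\#$ be the set of real vectors $(x_{l_1l_2})_{(l_1,l_2)\in Y_d}$ with the group law $$[x\cdot y]_{l_10}=x_{l_10}+y_{l_10},\qquad [x\cdot y]_{l_1l_2}=x_{l_1l_2}+y_{l_1l_2}+x_{l_10}\,y_{l_20}\quad (l_2\ge 1),$$ and let $A_0:\mathbb{R}\to\mathbb{G}_0^\#$ be given by $[A_0(x)]_{l_10}=x^{l_1}$ and $[A_0(x)]_{l_1l_2}=0$ for $l_2\ge1$. For $r\ge 1$ and $n,m\in\mathbb{R}^r$ put $$D(n,m)=A_0(n_1)^{-1}\cdot A_0(m_1)\cdot\ldots\cdot A_0(n_r)^{-1}\cdot A_0(m_r),\qquad \widetilde D(n,m)=A_0(n_1)\cdot A_0(m_1)^{-1}\cdot\ldots\cdot A_0(n_r)\cdot A_0(m_r)^{-1}.$$ For an integer $P\ge1$ let $\phi^{(j)}_P,\psi^{(j)}_P:\mathbb{R}\to\mathbb{R}$, $j=1,\ldots,r$, be $C^1$ functions such that, for every $j$,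 $$|\phi^{(j)}_P|+|\psi^{(j)}_P|\le \mathbf{1}_{[-P,P]},\qquad \int_{\mathbb{R}}\big(|(\phi^{(j)}_P)'(x)|+|(\psi^{(j)}_P)'(x)|\big)\,dx\le 1.$$ For $\theta\in\mathbb{R}^{Y_d}$ let $$S_{P,r}(\theta)=\sum_{n,m\in\mathbb{Z}^r}e^{-2\pi i D(n,m)\cdot\theta}\prod_{j=1}^r\phi^{(j)}_P(n_j)\,\psi^{(j)}_P(m_j),$$ where $D(n,m)\cdot\theta=\sum_{(l_1,l_2)\in Y_d}[D(n,m)]_{l_1l_2}\theta_{l_1l_2}$, and let $\widetilde S_{P,r}(\theta)$ be the same sum with $\widetilde D$ in place of $D$. Proposition. For every $d\ge 1$ there is a constant $\overline C=\overline C(d)>0$, and for every $r\ge1$ a constant $C_{d,r}>0$ (depending only on $d$ and $r$), such that the following holds for all $\epsilon\in(0,1/2]$, all integers $P\ge1$, all functions $\phi^{(j)}_P,\psi^{(j)}_P$ as above and all $\theta\in\mathbb{R}^{Y_d}$. If there are a pair $(l_1,l_2)\in Y_d$ and an irreducible fraction $a/q$ with $a\in\mathbb{Z}$ and an integer $q\ge1$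 such that $$|\theta_{l_1l_2}-a/q|\le 1/q^2\qquad\text{and}\qquad P^{\epsilon}\le q\le P^{l_1+l_2-\epsilon},$$ then $$|S_{P,r}(\theta)|+|\widetilde S_{P,r}(\theta)|\le C_{d,r}\,P^{2r}\,P^{\overline C-r\epsilon/\overline C}.$$ -/

import Mathlib

namespace StepTwo

noncomputable section

/-- The index set `Y_d = {(l₁, l₂) : 0 ≤ l₂ < l₁ ≤ d}`. -/
def Y (d : ℕ) : Finset (ℕ × ℕ) :=
  (Finset.range (d + 1) ×ˢ Finset.range (d + 1)).filter (fun l => l.2 < l.1)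

theorem mem_Y {d : ℕ} {l : ℕ × ℕ} : l ∈ Y d ↔ l.2 < l.1 ∧ l.1 ≤ d := by
  simp only [Y, Finset.mem_filter, Finset.mem_product, Finset.mem_range]
  omega

/-- For `(l₁, l₂) ∈ Y_d`, the index `(l₁, 0) ∈ Y_d`. -/
def fstIdx {d : ℕ} (l : Y d) : Y d :=
  ⟨(l.1.1, 0), by have h := mem_Y.1 l.2; exact mem_Y.2 (by simp only; omega)⟩

/-- For `(l₁, l₂) ∈ Y_d` with `l₂ ≠ 0`, the index `(l₂, 0) ∈ Y_d`. -/
def sndIdx {d : ℕ} (l : Y d) (hl : l.1.2 ≠ 0) : Y d :=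
  ⟨(l.1.2, 0), by have h := mem_Y.1 l.2; exact mem_Y.2 (by simp only; omega)⟩

@[simp] theorem fstIdx_snd {d : ℕ} (l : Y d) : (fstIdx l).1.2 = 0 := rfl

@[simp] theorem sndIdx_snd {d : ℕ} (l : Y d) (hl : l.1.2 ≠ 0) : (sndIdx l hl).1.2 = 0 := rfl

/-- The underlying set of the universal step-two nilpotent Lie group `𝔾₀^#(d)`:
real vectors indexed by `Y_d`. -/
@[ext] structure G0 (d : ℕ) where
  coord : Y d → ℝ

namespace G0

variable {d : ℕ}

/-- The quadratic term `x_{l₁ 0} y_{l₂ 0}` of the group law, present only when `l₂ ≥ 1`. -/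
def cross (x y : G0 d) (l : Y d) : ℝ :=
  if hl : l.1.2 = 0 then 0 else x.coord (fstIdx l) * y.coord (sndIdx l hl)

instance : Mul (G0 d) := ⟨fun x y => ⟨fun l => x.coord l + y.coord l + cross x y l⟩⟩

instance : One (G0 d) := ⟨⟨fun _ => 0⟩⟩

instance : Inv (G0 d) := ⟨fun x => ⟨fun l => - x.coord l + cross x x l⟩⟩

theorem mul_coord (x y : G0 d) (l : Y d) :
    (x * y).coord l = x.coord l + y.coord l + cross x y l := rfl

theorem one_coord (l : Y d) : (1 : G0 d).coord l = 0 := rfl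

theorem inv_coord (x : G0 d) (l : Y d) : (x⁻¹).coord l = - x.coord l + cross x x l := rfl

instance : Group (G0 d) :=
  Group.ofLeftAxioms
    (by
      intro x y z
      ext l
      by_cases hl : l.1.2 = 0
      · simp [mul_coord, cross, hl, add_assoc]
      · simp [mul_coord, cross, hl]; ring)
    (by
      intro x
      ext l
      simp [mul_coord, one_coord, cross])
    (by
      intro x
      ext l
      by_cases hl : l.1.2 = 0
      · simp [mul_coord, inv_coord, one_coord, cross, hl]
      · simp [mul_coord, inv_coord, one_coord, cross, hl])

end G0

/-- The polynomial map `A₀ : ℝ → 𝔾₀^#`, with `[A₀(x)]_{l₁ l₂} = x^{l₁}` if `l₂ = 0` and `0`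
otherwise. -/
def A0 (d : ℕ) (x : ℝ) : G0 d := ⟨fun l => if l.1.2 = 0 then x ^ l.1.1 else 0⟩

/-- `D(x, y) = A₀(x₁)⁻¹ · A₀(y₁) · … · A₀(x_r)⁻¹ · A₀(y_r)` (an ordered product). -/
def D (d r : ℕ) (x y : Fin r → ℝ) : G0 d :=
  (List.ofFn fun j => (A0 d (x j))⁻¹ * A0 d (y j)).prod

/-- `D̃(x, y) = A₀(x₁) · A₀(y₁)⁻¹ · … · A₀(x_r) · A₀(y_r)⁻¹` (an ordered product). -/
def Dtilde (d r : ℕ) (x y : Fin r → ℝ) : G0 d :=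
  (List.ofFn fun j => A0 d (x j) * (A0 d (y j))⁻¹).prod

/-- The pairing `g · θ = ∑_{l ∈ Y_d} g_l θ_l`. -/
def pairing {d : ℕ} (g : G0 d) (θ : Y d → ℝ) : ℝ := ∑ l, g.coord l * θ l

/-- The cutoffs at scale `P`: `C¹` functions with `|φ_j| + |ψ_j| ≤ 1_{[-P,P]}` and
`∫ (|φ_j'| + |ψ_j'|) ≤ 1`. -/
structure IsCutoff {r : ℕ} (P : ℕ) (φ ψ : Fin r → ℝ → ℝ) : Prop where
  contDiff_left : ∀ j, ContDiff ℝ 1 (φ j)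
  contDiff_right : ∀ j, ContDiff ℝ 1 (ψ j)
  bound : ∀ j x, |φ j x| + |ψ j x| ≤ Set.indicator (Set.Icc (-(P : ℝ)) P) (fun _ => (1 : ℝ)) x
  variation : ∀ j, ∫ x, (|deriv (φ j) x| + |deriv (ψ j) x|) ≤ 1

/-- The exponential sum with phase `E`. For cutoffs as above, only finitely many terms are
nonzero. -/
def expSum {d r : ℕ} (E : (Fin r → ℝ) → (Fin r → ℝ) → G0 d) (φ ψ : Fin r → ℝ → ℝ)
    (θ : Y d → ℝ) : ℂ :=
  ∑' p : (Fin r → ℤ) × (Fin r → ℤ),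
    Complex.exp (-2 * Real.pi * Complex.I *
        (pairing (E (fun j => (p.1 j : ℝ)) (fun j => (p.2 j : ℝ))) θ : ℂ)) *
      ((∏ j, φ j (p.1 j : ℝ) : ℝ) : ℂ) * ((∏ j, ψ j (p.2 j : ℝ) : ℝ) : ℂ)

/-- The sum `S_{P,r}(θ)`. -/
def S {d r : ℕ} (φ ψ : Fin r → ℝ → ℝ) (θ : Y d → ℝ) : ℂ := expSum (D d r) φ ψ θ

/-- The sum `S̃_{P,r}(θ)`. -/
def Stilde {d r : ℕ} (φ ψ : Fin r → ℝ → ℝ) (θ : Y d → ℝ) : ℂ := expSum (Dtilde d r) φ ψ θ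

end

end StepTwo

/-! Call the frequencies with `l₂ ≥ 1` central and those with `l₂ = 0` horizontal, and call a
frequency major if it lies near a fraction with small denominator (`Major`). By
`not_major_of_approx`, the Diophantine hypothesis says that one frequency is not major at a level
that is a small power of `P ^ ε`. With `H` a smaller power of `P ^ ε`, it suffices to save a fixed
power of `H` for each bounded group of variables. A loss of a power of `P` that does not depend on
`r` is harmless, since it goes into the constant `Cbar`.

Suppose that some central frequency is not major. The phase of the ordered product is a sum of
one-step phases plus `∑_{j<k} B(h_j, h_k)`, where `B` is the bilinear form of the central
frequencies and `h_j` are the horizontal displacements. This ordered sum is the cocycle of the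
twisted translations `V_X` on `ℓ²(ℤ^d)`, for which `V_X V_Y = e(-B(X,Y)) V_{X+Y}`. Hence the
exponential sum is read off from a product of `r` operators (`IsModel.norm_expSum_le_opNorm`), and
norms of blocks multiply. A block of `s` operators is `∑ m(Z) V_Z`, and the mean value estimate
`vinogradov_count` shows that `m` is spread evenly over its box. The C*-identity and two
applications of Cauchy–Schwarz (`norm_twisted_pow_eight_le`) remove `m` and leave only the
commutator phase `B(Z',Z) - B(Z,Z')`. If the block norm is large, this phase has many near-integral
coefficients, and `linear_recurrence` makes every central frequency major (`minor_inverse`). So each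
block saves a factor `H` (`norm_block_le`, `central_minor_bound`).

Suppose instead that all central frequencies are major. On cells of side about `P / X` the central
phase is then a function periodic modulo a small `Q` times a slowly varying one, so it can be
separated from products of one-variable weights at a cost that is a fixed power of `X` per variable
(`Tame`, `tame_central`). The sum decouples into `2r` one-variable Weyl sums. The frequency that is
not major must now be horizontal, and `weyl_coeff` gives each Weyl sum a saving larger than that
cost (`horizontal_minor_bound`).

Both Weyl's inequality and the mean value estimate are derived from `linear_recurrence`:
differencing gives the leading coefficient, removing a major leading term gives the others by
induction, and counting major frequencies bounds a high moment. -/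

namespace StepTwo

open Finset

/-! ### Characters, nearness to rationals, and weights of bounded variation -/

section

/-- The additive character `e(x) = exp(2πix)`. -/
noncomputable def e (x : ℝ) : ℂ := Complex.exp (2 * Real.pi * Complex.I * x)

theorem e_add (x y : ℝ) : e (x + y) = e x * e y := by
  simp only [e, ← Complex.exp_add]; push_cast; ring_nf

theorem e_zero : e 0 = 1 := by simp [e]

theorem norm_e (x : ℝ) : ‖e x‖ = 1 := by
  rw [e, Complex.norm_exp]; simp

theorem e_int (n : ℤ) : e n = 1 := by
  rw [e, Complex.exp_eq_one_iff]; exact ⟨n, by push_cast; ring⟩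

theorem e_add_int (x : ℝ) (n : ℤ) : e (x + n) = e x := by rw [e_add, e_int, mul_one]

theorem conj_e (x : ℝ) : (starRingEnd ℂ) (e x) = e (-x) := by
  rw [e, e, ← Complex.exp_conj]
  simp [Complex.conj_ofNat]

theorem e_sum {ι : Type*} (s : Finset ι) (f : ι → ℝ) : e (∑ i ∈ s, f i) = ∏ i ∈ s, e (f i) := by
  classical
  induction s using Finset.induction_on with
  | empty => simp [e_zero]
  | insert a s ha ih => rw [sum_insert ha, prod_insert ha, e_add, ih]

theorem norm_e_sub_one_le (x : ℝ) : ‖e x - 1‖ ≤ 2 * Real.pi * |x| := by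
  have : e x = Complex.exp (Complex.I * ((2 * Real.pi * x : ℝ) : ℂ)) := by
    rw [e]; push_cast; ring_nf
  rw [this]
  refine (Real.norm_exp_I_mul_ofReal_sub_one_le).trans ?_
  rw [Real.norm_eq_abs, abs_mul, abs_of_pos Real.two_pi_pos]

theorem four_mul_abs_le_norm_e_sub_one {x : ℝ} (hx : |x| ≤ 1 / 2) : 4 * |x| ≤ ‖e x - 1‖ := by
  have h1 : e x = Complex.exp (Complex.I * ((2 * Real.pi * x : ℝ) : ℂ)) := by
    rw [e]; push_cast; ring_nf
  rw [h1, Complex.norm_exp_I_mul_ofReal_sub_one, Real.norm_eq_abs, abs_mul, abs_two]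
  have h2 : |2 * Real.pi * x / 2| ≤ Real.pi / 2 := by
    rw [show 2 * Real.pi * x / 2 = Real.pi * x by ring, abs_mul, abs_of_pos Real.pi_pos]
    nlinarith [Real.pi_pos]
  have h3 := Real.mul_abs_le_abs_sin h2
  rw [show 2 * Real.pi * x / 2 = Real.pi * x by ring, abs_mul, abs_of_pos Real.pi_pos] at h3
  rw [show 2 * Real.pi * x / 2 = Real.pi * x by ring]
  have : 2 / Real.pi * (Real.pi * |x|) = 2 * |x| := by field_simp
  linarith

/-- `x` is within `t` of an integer. -/
def Near (t x : ℝ) : Prop := ∃ a : ℤ, |x - a| ≤ t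

theorem Near.mono {t t' x : ℝ} (h : Near t x) (ht : t ≤ t') : Near t' x :=
  let ⟨a, ha⟩ := h; ⟨a, ha.trans ht⟩

theorem near_of_half_le {t : ℝ} (ht : 1 / 2 ≤ t) (x : ℝ) : Near t x :=
  ⟨round x, (abs_sub_round x).trans ht⟩

theorem Near.add {s t x y : ℝ} (hx : Near s x) (hy : Near t y) : Near (s + t) (x + y) := by
  obtain ⟨a, ha⟩ := hx
  obtain ⟨b, hb⟩ := hy
  refine ⟨a + b, ?_⟩
  push_cast
  calc |x + y - (a + b)| = |(x - a) + (y - b)| := by ring_nf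
    _ ≤ _ := (abs_add_le _ _).trans (add_le_add ha hb)

theorem Near.neg {t x : ℝ} (hx : Near t x) : Near t (-x) := by
  obtain ⟨a, ha⟩ := hx
  refine ⟨-a, ?_⟩
  rw [← abs_neg]
  push_cast
  convert ha using 2
  ring

theorem Near.sub {s t x y : ℝ} (hx : Near s x) (hy : Near t y) : Near (s + t) (x - y) := by
  rw [sub_eq_add_neg]; exact hx.add hy.neg

theorem Near.nat_mul {t x : ℝ} (hx : Near t x) (n : ℕ) : Near (n * t) (n * x) := by
  obtain ⟨a, ha⟩ := hx
  refine ⟨n * a, ?_⟩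
  push_cast
  rw [← mul_sub, abs_mul, Nat.abs_cast]
  gcongr

/-- `t` is within `X / (q T)` of a fraction with denominator `q ≤ X`. -/
def Major (X T t : ℝ) : Prop := ∃ q : ℕ, 1 ≤ q ∧ (q : ℝ) ≤ X ∧ Near (X / T) (q * t)

theorem Major.mono {X X' T t : ℝ} (h : Major X T t) (hX : X ≤ X') (hT : 0 < T) : Major X' T t := by
  obtain ⟨q, h1, h2, h3⟩ := h
  exact ⟨q, h1, h2.trans hX, h3.mono (by gcongr)⟩

theorem major_of_le {X T : ℝ} (h1 : 1 ≤ X) (hT : 0 < T) (h : T ≤ X) (t : ℝ) : Major X T t :=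
  ⟨1, le_rfl, by simpa using h1, near_of_half_le (by
    rw [le_div_iff₀ hT]; linarith) _⟩

theorem sum_Ico_succ_top_int {M : Type*} [AddCommMonoid M] {a b : ℤ} (hab : a ≤ b) (f : ℤ → M) :
    ∑ x ∈ Ico a (b + 1), f x = ∑ x ∈ Ico a b, f x + f b := by
  rw [← Finset.insert_Ico_right_eq_Ico_add_one hab, sum_insert right_notMem_Ico, add_comm]

theorem sum_Ico_sub_int {a b : ℤ} (hab : a ≤ b) (f : ℤ → ℂ) :
    ∑ x ∈ Ico a b, (f (x + 1) - f x) = f b - f a := by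
  induction b, hab using Int.leInduction with
  | base => simp
  | succ n hn ih => rw [sum_Ico_succ_top_int hn, ih]; ring

theorem norm_sum_e_mul_le (a b : ℤ) (γ c : ℝ) :
    ‖∑ x ∈ Ico a b, e (γ * x + c)‖ * ‖e γ - 1‖ ≤ 2 := by
  rcases le_total b a with h | h
  · simp [Ico_eq_empty_of_le h]
  rw [← norm_mul, sum_mul]
  have : ∀ x ∈ Ico a b, e (γ * x + c) * (e γ - 1) =
      e (γ * ((x + 1 : ℤ) : ℝ) + c) - e (γ * x + c) := by
    intro x _
    rw [mul_sub, ← e_add, mul_one]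
    congr 2
    push_cast; ring
  rw [sum_congr rfl this, sum_Ico_sub_int h (fun x => e (γ * x + c))]
  refine (norm_sub_le _ _).trans ?_
  rw [norm_e, norm_e]; norm_num

/-- The geometric sum times `e γ - 1` telescopes to size at most `2`, while `‖e γ - 1‖` is at least
four times the distance from `γ` to the nearest integer. -/
theorem near_of_le_norm_sum_e {a b : ℤ} {γ c t : ℝ} (ht : 0 < t)
    (h : t ≤ ‖∑ x ∈ Ico a b, e (γ * x + c)‖) : Near (1 / (2 * t)) γ := by
  refine ⟨round γ, ?_⟩
  have h1 := norm_sum_e_mul_le a b γ c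
  have h2 := four_mul_abs_le_norm_e_sub_one (abs_sub_round γ)
  have h3 : e (γ - round γ) = e γ := by
    have := e_add_int (γ - round γ) (round γ)
    rw [← this]; congr 1; ring
  rw [h3] at h2
  rw [le_div_iff₀ (by positivity)]
  nlinarith [norm_nonneg (e γ - 1), abs_nonneg (γ - round γ)]

/-- Sup norm plus variation of `u` on `[a, b)` is at most `c`. -/
def BVle (a b : ℤ) (u : ℤ → ℂ) (c : ℝ) : Prop :=
  ∀ x ∈ Ico a b, ‖u x‖ + ∑ y ∈ Ico a (b - 1), ‖u (y + 1) - u y‖ ≤ c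

theorem BVle.subinterval {a b a' b' : ℤ} {u : ℤ → ℂ} {c : ℝ} (h : BVle a b u c) (ha : a ≤ a')
    (hb : b' ≤ b) : BVle a' b' u c := by
  intro x hx
  refine le_trans ?_ (h x (Ico_subset_Ico ha hb hx))
  gcongr

theorem summation_by_parts {a b : ℤ} (hab : a ≤ b) (u w : ℤ → ℂ) :
    ∑ x ∈ Ico a (b + 1), u x * w x = u b * ∑ x ∈ Ico a (b + 1), w x -
      ∑ x ∈ Ico a b, (u (x + 1) - u x) * ∑ y ∈ Ico a (x + 1), w y := by
  induction b, hab using Int.leInduction with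
  | base => simp [sum_Ico_succ_top_int le_rfl]
  | succ n hn ih =>
    rw [sum_Ico_succ_top_int (b := n + 1) (by lia) (fun x => u x * w x), ih,
      sum_Ico_succ_top_int hn (fun x => (u (x + 1) - u x) * _),
      sum_Ico_succ_top_int (b := n + 1) (by lia) w]
    ring

theorem norm_sum_mul_le_of_bv {a b : ℤ} {u w : ℤ → ℂ} {c B : ℝ} (hc : 0 ≤ c) (hB : 0 ≤ B)
    (hu : BVle a b u c)
    (hw : ∀ b', a ≤ b' → b' ≤ b → ‖∑ x ∈ Ico a b', w x‖ ≤ B) :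
    ‖∑ x ∈ Ico a b, u x * w x‖ ≤ c * B := by
  rcases le_or_gt b a with h | h
  · simp only [Ico_eq_empty_of_le h, sum_empty, norm_zero]; positivity
  obtain ⟨b, rfl⟩ : ∃ b', b = b' + 1 := ⟨b - 1, by ring⟩
  have hab : a ≤ b := by lia
  rw [summation_by_parts hab]
  have hu' := hu b (by simp; lia)
  simp only [add_sub_cancel_right] at hu'
  calc _ ≤ ‖u b‖ * B + ∑ x ∈ Ico a b, ‖u (x + 1) - u x‖ * B := by
        refine (norm_sub_le _ _).trans (add_le_add ?_ ((norm_sum_le _ _).trans (sum_le_sum ?_)))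
        · rw [norm_mul]; gcongr; exact hw _ (by lia) le_rfl
        · intro x hx
          rw [mem_Ico] at hx
          rw [norm_mul]; gcongr; exact hw _ (by lia) (by lia)
    _ = (‖u b‖ + ∑ x ∈ Ico a b, ‖u (x + 1) - u x‖) * B := by rw [add_mul, sum_mul]
    _ ≤ _ := by gcongr

/-- All subinterval sums of `w`, twisted by characters mod `Q`, are at most `B`. -/
def Small (Q : ℕ) (a b : ℤ) (w : ℤ → ℂ) (B : ℝ) : Prop :=
  ∀ a' b' : ℤ, a ≤ a' → b' ≤ b → ∀ k : ℤ, ‖∑ x ∈ Ico a' b', w x * e (k / Q * x)‖ ≤ B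

theorem Small.nonneg {Q : ℕ} {a b : ℤ} {w : ℤ → ℂ} {B : ℝ} (h : Small Q a b w B) : 0 ≤ B :=
  (norm_nonneg _).trans (h a b le_rfl le_rfl 0)

/-- Abel summation. `Small` quantifies over all subintervals and all twists modulo `Q` so that it
survives multiplication by slowly varying factors (here) and restriction to residue classes
(`Small.residue`). -/
theorem Small.mul_bv {Q : ℕ} {a b : ℤ} {u w : ℤ → ℂ} {c B : ℝ} (hc : 0 ≤ c) (hu : BVle a b u c)
    (hw : Small Q a b w B) : Small Q a b (fun x => u x * w x) (c * B) := by
  intro a' b' ha hb k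
  simp only [mul_assoc]
  exact norm_sum_mul_le_of_bv hc hw.nonneg (hu.subinterval ha hb)
    (fun b'' _ h2 => hw a' b'' ha (h2.trans hb) k)

theorem sum_e_residue {Q : ℕ} (hQ : 1 ≤ Q) (x : ℤ) :
    ∑ k ∈ range Q, e ((k : ℤ) / Q * x) = if (Q : ℤ) ∣ x then (Q : ℂ) else 0 := by
  have hQ' : (Q : ℝ) ≠ 0 := by positivity
  have hQc : (Q : ℂ) ≠ 0 := by exact_mod_cast hQ'
  have h1 : ∀ k ∈ range Q, e ((k : ℤ) / Q * x) = e (x / Q) ^ k := by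
    intro k _
    rw [e, e, ← Complex.exp_nat_mul]
    congr 1; push_cast; ring
  rw [sum_congr rfl h1]
  have h2 : e (x / Q) ^ Q = 1 := by
    rw [← e_int x, e, e, ← Complex.exp_nat_mul]
    congr 1; push_cast; field_simp
  split_ifs with h
  · obtain ⟨y, rfl⟩ := h
    have : e (((Q * y : ℤ) : ℝ) / Q) = 1 := by
      rw [← e_int y]; congr 1; push_cast; field_simp
    rw [sum_congr rfl fun k _ => by rw [this, one_pow]]
    simp
  · have h3 : e (x / Q) ≠ 1 := by
      intro h3
      rw [e, Complex.exp_eq_one_iff] at h3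
      obtain ⟨n, hn⟩ := h3
      apply h
      refine ⟨n, ?_⟩
      have h4 : (2 * Real.pi * Complex.I) ≠ 0 := Complex.two_pi_I_ne_zero
      have h5 : (((x / Q : ℝ)) : ℂ) = n := by
        apply mul_left_cancel₀ h4
        rw [hn]; ring
      have h6 : (x : ℝ) / Q = n := by exact_mod_cast h5
      rw [div_eq_iff hQ'] at h6
      have : (x : ℝ) = ((Q * n : ℤ) : ℝ) := by rw [h6]; push_cast; ring
      exact_mod_cast this
    have := geom_sum_eq h3 Q
    rw [this, h2]; simp

/-- The sum of a small weight over a residue class in a subinterval. -/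
theorem Small.residue {Q : ℕ} (hQ : 1 ≤ Q) {a b : ℤ} {w : ℤ → ℂ} {B : ℝ}
    (hw : Small Q a b w B) (c : ℤ) :
    ‖∑ x ∈ Ico a b with x % Q = c % Q, w x‖ ≤ B := by
  have hQ' : (Q : ℂ) ≠ 0 := by exact_mod_cast (by lia : Q ≠ 0)
  have h1 : ∑ x ∈ Ico a b with x % Q = c % Q, w x =
      (Q : ℂ)⁻¹ * ∑ k ∈ range Q, e (-((k : ℤ) / Q * c)) * ∑ x ∈ Ico a b, w x * e ((k : ℤ) / Q * x) := by
    rw [sum_filter]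
    simp only [mul_sum]
    rw [sum_comm]
    refine sum_congr rfl fun x _ => ?_
    have h2 : ∀ k ∈ range Q, (Q : ℂ)⁻¹ * (e (-((k : ℤ) / Q * c)) * (w x * e ((k : ℤ) / Q * x))) =
        (Q : ℂ)⁻¹ * w x * e ((k : ℤ) / Q * ((x - c : ℤ) : ℝ)) := by
      intro k _
      have : e ((k : ℤ) / Q * ((x - c : ℤ) : ℝ)) = e (-((k : ℤ) / Q * c)) * e ((k : ℤ) / Q * x) := by
        rw [← e_add]; congr 1; push_cast; ring
      rw [this]; ring
    rw [sum_congr rfl h2, ← mul_sum, sum_e_residue hQ]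
    have h3 : (Q : ℤ) ∣ x - c ↔ x % Q = c % Q := by
      rw [Int.emod_eq_emod_iff_emod_sub_eq_zero, Int.dvd_iff_emod_eq_zero]
    simp only [h3]
    split_ifs
    · field_simp
    · simp
  rw [h1, norm_mul, norm_inv, Complex.norm_natCast]
  have h4 : ‖∑ k ∈ range Q, e (-((k : ℤ) / Q * c)) * ∑ x ∈ Ico a b, w x * e ((k : ℤ) / Q * x)‖
      ≤ Q * B := by
    refine (norm_sum_le _ _).trans ?_
    calc _ ≤ ∑ k ∈ range Q, B := by
          refine sum_le_sum fun k _ => ?_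
          rw [norm_mul, norm_e, one_mul]
          exact hw a b le_rfl le_rfl k
      _ = _ := by simp
  have hQ'' : (0 : ℝ) < Q := by exact_mod_cast hQ
  rw [inv_mul_le_iff₀ hQ'']
  exact h4

end

/-! ### Near-integral values of a linear function on a dense set -/

section

theorem card_le_of_residue_of_diff {Y : Finset ℤ} {q : ℤ} (hq : 0 < q) {M : ℝ}
    (hres : ∀ y ∈ Y, ∀ y' ∈ Y, q ∣ y - y')
    (hdiff : ∀ y ∈ Y, ∀ y' ∈ Y, ((y - y' : ℤ) : ℝ) ≤ q * M) (hM : 0 ≤ M) :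
    (Y.card : ℝ) ≤ M + 1 := by
  rcases Y.eq_empty_or_nonempty with rfl | hne
  · simp; positivity
  set y₀ := Y.min' hne with hy₀
  have h0 : y₀ ∈ Y := Y.min'_mem hne
  have hcard : Y.card ≤ (Icc (0 : ℤ) ⌊M⌋).card := by
    refine card_le_card_of_injOn (fun y => (y - y₀) / q) ?_ ?_
    · intro y hy
      rw [mem_coe] at hy
      have h1 : y₀ ≤ y := Y.min'_le y hy
      obtain ⟨t, ht⟩ := hres y hy y₀ h0
      have h2 := hdiff y hy y₀ h0
      rw [coe_Icc, Set.mem_Icc]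
      simp only [ht, Int.mul_ediv_cancel_left _ hq.ne']
      have hq' : (0 : ℝ) < q := by exact_mod_cast hq
      rw [ht] at h2
      push_cast at h2
      have h3 : (t : ℝ) ≤ M := le_of_mul_le_mul_left h2 hq'
      refine ⟨?_, Int.le_floor.2 h3⟩
      by_contra hneg
      push Not at hneg
      nlinarith
    · intro y hy y' hy' h
      obtain ⟨t, ht⟩ := hres y hy y₀ h0
      obtain ⟨t', ht'⟩ := hres y' hy' y₀ h0
      simp only [ht, ht', Int.mul_ediv_cancel_left _ hq.ne'] at h
      subst h
      linarith
  have hfl : 0 ≤ ⌊M⌋ := Int.floor_nonneg.2 hM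
  rw [Int.card_Icc] at hcard
  have h4 : ((⌊M⌋ + 1 - 0).toNat : ℝ) = ⌊M⌋ + 1 := by
    have : (((⌊M⌋ + 1 - 0).toNat : ℤ) : ℝ) = ⌊M⌋ + 1 := by
      rw [Int.toNat_of_nonneg (by lia)]; push_cast; ring
    exact_mod_cast this
  calc (Y.card : ℝ) ≤ ((⌊M⌋ + 1 - 0).toNat : ℝ) := by exact_mod_cast hcard
    _ = ⌊M⌋ + 1 := h4
    _ ≤ M + 1 := by linarith [Int.floor_le M]

/-- Pigeonhole on blocks of length `⌈2H⌉`: there are at most `N/(2H) + 1 < N/H` of them. -/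
theorem exists_close_pair {Y : Finset ℤ} {A : ℤ} {N : ℕ} {H : ℝ} (hH : 1 ≤ H)
    (hY : Y ⊆ Ico A (A + N)) (hcard : N / H ≤ Y.card) (hN : 2 * H < N) :
    ∃ y ∈ Y, ∃ y' ∈ Y, y < y' ∧ ((y' - y : ℤ) : ℝ) ≤ 3 * H := by
  set m : ℕ := ⌈2 * H⌉₊ with hm
  have hm1 : 2 * H ≤ m := Nat.le_ceil _
  have hm2 : (m : ℝ) < 2 * H + 1 := Nat.ceil_lt_add_one (by linarith)
  have hm0 : 0 < m := by
    have : (0 : ℝ) < m := by linarith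
    exact_mod_cast this
  have hmap : Set.MapsTo (fun y => (y - A) / (m : ℤ)) Y (range (N / m + 1) |>.image (fun i : ℕ => (i : ℤ))) := by
    intro y hy
    have := mem_Ico.1 (hY hy)
    rw [coe_image]
    refine ⟨((y - A) / (m : ℤ)).toNat, ?_, ?_⟩
    · rw [mem_coe, mem_range]
      have h1 : (y - A) / (m : ℤ) ≤ (N : ℤ) / m := Int.ediv_le_ediv (by lia) (by lia)
      have h2 : ((N / m : ℕ) : ℤ) = (N : ℤ) / m := by push_cast; rfl
      lia
    · refine Int.toNat_of_nonneg ?_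
      exact Int.ediv_nonneg (by lia) (by lia)
  have hlt : ((range (N / m + 1)).image (fun i : ℕ => (i : ℤ))).card < Y.card := by
    refine lt_of_le_of_lt card_image_le ?_
    rw [card_range]
    have h1 : ((N / m : ℕ) : ℝ) ≤ N / m := Nat.cast_div_le
    have h2 : (N : ℝ) / m ≤ N / (2 * H) := by gcongr
    have h3 : (N : ℝ) / (2 * H) + 1 < N / H := by
      have : (N : ℝ) / H = N / (2 * H) + N / (2 * H) := by field_simp; ring
      rw [this]
      have : 1 < (N : ℝ) / (2 * H) := by rw [lt_div_iff₀ (by linarith)]; linarith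
      linarith
    have : ((N / m + 1 : ℕ) : ℝ) < Y.card := by push_cast; linarith
    exact_mod_cast this
  obtain ⟨y, hy, y', hy', hne, heq⟩ := exists_ne_map_eq_of_card_lt_of_maps_to hlt hmap
  have key : ∀ y y' : ℤ, (y - A) / (m : ℤ) = (y' - A) / (m : ℤ) → y' - y < m := by
    intro y y' h
    have h1 := Int.mul_ediv_add_emod (y - A) m
    have h2 := Int.mul_ediv_add_emod (y' - A) m
    have h3 := Int.emod_lt_of_pos (y' - A) (by lia : (0 : ℤ) < m)
    have h4 := Int.emod_nonneg (y - A) (by lia : (m : ℤ) ≠ 0)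
    rw [h] at h1
    lia
  have key' : ∀ y y' : ℤ, (y - A) / (m : ℤ) = (y' - A) / (m : ℤ) → ((y' - y : ℤ) : ℝ) ≤ 3 * H := by
    intro y y' h
    have h1 : y' - y + 1 ≤ (m : ℤ) := key y y' h
    have h2 : (((y' - y + 1 : ℤ)) : ℝ) ≤ m := by exact_mod_cast h1
    push_cast at h2 ⊢
    linarith
  rcases lt_or_gt_of_ne hne with h | h
  · exact ⟨y, hy, y', hy', h, key' _ _ heq⟩
  · exact ⟨y', hy', y, hy, h, key' _ _ heq.symm⟩

/-- Let `κ = qβ - a`. Two points of the same residue class modulo `q`, at distance `q t` with `t |κ|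
≤ 1/4`, have values differing by `t κ` modulo integers with no wrap-around, so nearness forces `t
|κ| ≤ 2τ`. The first factor bounds the number of pairs (block, residue), the second the points in
each. -/
theorem card_le_of_near {Y : Finset ℤ} {A a : ℤ} {N q : ℕ} {τ β c : ℝ}
    (hY : Y ⊆ Ico A (A + N)) (hq1 : 1 ≤ q) (hτ0 : 0 ≤ τ) (hτ1 : τ ≤ 1 / 128)
    (hnear : ∀ y ∈ Y, Near τ (β * y + c)) (ha : |q * β - a| ≤ 2 * τ) (h0 : q * β - a ≠ 0) :
    (Y.card : ℝ) ≤ (8 * |q * β - a| * N + q) * (2 * τ / |q * β - a| + 1) := by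
  set κ : ℝ := q * β - a with hκ
  set k : ℝ := |κ| with hk
  have hkpos : 0 < k := abs_pos.2 h0
  have hk1 : 4 * k ≤ 1 / 16 := by linarith
  -- Blocks have length `L q`. The upper bound on `L` prevents wrap-around inside a block; the lower
  -- bound keeps the number of blocks down.
  obtain ⟨L, hL1, hL2⟩ : ∃ L : ℕ, (L : ℝ) ≤ 1 / (4 * k) ∧ 1 / (8 * k) ≤ L := by
    refine ⟨⌊1 / (4 * k)⌋₊, Nat.floor_le (by positivity), ?_⟩
    have h1 := Nat.lt_floor_add_one (1 / (4 * k))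
    have h2 : 1 ≤ 1 / (8 * k) := by rw [le_div_iff₀ (by positivity)]; linarith
    have h3 : 1 / (4 * k) = 1 / (8 * k) + 1 / (8 * k) := by field_simp; norm_num
    linarith
  have hL0 : (0 : ℝ) < L := lt_of_lt_of_le (by positivity) hL2
  have hL0' : 0 < L := by exact_mod_cast hL0
  have hLk : (L : ℝ) * (4 * k) ≤ 1 := by rwa [le_div_iff₀ (by positivity)] at hL1
  have hLk' : 1 ≤ (L : ℝ) * (8 * k) := by rwa [div_le_iff₀ (by positivity)] at hL2
  have hLq : 0 < L * q := by positivity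
  -- fibres over (block, residue)
  let F : ℤ → ℤ × ℤ := fun y => ((y - A) / ((L * q : ℕ) : ℤ), y % (q : ℤ))
  let T : Finset (ℤ × ℤ) := Icc (0 : ℤ) ((N / (L * q) : ℕ) : ℤ) ×ˢ Ico (0 : ℤ) q
  have hF : Set.MapsTo F Y T := by
    intro y hy
    have := mem_Ico.1 (hY hy)
    simp only [F, T, coe_product, Set.mem_prod, mem_coe, mem_Icc, mem_Ico]
    refine ⟨⟨Int.ediv_nonneg (by lia) (by lia), ?_⟩, Int.emod_nonneg _ (by lia), Int.emod_lt_of_pos _ (by lia)⟩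
    rw [Int.natCast_div]
    exact Int.ediv_le_ediv (by lia) (by lia)
  have hfib : ∀ t ∈ T, (((Y.filter fun y => F y = t).card : ℕ) : ℝ) ≤ 2 * τ / k + 1 := by
    intro t _
    have hmod : ∀ y ∈ Y.filter (fun y => F y = t), ∀ y' ∈ Y.filter (fun y => F y = t),
        (q : ℤ) ∣ y - y' := by
      intro y hy y' hy'
      have h1 := (mem_filter.1 hy).2.trans (mem_filter.1 hy').2.symm
      have h2 := (Prod.ext_iff.1 h1).2
      simp only [F] at h2
      rw [Int.dvd_iff_emod_eq_zero]
      exact Int.emod_eq_emod_iff_emod_sub_eq_zero.1 h2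
    refine card_le_of_residue_of_diff (q := q) (by lia) hmod ?_ (by positivity)
    intro y hy y' hy'
    have h1 := (mem_filter.1 hy).2.trans (mem_filter.1 hy').2.symm
    have h2 := (Prod.ext_iff.1 h1).1
    simp only [F] at h2
    obtain ⟨t, ht⟩ := hmod y hy y' hy'
    rw [ht]
    push_cast
    have hq0 : (0 : ℝ) ≤ q := by positivity
    refine mul_le_mul_of_nonneg_left ?_ hq0
    rcases le_or_gt t 0 with htn | htp
    · exact le_trans (Int.cast_nonpos.2 htn) (by positivity)
    have htL : t < L := by
      have g1 := Int.mul_ediv_add_emod (y - A) ((L * q : ℕ) : ℤ)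
      have g2 := Int.mul_ediv_add_emod (y' - A) ((L * q : ℕ) : ℤ)
      have g3 := Int.emod_lt_of_pos (y - A) (by exact_mod_cast hLq : (0 : ℤ) < ((L * q : ℕ) : ℤ))
      have g4 := Int.emod_nonneg (y' - A) (by lia : ((L * q : ℕ) : ℤ) ≠ 0)
      rw [h2] at g1
      have g5 : y - y' < ((L * q : ℕ) : ℤ) := by lia
      rw [ht] at g5
      push_cast at g5
      have : (q : ℤ) * t < q * L := by linarith
      exact lt_of_mul_lt_mul_left this (by lia)
    have htL' : (t : ℝ) ≤ L := by exact_mod_cast htL.le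
    have htp' : (0 : ℝ) < t := by exact_mod_cast htp
    have hn := (hnear y (mem_filter.1 hy).1).sub (hnear y' (mem_filter.1 hy').1)
    have he : β * y + c - (β * y' + c) = t * κ + (t * a : ℤ) := by
      have : (y : ℝ) - y' = q * t := by
        have : ((y - y' : ℤ) : ℝ) = ((q * t : ℤ) : ℝ) := by rw [ht]
        push_cast at this; exact this
      rw [hκ]
      push_cast
      linear_combination β * this
    rw [he] at hn
    obtain ⟨b, hb⟩ := hn
    have hsmall : |(t : ℝ) * κ| ≤ 1 / 4 := by
      rw [abs_mul, abs_of_pos htp']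
      nlinarith
    have hz : b - t * a = 0 := by
      have h3 : |((b - t * a : ℤ) : ℝ)| < 1 := by
        have : ((b - t * a : ℤ) : ℝ) = t * κ - (t * κ + (t * a : ℤ) - b) := by push_cast; ring
        rw [this]
        refine (abs_sub _ _).trans_lt ?_
        linarith
      have h4 : |b - t * a| < 1 := by exact_mod_cast h3
      exact Int.abs_lt_one_iff.1 h4
    have hb' : |(t : ℝ) * κ| ≤ 2 * τ := by
      have : (t : ℝ) * κ = t * κ + (t * a : ℤ) - b + ((b - t * a : ℤ) : ℝ) := by push_cast; ring
      rw [this, hz]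
      simp only [Int.cast_zero, add_zero]
      linarith
    rw [abs_mul, abs_of_pos htp'] at hb'
    rw [le_div_iff₀ hkpos]
    exact hb'
  have hcount : (Y.card : ℝ) ≤ T.card * (2 * τ / k + 1) := by
    rw [card_eq_sum_card_fiberwise hF]
    push_cast
    calc _ ≤ ∑ _t ∈ T, (2 * τ / k + 1) := sum_le_sum hfib
      _ = _ := by rw [sum_const, nsmul_eq_mul]
  have hT : (T.card : ℝ) ≤ N / L + q := by
    simp only [T, card_product, Int.card_Icc, Int.card_Ico]
    have h1 : (((N / (L * q) : ℕ) : ℤ) + 1 - 0).toNat = N / (L * q) + 1 := by lia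
    have h2 : ((q : ℤ) - 0).toNat = q := by lia
    rw [h1, h2]
    push_cast
    have h3 : ((N / (L * q) : ℕ) : ℝ) ≤ N / (L * q) := by
      have := @Nat.cast_div_le ℝ _ _ _ N (L * q)
      push_cast at this; exact this
    have hq0 : (0 : ℝ) < q := by exact_mod_cast hq1
    calc (((N / (L * q) : ℕ) : ℝ) + 1) * q ≤ (N / (L * q) + 1) * q := by gcongr
      _ = N / L + q := by field_simp
  have hNL : (N : ℝ) / L ≤ 8 * k * N := by
    rw [div_le_iff₀ hL0]
    have : (0 : ℝ) ≤ N := Nat.cast_nonneg N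
    nlinarith
  refine hcount.trans ?_
  gcongr
  linarith

/-- If `β y + c` is close to an integer for many `y` in an interval, then `β` is close to a rational
with small denominator. -/
theorem linear_recurrence {Y : Finset ℤ} {A : ℤ} {N : ℕ} {H τ β c : ℝ} (hH : 1 ≤ H)
    (hY : Y ⊆ Ico A (A + N)) (hcard : N / H ≤ Y.card) (hτ0 : 0 ≤ τ)
    (hnear : ∀ y ∈ Y, Near τ (β * y + c)) (hN : 12 * H ^ 2 ≤ N) (hτ : τ ≤ 1 / (128 * H)) :
    ∃ q : ℕ, 1 ≤ q ∧ (q : ℝ) ≤ 3 * H ∧ Near (12 * H ^ 2 * τ / N) (q * β) := by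
  have hN2 : 2 * H < N := by nlinarith
  have hNpos : (0 : ℝ) < N := by linarith
  have hHpos : 0 < H := by linarith
  have hτ' : τ * (128 * H) ≤ 1 := by rwa [le_div_iff₀ (by positivity)] at hτ
  -- The denominator is the difference of two close points of `Y`. This alone gives `qβ` within `2τ`
  -- of an integer; the rest of the density improves the error by a factor of order `H² / N`.
  obtain ⟨y₁, hy₁, y₂, hy₂, hlt, hle⟩ := exists_close_pair hH hY hcard hN2
  obtain ⟨q, hq⟩ : ∃ q : ℕ, (q : ℤ) = y₂ - y₁ := ⟨(y₂ - y₁).toNat, Int.toNat_of_nonneg (by lia)⟩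
  have hq1 : 1 ≤ q := by lia
  have hq3 : (q : ℝ) ≤ 3 * H := by rw [← hq] at hle; exact_mod_cast hle
  have hqβ : Near (2 * τ) (q * β) := by
    have := (hnear y₂ hy₂).sub (hnear y₁ hy₁)
    have h1 : (q : ℝ) = y₂ - y₁ := by
      have : ((q : ℤ) : ℝ) = ((y₂ - y₁ : ℤ) : ℝ) := by rw [hq]
      push_cast at this; exact this
    rw [h1]
    convert this using 1 <;> ring
  refine ⟨q, hq1, hq3, ?_⟩
  obtain ⟨a, ha⟩ := hqβ
  refine ⟨a, ?_⟩
  set κ : ℝ := q * β - a with hκ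
  rcases eq_or_ne κ 0 with h0 | h0
  · rw [h0, abs_zero]; positivity
  set k : ℝ := |κ| with hk
  have hkpos : 0 < k := abs_pos.2 h0
  have hτ1 : τ ≤ 1 / 128 := by nlinarith
  -- After expansion, three of the four terms on the right total at most `N / (2H)`. The remaining
  -- one, `6Hτ/k`, is therefore at least `N / (2H)`, which is the required upper bound on `k`.
  have hmain : (N : ℝ) / H ≤ (8 * k * N + 3 * H) * (2 * τ / k + 1) := by
    refine hcard.trans ((card_le_of_near hY hq1 hτ0 hτ1 hnear ha h0).trans ?_)
    gcongr
  have e1 : (8 * k * N + 3 * H) * (2 * τ / k + 1) = 16 * N * τ + 8 * k * N + 6 * H * τ / k + 3 * H := by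
    field_simp; ring
  rw [e1] at hmain
  have e2 : (N : ℝ) / H = 2 * (N / (2 * H)) := by field_simp
  have e3 : 16 * N * τ + 8 * k * N ≤ N / (4 * H) := by
    rw [le_div_iff₀ (by positivity)]
    have h1 : 16 * N * τ + 8 * k * N ≤ 32 * N * τ := by nlinarith
    calc _ ≤ 32 * N * τ * (4 * H) := by gcongr
      _ = N * (τ * (128 * H)) := by ring
      _ ≤ N * 1 := by gcongr
      _ = N := mul_one _
  have e4 : 3 * H ≤ N / (4 * H) := by
    rw [le_div_iff₀ (by positivity)]; nlinarith
  have e5 : (N : ℝ) / (2 * H) ≤ 6 * H * τ / k := by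
    have : (N : ℝ) / (2 * H) = 2 * (N / (4 * H)) := by field_simp; norm_num
    linarith
  rw [div_le_div_iff₀ (by positivity) hkpos] at e5
  rw [le_div_iff₀ hNpos]
  linarith

/-- A recurrence at precision `P ^ (-i)` along an interval of length at least `P ^ j` yields
precision `P ^ (-(i + j))`. The size conditions of `linear_recurrence` can fail only when `P ≤ W`,
and then the conclusion is trivial with denominator `1`. -/
theorem major_of_recurrence {Y : Finset ℤ} {A : ℤ} {N i j : ℕ} {P H X β c : ℝ} (hH : 1 ≤ H)
    (hX : 1 ≤ X) (hP : 1 ≤ P) (hi : 1 ≤ i) (hj : 1 ≤ j) (hPN : P ^ j ≤ N)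
    (hY : Y ⊆ Ico A (A + N)) (hcard : N / H ≤ Y.card)
    (hnear : ∀ y ∈ Y, Near (X / P ^ i) (β * y + c)) :
    Major ((128 * H ^ 2 * X) ^ (i + j)) (P ^ (i + j)) β := by
  set W := 128 * H ^ 2 * X with hW
  have hH2 : 1 ≤ H ^ 2 := one_le_pow₀ hH
  have hHH : H ≤ H ^ 2 := by nlinarith
  have hW1 : 128 * H ^ 2 ≤ W := by rw [hW]; nlinarith
  have hWW : W ≤ W ^ (i + j) := le_self_pow₀ (by linarith) (by lia)
  rcases le_or_gt P W with h | h
  · exact major_of_le (one_le_pow₀ (by linarith)) (by positivity) (by gcongr) _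
  have hPj : P ≤ P ^ j := le_self_pow₀ hP (by lia)
  have hPi : P ≤ P ^ i := le_self_pow₀ hP (by lia)
  obtain ⟨q, h1, h2, h3⟩ := linear_recurrence (τ := X / P ^ i) hH hY hcard (by positivity) hnear
    (by linarith) (by
      rw [div_le_div_iff₀ (by positivity) (by positivity)]
      nlinarith)
  refine ⟨q, h1, by linarith, h3.mono ?_⟩
  have hN0 : (0 : ℝ) < N := by linarith
  calc 12 * H ^ 2 * (X / P ^ i) / N = (12 * H ^ 2 * X) / (P ^ i * N) := by field_simp
    _ ≤ W ^ (i + j) / (P ^ i * P ^ j) := by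
        gcongr
        refine le_trans ?_ hWW
        rw [hW]; gcongr; norm_num
    _ = _ := by rw [pow_add P]

end

/-! ### Weyl's inequality for the leading coefficient -/

section

/-- Popularity principle: terms below `t` contribute at most `s.card * t`, so the rest of the total
is carried by the terms above `t`, each at most `M`. -/
theorem card_large_mul_ge {ι : Type*} (s : Finset ι) (g : ι → ℝ) {M t T : ℝ}
    (hM : ∀ i ∈ s, g i ≤ M) (ht : 0 ≤ t) (hT : T ≤ ∑ i ∈ s, g i) :
    T - s.card * t ≤ ((s.filter fun i => t ≤ g i).card : ℝ) * M := by
  rw [← sum_filter_add_sum_filter_not s (fun i => t ≤ g i)] at hT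
  have h1 : ∑ i ∈ s with t ≤ g i, g i ≤ ((s.filter fun i => t ≤ g i).card : ℝ) * M := by
    rw [← nsmul_eq_mul]
    exact sum_le_card_nsmul _ _ _ fun i hi => hM i (mem_filter.1 hi).1
  have h2 : ∑ i ∈ s with ¬ t ≤ g i, g i ≤ s.card * t := by
    calc _ ≤ ((s.filter fun i => ¬ t ≤ g i).card : ℝ) * t := by
          rw [← nsmul_eq_mul]
          exact sum_le_card_nsmul _ _ _ fun i hi => (not_le.1 (mem_filter.1 hi).2).le
      _ ≤ _ := by gcongr; exact filter_subset _ _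
  linarith

theorem Major.of_nat_mul {X T t : ℝ} {n : ℕ} {Z : ℝ} (hn : 1 ≤ n) (hZ : (n : ℝ) ≤ Z) (hT : 0 < T)
    (h : Major X T (n * t)) : Major (X * Z) T t := by
  obtain ⟨q, h1, h2, h3⟩ := h
  have hn' : (1 : ℝ) ≤ n := by exact_mod_cast hn
  have hX : 1 ≤ X := le_trans (by exact_mod_cast h1) h2
  refine ⟨q * n, Nat.mul_pos h1 hn, by push_cast; gcongr, ?_⟩
  have : ((q * n : ℕ) : ℝ) * t = q * (n * t) := by push_cast; ring
  rw [this]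
  refine h3.mono ?_
  gcongr
  nlinarith

theorem Major.of_add_div {X T t : ℝ} {n : ℕ} {Z : ℝ} {k : ℤ} (hn : 1 ≤ n) (hZ : (n : ℝ) ≤ Z)
    (hT : 0 < T) (h : Major X T (t + k / n)) : Major (X * Z) T t := by
  obtain ⟨q, h1, h2, h3⟩ := h
  have hn' : (1 : ℝ) ≤ n := by exact_mod_cast hn
  have hX : 1 ≤ X := le_trans (by exact_mod_cast h1) h2
  refine ⟨q * n, Nat.mul_pos h1 hn, by push_cast; gcongr, ?_⟩
  obtain ⟨a, ha⟩ := (h3.nat_mul n)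
  refine ⟨a - q * k, ?_⟩
  have h4 : ((q * n : ℕ) : ℝ) * t - ((a - q * k : ℤ) : ℝ) = n * (q * (t + k / n)) - a := by
    push_cast; field_simp; ring
  rw [h4]
  refine ha.trans ?_
  rw [mul_div_assoc', mul_comm X Z]
  gcongr

/-- Functions `ℤ → ℝ` whose `d`-th finite differences are constant, with leading coefficient `α`. -/
def PolyLead : ℕ → ℝ → (ℤ → ℝ) → Prop
  | 0, α, f => ∀ x, f x = α
  | d + 1, α, f => ∀ h : ℤ, PolyLead d ((d + 1) * α * h) (fun x => f (x + h) - f x)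

theorem PolyLead.add {d : ℕ} : ∀ {α β : ℝ} {f g : ℤ → ℝ}, PolyLead d α f → PolyLead d β g →
    PolyLead d (α + β) (fun x => f x + g x) := by
  induction d with
  | zero => intro α β f g hf hg x; simp only [hf x, hg x]
  | succ d ih =>
    intro α β f g hf hg h
    convert ih (hf h) (hg h) using 1
    · ring
    · ext x; ring

theorem PolyLead.const_mul {d : ℕ} (c : ℝ) : ∀ {α : ℝ} {f : ℤ → ℝ}, PolyLead d α f →
    PolyLead d (c * α) (fun x => c * f x) := by
  induction d with
  | zero => intro α f hf x; simp only [hf x]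
  | succ d ih =>
    intro α f hf h
    convert ih (hf h) using 1
    · ring
    · ext x; ring

theorem PolyLead.shift {d : ℕ} (k : ℤ) : ∀ {α : ℝ} {f : ℤ → ℝ}, PolyLead d α f →
    PolyLead d α (fun x => f (x + k)) := by
  induction d with
  | zero => intro α f hf x; exact hf (x + k)
  | succ d ih =>
    intro α f hf h
    convert ih (hf h) using 1
    ext x
    beta_reduce
    rw [show x + h + k = x + k + h by ring]

theorem polyLead_sum {d : ℕ} : ∀ c : ℕ → ℝ,
    PolyLead d (c d) (fun x => ∑ k ∈ range (d + 1), c k * (x : ℝ) ^ k) := by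
  induction d with
  | zero => intro c x; simp
  | succ d ih =>
    intro c h
    -- The part of degree at most `d` differences to leading coefficient zero. The top power
    -- contributes through the binomial expansion, whose coefficient at `x ^ d` is `(d + 1) h
    -- c_{d+1}`.
    have h1 := ((ih c).shift h).add ((ih c).const_mul (-1))
    have h2 := ih (fun j => c (d + 1) * ((d + 1).choose j * (h : ℝ) ^ (d + 1 - j)))
    convert h1.add h2 using 1
    · have : d + 1 - d = 1 := by lia
      simp only [this, Nat.choose_succ_self_right]
      push_cast; ring
    · ext x
      beta_reduce
      rw [sum_range_succ _ (d + 1), sum_range_succ _ (d + 1)]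
      have h3 : ((x + h : ℤ) : ℝ) ^ (d + 1) =
          ∑ j ∈ range (d + 1), (x : ℝ) ^ j * (h : ℝ) ^ (d + 1 - j) * (d + 1).choose j
            + (x : ℝ) ^ (d + 1) := by
        push_cast
        rw [add_pow, sum_range_succ]
        simp
      rw [h3, mul_add, mul_sum]
      have h4 : ∑ j ∈ range (d + 1), c (d + 1) * ((x : ℝ) ^ j * (h : ℝ) ^ (d + 1 - j) * (d + 1).choose j) =
          ∑ j ∈ range (d + 1), c (d + 1) * ((d + 1).choose j * (h : ℝ) ^ (d + 1 - j)) * (x : ℝ) ^ j :=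
        sum_congr rfl fun j _ => by ring
      rw [h4]
      ring

/-- Weyl differencing: expand the square and group pairs by their difference `h`. -/
theorem norm_sq_sum_e_le (f : ℤ → ℝ) (A B : ℤ) (N : ℕ) (hN : B - A ≤ N) :
    ‖∑ x ∈ Ico A B, e (f x)‖ ^ 2 ≤ ∑ h ∈ Ico (-(N : ℤ)) N,
      ‖∑ x ∈ Ico (max A (A - h)) (min B (B - h)), e (f (x + h) - f x)‖ := by
  have h1 : ((‖∑ x ∈ Ico A B, e (f x)‖ ^ 2 : ℝ) : ℂ) =
      ∑ p ∈ Ico A B ×ˢ Ico A B, e (f p.2 - f p.1) := by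
    rw [← Complex.normSq_eq_norm_sq, Complex.normSq_eq_conj_mul_self, map_sum, sum_product]
    rw [sum_mul_sum]
    refine sum_congr rfl fun x _ => sum_congr rfl fun y _ => ?_
    rw [conj_e, ← e_add]; congr 1; ring
  have hmap : ∀ p ∈ Ico A B ×ˢ Ico A B, p.2 - p.1 ∈ Ico (-(N : ℤ)) N := by
    intro p hp
    simp only [mem_product, mem_Ico] at hp ⊢
    lia
  rw [← sum_fiberwise_of_maps_to hmap] at h1
  have h2 : ∀ h ∈ Ico (-(N : ℤ)) N, ∑ p ∈ Ico A B ×ˢ Ico A B with p.2 - p.1 = h, e (f p.2 - f p.1) =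
      ∑ x ∈ Ico (max A (A - h)) (min B (B - h)), e (f (x + h) - f x) := by
    intro h _
    refine sum_bij' (fun p _ => p.1) (fun x _ => (x, x + h)) ?_ ?_ ?_ ?_ ?_
    · intro p hp
      simp only [mem_filter, mem_product, mem_Ico] at hp ⊢
      lia
    · intro x hx
      simp only [mem_filter, mem_product, mem_Ico] at hx ⊢
      lia
    · intro p hp
      simp only [mem_filter] at hp
      ext <;> simp; lia
    · intro x hx; rfl
    · intro p hp
      simp only [mem_filter] at hp
      have : p.1 + h = p.2 := by lia
      rw [this]
  rw [sum_congr rfl h2] at h1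
  have h3 : ‖((‖∑ x ∈ Ico A B, e (f x)‖ ^ 2 : ℝ) : ℂ)‖ = ‖∑ x ∈ Ico A B, e (f x)‖ ^ 2 := by
    rw [Complex.norm_real, Real.norm_eq_abs, abs_of_nonneg (by positivity)]
  rw [← h3, h1]
  exact norm_sum_le _ _

theorem norm_sum_e_le_card {ι : Type*} (s : Finset ι) (f : ι → ℝ) :
    ‖∑ x ∈ s, e (f x)‖ ≤ s.card := by
  refine (norm_sum_le _ _).trans ?_
  simp only [norm_e, sum_const, nsmul_eq_mul, mul_one, le_refl]

/-- Weyl's inequality in inverse form, for the leading coefficient. -/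
theorem weyl_lead (d : ℕ) : ∃ K : ℝ, 1 ≤ K ∧ ∃ C : ℕ, ∀ (f : ℤ → ℝ) (α : ℝ), PolyLead (d + 1) α f →
    ∀ (A B : ℤ) (N : ℕ) (H : ℝ), 1 ≤ N → B - A ≤ N → 1 ≤ H →
      N / H ≤ ‖∑ x ∈ Ico A B, e (f x)‖ → Major (K * H ^ C) (N ^ (d + 1)) α := by
  induction d with
  | zero =>
    refine ⟨1, le_rfl, 1, fun f α hf A B N H hN hAB hH hS => ?_⟩
    have hN' : (1 : ℝ) ≤ N := by exact_mod_cast hN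
    have hf' : ∀ x : ℤ, f x = α * x + f 0 := by
      intro x
      have := hf x 0
      simp only [zero_add] at this
      push_cast at this
      linarith
    rw [sum_congr rfl fun x _ => by rw [hf' x]] at hS
    have := near_of_le_norm_sum_e (by positivity) hS
    refine ⟨1, le_rfl, by simpa using hH, ?_⟩
    rw [Nat.cast_one, one_mul, one_mul]
    refine this.mono ?_
    have e1 : 1 / (2 * ((N : ℝ) / H)) = H / (2 * N) := by field_simp
    rw [e1]
    simp only [zero_add, pow_one]
    gcongr
    linarith
  | succ d ih =>
    obtain ⟨K, hK, C, ih⟩ := ih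
    refine ⟨(2048 * K ^ 3 * 4 ^ (3 * C)) ^ (d + 2) * (K * 4 ^ C * (d + 2)), ?_,
      (4 + 6 * C) * (d + 2) + 2 * C, fun f α hf A B N H hN hAB hH hS => ?_⟩
    · have h1 : (1 : ℝ) ≤ K ^ 3 := one_le_pow₀ hK
      have h2 : (1 : ℝ) ≤ 4 ^ (3 * C) := one_le_pow₀ (by norm_num)
      have h3 : (1 : ℝ) ≤ 4 ^ C := one_le_pow₀ (by norm_num)
      have h4 : (1 : ℝ) ≤ 2048 * K ^ 3 * 4 ^ (3 * C) :=
        one_le_mul_of_one_le_of_one_le (by linarith) h2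
      have h5 : (1 : ℝ) ≤ d + 2 := by have : (0 : ℝ) ≤ d := Nat.cast_nonneg d; linarith
      exact one_le_mul_of_one_le_of_one_le (one_le_pow₀ h4)
        (one_le_mul_of_one_le_of_one_le (one_le_mul_of_one_le_of_one_le hK h3) h5)
    have hN' : (1 : ℝ) ≤ N := by exact_mod_cast hN
    have hH2 : 1 ≤ H ^ 2 := one_le_pow₀ hH
    set X : ℝ := K * (4 * H ^ 2) ^ C with hX
    have hX1 : 1 ≤ X := one_le_mul_of_one_le_of_one_le hK (one_le_pow₀ (by linarith))
    let g : ℤ → ℝ := fun h => ‖∑ x ∈ Ico (max A (A - h)) (min B (B - h)), e (f (x + h) - f x)‖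
    have hsum : (N : ℝ) ^ 2 / H ^ 2 ≤ ∑ h ∈ Ico (-(N : ℤ)) N, g h := by
      refine le_trans ?_ (norm_sq_sum_e_le f A B N hAB)
      rw [← div_pow]
      gcongr
    have hgN : ∀ h ∈ Ico (-(N : ℤ)) N, g h ≤ N := by
      intro h _
      refine (norm_sum_e_le_card _ _).trans ?_
      rw [Int.card_Ico]
      exact_mod_cast (by lia)
    -- The threshold is half the average: the `2N` shifts below it contribute at most half of `N ^ 2
    -- / H ^ 2`.
    set Hs := (Ico (-(N : ℤ)) N).filter fun h => N / (4 * H ^ 2) ≤ g h with hHs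
    have hcard : (N : ℝ) / (2 * H ^ 2) ≤ Hs.card := by
      have h1 := card_large_mul_ge (t := N / (4 * H ^ 2)) _ g hgN (by positivity) hsum
      have h2 : ((Ico (-(N : ℤ)) N).card : ℝ) = 2 * N := by
        rw [Int.card_Ico]
        have : ((N : ℤ) - -(N : ℤ)).toNat = 2 * N := by lia
        rw [this]; push_cast; ring
      rw [h2] at h1
      have h3 : (N : ℝ) ^ 2 / H ^ 2 - 2 * N * (N / (4 * H ^ 2)) = N / (2 * H ^ 2) * N := by
        field_simp; ring
      rw [h3] at h1
      exact le_of_mul_le_mul_right h1 (by linarith)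
    have hmaj : ∀ h ∈ Hs, ∃ q : ℕ, 1 ≤ q ∧ (q : ℝ) ≤ X ∧
        Near (X / N ^ (d + 1)) (q * (((d + 1 : ℕ) + 1) * α * h)) := by
      intro h hh
      obtain ⟨h1, h2⟩ := mem_filter.1 hh
      exact ih _ _ (hf h) _ _ N (4 * H ^ 2) hN (by lia) (by linarith) h2
    choose! Q hQ1 hQX hQ using hmaj
    have hmap : ∀ h ∈ Hs, Q h ∈ Icc 1 ⌊X⌋₊ := by
      intro h hh
      rw [mem_Icc]
      exact ⟨hQ1 h hh, Nat.le_floor (hQX h hh)⟩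
    -- By induction each good shift `h` makes `(d + 2) α h` major with its own denominator `Q h ≤
    -- X`. Pigeonholing fixes one denominator `q` at the cost of a factor `X` in density, after
    -- which `q (d + 2) α` recurs along the shifts.
    obtain ⟨q, hq, hfib⟩ := exists_le_card_fiber_of_nsmul_le_card_of_maps_to
      (b := (N : ℝ) / (2 * H ^ 2 * X)) hmap ⟨1, by
        rw [mem_Icc]; exact ⟨le_rfl, Nat.le_floor (by simpa using hX1)⟩⟩ (by
        rw [Nat.card_Icc, nsmul_eq_mul, Nat.add_sub_cancel]
        calc (⌊X⌋₊ : ℝ) * (N / (2 * H ^ 2 * X)) ≤ X * (N / (2 * H ^ 2 * X)) := by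
              gcongr; exact Nat.floor_le (by linarith)
          _ = N / (2 * H ^ 2) := by field_simp
          _ ≤ _ := hcard)
    rw [mem_Icc] at hq
    have hqX : (q : ℝ) ≤ X := le_trans (by exact_mod_cast hq.2) (Nat.floor_le (by linarith))
    have hrec := major_of_recurrence (Y := Hs.filter fun h => Q h = q) (A := -(N : ℤ)) (N := 2 * N)
      (i := d + 1) (j := 1) (P := N) (H := 4 * H ^ 2 * X) (X := X)
      (β := q * (((d + 1 : ℕ) + 1) * α)) (c := 0)
      (by nlinarith) hX1 hN' (by lia) le_rfl (by push_cast; linarith)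
      (by
        intro y hy
        have := (mem_filter.1 ((mem_filter.1 hy).1)).1
        simp only [mem_Ico] at this ⊢
        push_cast; lia)
      (by
        refine le_trans (le_of_eq ?_) hfib
        push_cast; field_simp; norm_num)
      (by
        intro y hy
        obtain ⟨h1, h2⟩ := mem_filter.1 hy
        have := hQ y h1
        rw [h2] at this
        convert this using 1
        ring)
    have h1 : (q : ℝ) * (((d + 1 : ℕ) + 1) * α) = ((q * (d + 2) : ℕ) : ℝ) * α := by
      push_cast; ring
    rw [h1] at hrec
    have h2 := hrec.of_nat_mul (Z := X * (d + 2)) (by nlinarith) (by push_cast; gcongr) (by positivity)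
    convert h2 using 1
    rw [hX]
    have e1 : (4 * H ^ 2 : ℝ) ^ C = 4 ^ C * H ^ (2 * C) := by rw [mul_pow, pow_mul]
    rw [e1]
    have e2 : (128 * (4 * H ^ 2 * (K * (4 ^ C * H ^ (2 * C)))) ^ 2 * (K * (4 ^ C * H ^ (2 * C))) : ℝ) =
        2048 * K ^ 3 * 4 ^ (3 * C) * H ^ (4 + 6 * C) := by ring
    rw [e2, mul_pow _ (H ^ (4 + 6 * C)), ← pow_mul, pow_add, add_assoc]
    ring

theorem abs_pow_sub_pow_le_mul {a b R : ℝ} (ha : |a| ≤ R) (hb : |b| ≤ R) (n : ℕ) :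
    |a ^ (n + 1) - b ^ (n + 1)| ≤ (n + 1) * R ^ n * |a - b| := by
  have hR : 0 ≤ R := (abs_nonneg a).trans ha
  induction n with
  | zero => simp
  | succ n ih =>
    have h1 : a ^ (n + 1 + 1) - b ^ (n + 1 + 1) =
        a * (a ^ (n + 1) - b ^ (n + 1)) + b ^ (n + 1) * (a - b) := by ring
    rw [h1]
    calc _ ≤ |a| * |a ^ (n + 1) - b ^ (n + 1)| + |b| ^ (n + 1) * |a - b| := by
          refine (abs_add_le _ _).trans ?_
          rw [abs_mul, abs_mul, abs_pow]
      _ ≤ R * ((n + 1) * R ^ n * |a - b|) + R ^ (n + 1) * |a - b| := by gcongr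
      _ = _ := by push_cast; ring

end

/-! ### Weyl's inequality for all coefficients -/

section

theorem norm_e_sub_e_le (x y : ℝ) : ‖e x - e y‖ ≤ 2 * Real.pi * |x - y| := by
  have : e x - e y = e y * (e (x - y) - 1) := by
    rw [mul_sub, ← e_add, mul_one, add_sub_cancel]
  rw [this, norm_mul, norm_e, one_mul]
  exact norm_e_sub_one_le _

theorem Small.sum_periodic {Q : ℕ} (hQ : 1 ≤ Q) {a b : ℤ} {w : ℤ → ℂ} {B : ℝ}
    (hw : Small Q a b w B) (g : ℤ → ℂ) (hg : ∀ x, ‖g x‖ ≤ 1) (hper : ∀ x, g (x % Q) = g x) :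
    ‖∑ x ∈ Ico a b, g x * w x‖ ≤ Q * B := by
  have hmap : ∀ x ∈ Ico a b, x % (Q : ℤ) ∈ Ico (0 : ℤ) Q := by
    intro x _
    rw [mem_Ico]
    exact ⟨Int.emod_nonneg _ (by lia), Int.emod_lt_of_pos _ (by lia)⟩
  rw [← sum_fiberwise_of_maps_to hmap]
  calc _ ≤ ∑ c ∈ Ico (0 : ℤ) Q, B := by
        refine (norm_sum_le _ _).trans (sum_le_sum fun c hc => ?_)
        have h1 : ∑ x ∈ Ico a b with x % Q = c, g x * w x =
            g c * ∑ x ∈ Ico a b with x % Q = c % Q, w x := by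
          rw [mem_Ico] at hc
          rw [mul_sum, Int.emod_eq_of_lt hc.1 hc.2]
          refine sum_congr rfl fun x hx => ?_
          rw [← hper x, (mem_filter.1 hx).2]
        rw [h1, norm_mul]
        calc _ ≤ 1 * B := mul_le_mul (hg c) (hw.residue hQ c) (norm_nonneg _) zero_le_one
          _ = B := one_mul B
    _ = Q * B := by simp

/-- The derivative of `κ x ^ (m+1)` is at most `|κ| (m+1) P ^ m` on an interval of length about
`2P`. -/
theorem bvle_e_pow {P m : ℕ} {A B : ℤ} {κ : ℝ} (hA : -(P : ℤ) ≤ A) (hB : B ≤ P + 1) :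
    BVle A B (fun x => e (κ * (x : ℝ) ^ (m + 1)))
      (1 + 4 * Real.pi * (m + 1) * (|κ| * P ^ (m + 1))) := by
  intro x _
  rw [norm_e]
  gcongr
  calc _ ≤ ∑ y ∈ Ico A (B - 1), 2 * Real.pi * (|κ| * ((m + 1) * P ^ m)) := by
        refine sum_le_sum fun y hy => (norm_e_sub_e_le _ _).trans ?_
        rw [mem_Ico] at hy
        rw [← mul_sub, abs_mul]
        have h1 : |((y + 1 : ℤ) : ℝ)| ≤ P := by
          rw [← Int.cast_abs]; exact_mod_cast abs_le.2 ⟨by lia, by lia⟩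
        have h2 : |(y : ℝ)| ≤ P := by
          rw [← Int.cast_abs]; exact_mod_cast abs_le.2 ⟨by lia, by lia⟩
        have h3 := abs_pow_sub_pow_le_mul h1 h2 m
        have h4 : |((y + 1 : ℤ) : ℝ) - y| = 1 := by push_cast; simp
        rw [h4, mul_one] at h3
        gcongr
    _ = (Ico A (B - 1)).card * (2 * Real.pi * (|κ| * ((m + 1) * P ^ m))) := by
        rw [sum_const, nsmul_eq_mul]
    _ ≤ (2 * P : ℝ) * (2 * Real.pi * (|κ| * ((m + 1) * P ^ m))) := by
        have : ((Ico A (B - 1)).card : ℝ) ≤ 2 * P := by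
          rw [Int.card_Ico]; exact_mod_cast (by lia)
        gcongr
    _ = _ := by ring

/-- Weyl's inequality in inverse form: a large exponential sum forces every nonconstant coefficient
to be close to a rational with small denominator. -/
theorem weyl_coeff (d : ℕ) : ∃ K : ℝ, 1 ≤ K ∧ ∃ C : ℕ, ∀ (c : ℕ → ℝ) (P : ℕ) (A B : ℤ) (H : ℝ),
    1 ≤ P → -(P : ℤ) ≤ A → B ≤ P + 1 → 1 ≤ H →
    P / H ≤ ‖∑ x ∈ Ico A B, e (∑ k ∈ range (d + 1), c k * (x : ℝ) ^ k)‖ →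
    ∀ l, 1 ≤ l → l ≤ d → Major (K * H ^ C) (P ^ l) (c l) := by
  induction d with
  | zero => exact ⟨1, le_rfl, 0, fun c P A B H _ _ _ _ _ l h1 h2 => by lia⟩
  | succ d ih =>
    obtain ⟨K₀, hK₀, C₀, ih⟩ := ih
    obtain ⟨K₁, hK₁, C₁, hlead⟩ := weyl_lead d
    set κ₁ : ℝ := K₁ * 3 ^ C₁ with hκ₁
    have hκ₁1 : 1 ≤ κ₁ := one_le_mul_of_one_le_of_one_le hK₁ (one_le_pow₀ (by norm_num))
    set M : ℝ := 2 * (1 + 4 * Real.pi * (d + 1)) with hM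
    have hM1 : 1 ≤ M := by
      rw [hM]
      have := Real.pi_pos
      have : 0 ≤ 4 * Real.pi * ((d : ℝ) + 1) := by positivity
      linarith
    refine ⟨K₀ * (M * κ₁ ^ 2) ^ C₀ * κ₁, ?_, (1 + 2 * C₁) * C₀ + C₁, ?_⟩
    · exact one_le_mul_of_one_le_of_one_le (one_le_mul_of_one_le_of_one_le hK₀
        (one_le_pow₀ (one_le_mul_of_one_le_of_one_le hM1 (one_le_pow₀ hκ₁1)))) hκ₁1
    intro c P A B H hP hA hB hH hS l hl1 hl2
    have hP' : (1 : ℝ) ≤ P := by exact_mod_cast hP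
    set X : ℝ := κ₁ * H ^ C₁ with hX
    have hX1 : 1 ≤ X := one_le_mul_of_one_le_of_one_le hκ₁1 (one_le_pow₀ hH)
    have htop : Major X (P ^ (d + 1)) (c (d + 1)) := by
      -- The interval has up to `2P + 1 ≤ 3P` points; scaling `H` by `3` as well leaves the lower
      -- bound `P / H` unchanged.
      have h1 := hlead _ _ (polyLead_sum c) A B (3 * P) (3 * H) (by lia) (by push_cast; lia)
        (by linarith) (by
          refine le_trans (le_of_eq ?_) hS
          push_cast; field_simp)
      have h2 : K₁ * (3 * H) ^ C₁ = X := by rw [hX, hκ₁, mul_pow]; ring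
      rw [h2] at h1
      obtain ⟨q, g1, g2, g3⟩ := h1
      refine ⟨q, g1, g2, g3.mono ?_⟩
      push_cast
      gcongr
      linarith
    have hXfin : X ≤ K₀ * (M * κ₁ ^ 2) ^ C₀ * κ₁ * H ^ ((1 + 2 * C₁) * C₀ + C₁) := by
      have h1 : 1 ≤ K₀ * (M * κ₁ ^ 2) ^ C₀ := one_le_mul_of_one_le_of_one_le hK₀
        (one_le_pow₀ (one_le_mul_of_one_le_of_one_le hM1 (one_le_pow₀ hκ₁1)))
      calc X = 1 * κ₁ * H ^ C₁ := by rw [hX]; ring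
        _ ≤ K₀ * (M * κ₁ ^ 2) ^ C₀ * κ₁ * H ^ ((1 + 2 * C₁) * C₀ + C₁) := by
            gcongr
            lia
    rcases hl2.eq_or_lt with rfl | hl
    · exact htop.mono hXfin (by positivity)
    obtain ⟨q, hq1, hqX, a, ha⟩ := htop
    have hq0 : (0 : ℝ) < q := by exact_mod_cast hq1
    have hq1' : (1 : ℝ) ≤ q := by exact_mod_cast hq1
    set κ : ℝ := c (d + 1) - a / q with hκ
    have hκP : |κ| * P ^ (d + 1) ≤ X := by
      have h1 : κ = (q * c (d + 1) - a) / q := by rw [hκ]; field_simp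
      rw [h1, abs_div, abs_of_pos hq0]
      rw [le_div_iff₀ (by positivity)] at ha
      calc |q * c (d + 1) - a| / q * P ^ (d + 1) ≤ |q * c (d + 1) - a| / 1 * P ^ (d + 1) := by
            gcongr
        _ ≤ X := by rw [div_one]; exact ha
    -- One factor `X` pays for the `q` residue classes, another (with a constant) for the variation
    -- of `e (κ x ^ (d+1))`. The `2` in `M` makes the contradiction strict.
    set H' : ℝ := M * H * X ^ 2 with hH'
    have hH'1 : 1 ≤ H' := one_le_mul_of_one_le_of_one_le (one_le_mul_of_one_le_of_one_le hM1 hH)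
      (one_le_pow₀ hX1)
    -- With `c (d+1) = a/q + κ` the top term is a `q`-periodic factor times a slowly varying one. If
    -- all twisted subinterval sums of the degree-`d` polynomial were small, the original sum would
    -- be too.
    obtain ⟨k, a', b', haa, hbb, hbig⟩ : ∃ (k a' b' : ℤ), A ≤ a' ∧ b' ≤ B ∧ P / H' ≤
        ‖∑ x ∈ Ico a' b', e (∑ k ∈ range (d + 1), c k * (x : ℝ) ^ k) * e (k / q * x)‖ := by
      by_contra! hcon
      have hsm : Small q A B (fun x => e (∑ k ∈ range (d + 1), c k * (x : ℝ) ^ k)) (P / H') :=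
        fun a' b' h1 h2 k => (hcon k a' b' h1 h2).le
      have h1 := (hsm.mul_bv (by positivity) (bvle_e_pow (m := d) (κ := κ) hA hB)).sum_periodic hq1
        (fun x => e (a * (x : ℝ) ^ (d + 1) / q)) (fun x => (norm_e _).le) (by
          intro x
          have h2 := Int.mul_ediv_add_emod x q
          obtain ⟨z, hz⟩ : (q : ℤ) ∣ x ^ (d + 1) - (x % q) ^ (d + 1) :=
            dvd_trans ⟨x / q, by linarith⟩ (sub_dvd_pow_sub_pow x (x % q) (d + 1))
          have h3 : (a * (x : ℝ) ^ (d + 1) / q) = a * ((x % q : ℤ) : ℝ) ^ (d + 1) / q + (a * z : ℤ) := by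
            have : ((x ^ (d + 1) - (x % q) ^ (d + 1) : ℤ) : ℝ) = ((q * z : ℤ) : ℝ) := by rw [hz]
            push_cast at this
            push_cast
            field_simp
            linear_combination (a : ℝ) * this
          rw [h3, e_add_int])
      have h2 : ∑ x ∈ Ico A B, e (∑ k ∈ range (d + 1 + 1), c k * (x : ℝ) ^ k) =
          ∑ x ∈ Ico A B, e (a * (x : ℝ) ^ (d + 1) / q) * (e (κ * (x : ℝ) ^ (d + 1)) *
            e (∑ k ∈ range (d + 1), c k * (x : ℝ) ^ k)) := by
        refine sum_congr rfl fun x _ => ?_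
        rw [← e_add, ← e_add, sum_range_succ _ (d + 1), hκ]
        congr 1; ring
      rw [← h2] at h1
      have h3 := hS.trans h1
      have hpi := Real.pi_pos
      have h4 : (q : ℝ) * ((1 + 4 * Real.pi * (d + 1) * (|κ| * P ^ (d + 1))) * (P / H')) ≤
          X * ((X * (1 + 4 * Real.pi * (d + 1))) * (P / H')) := by
        gcongr
        calc 1 + 4 * Real.pi * (d + 1) * (|κ| * P ^ (d + 1)) ≤ X + 4 * Real.pi * (d + 1) * X := by
              gcongr
          _ = _ := by ring
      have h5 : X * ((X * (1 + 4 * Real.pi * (d + 1))) * (P / H')) = P / H / 2 := by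
        rw [hH', hM]
        have : 0 < 1 + 4 * Real.pi * ((d : ℝ) + 1) := by positivity
        field_simp
      have h6 : 0 < (P : ℝ) / H := by positivity
      linarith
    -- The twist only moves the linear coefficient, and by a fraction with denominator `q ≤ X`, so
    -- it costs one more factor `X` in `Major.of_add_div`.
    let c' : ℕ → ℝ := fun j => c j + if j = 1 then (k : ℝ) / q else 0
    have hc' : ∀ x : ℤ, e (∑ j ∈ range (d + 1), c j * (x : ℝ) ^ j) * e (k / q * x) =
        e (∑ j ∈ range (d + 1), c' j * (x : ℝ) ^ j) := by
      intro x
      rw [← e_add]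
      congr 1
      simp only [c', add_mul, sum_add_distrib, ite_mul, zero_mul, sum_ite_eq', pow_one]
      rw [if_pos (by rw [mem_range]; lia)]
    simp only [hc'] at hbig
    have hfin := ih c' P a' b' H' hP (by lia) (by lia) hH'1 hbig l hl1 (by lia)
    have hfin' : Major (K₀ * H' ^ C₀) (P ^ l) (c l + ((if l = 1 then k else 0 : ℤ) : ℝ) / q) := by
      convert hfin using 1
      simp only [c']
      split_ifs <;> simp
    convert hfin'.of_add_div hq1 hqX (by positivity) using 1
    rw [hH', hX]
    have e1 : M * H * (κ₁ * H ^ C₁) ^ 2 = M * κ₁ ^ 2 * H ^ (1 + 2 * C₁) := by ring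
    rw [e1, mul_pow _ (H ^ (1 + 2 * C₁)), ← pow_mul, pow_add]
    ring

end

/-! ### A mean value estimate from counting large Weyl sums -/

section

/-- Dyadic decomposition by the size of `t i`. The exponent `C + 1` exceeds the growth exponent of
the level sets by one, so the level of size about `2 ^ (-m)` contributes `O(2 ^ (-m))`. -/
theorem sum_pow_le_of_card_le {ι : Type*} (s : Finset ι) (t : ι → ℝ) (h0 : ∀ i ∈ s, 0 ≤ t i)
    (h1 : ∀ i ∈ s, t i ≤ 1) {K : ℝ} {C : ℕ}
    (hcard : ∀ H : ℝ, 1 ≤ H → ((s.filter fun i => 1 / H ≤ t i).card : ℝ) ≤ K * H ^ C) :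
    ∑ i ∈ s, t i ^ (C + 1) ≤ K * 2 ^ (C + 1) := by
  have hK : 0 ≤ K := by
    have := hcard 1 le_rfl
    simp only [one_pow, mul_one] at this
    exact le_trans (Nat.cast_nonneg _) this
  have hsub : ∑ i ∈ s, t i ^ (C + 1) = ∑ i ∈ s with 0 < t i, t i ^ (C + 1) := by
    rw [sum_filter]
    refine sum_congr rfl fun i hi => ?_
    split_ifs with h
    · rfl
    · rw [le_antisymm (not_lt.1 h) (h0 i hi)]; simp
  have hn : ∀ i ∈ s.filter (fun i => 0 < t i), ∃ n : ℕ, (1 / 2 : ℝ) ^ (n + 1) < t i ∧ t i ≤ (1 / 2) ^ n := by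
    intro i hi
    obtain ⟨hi1, hi2⟩ := mem_filter.1 hi
    exact exists_nat_pow_near_of_lt_one hi2 (h1 i hi1) (by norm_num) (by norm_num)
  choose! n hn1 hn2 using hn
  rw [hsub, ← sum_fiberwise_of_maps_to (t := (s.filter (fun i => 0 < t i)).image n)
    (fun i hi => mem_image_of_mem n hi)]
  calc _ ≤ ∑ m ∈ (s.filter (fun i => 0 < t i)).image n, K * 2 ^ C * (1 / 2 : ℝ) ^ m := by
        refine sum_le_sum fun m _ => ?_
        calc _ ≤ ∑ i ∈ s with 1 / (2 : ℝ) ^ (m + 1) ≤ t i, ((1 / 2 : ℝ) ^ m) ^ (C + 1) := by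
              refine (sum_le_sum (g := fun _ => ((1 / 2 : ℝ) ^ m) ^ (C + 1)) fun i hi => ?_).trans
                (sum_le_sum_of_subset_of_nonneg ?_ fun _ _ _ => by positivity)
              · obtain ⟨hi1, hi2⟩ := mem_filter.1 hi
                have := hn2 i hi1
                rw [hi2] at this
                exact pow_le_pow_left₀ (mem_filter.1 hi1).2.le this _
              · intro i hi
                obtain ⟨hi1, hi2⟩ := mem_filter.1 hi
                have := hn1 i hi1
                rw [hi2] at this
                rw [mem_filter]
                refine ⟨(mem_filter.1 hi1).1, ?_⟩
                rw [← one_div_pow]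
                exact this.le
          _ = ((s.filter fun i => 1 / (2 : ℝ) ^ (m + 1) ≤ t i).card : ℝ) * ((1 / 2 : ℝ) ^ m) ^ (C + 1) := by
              rw [sum_const, nsmul_eq_mul]
          _ ≤ (K * (2 ^ (m + 1)) ^ C) * ((1 / 2 : ℝ) ^ m) ^ (C + 1) := by
              gcongr
              exact hcard _ (one_le_pow₀ (by norm_num))
          _ = K * 2 ^ C * (1 / 2 : ℝ) ^ m := by
              rw [one_div_pow, one_div_pow, pow_succ 2 m, mul_pow, ← pow_mul, ← pow_mul,
                mul_add, mul_one, pow_add]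
              field_simp
    _ = K * 2 ^ C * ∑ m ∈ (s.filter (fun i => 0 < t i)).image n, (1 / 2 : ℝ) ^ m := by
        rw [mul_sum]
    _ ≤ K * 2 ^ C * 2 := by
        gcongr
        refine le_trans ?_ tsum_geometric_two.le
        exact summable_geometric_two.sum_le_tsum _ fun _ _ => by positivity
    _ = _ := by ring

-- If `q (k/N)` is within `X/N` of `a`, then `k` is determined by the triple `(q, a, qk - aN)`, and
-- each entry takes `O(X)` values.
open Classical in
theorem card_major_le (N : ℕ) (hN : 1 ≤ N) {X : ℝ} (hX : 1 ≤ X) :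
    (((range N).filter fun k : ℕ => Major X N (k / N)).card : ℝ) ≤ 15 * X ^ 3 := by
  have hN' : (1 : ℝ) ≤ N := by exact_mod_cast hN
  have hex : ∀ k ∈ (range N).filter (fun k : ℕ => Major X N (k / N)),
      ∃ q : ℕ, ∃ a : ℤ, 1 ≤ q ∧ (q : ℝ) ≤ X ∧ |((q * k - a * N : ℤ) : ℝ)| ≤ X := by
    intro k hk
    obtain ⟨q, h1, h2, a, ha⟩ := (mem_filter.1 hk).2
    refine ⟨q, a, h1, h2, ?_⟩
    have : ((q * k - a * N : ℤ) : ℝ) = (q * (k / N) - a) * N := by push_cast; field_simp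
    rw [this, abs_mul, Nat.abs_cast]
    rwa [le_div_iff₀ (by linarith)] at ha
  choose! q a hq1 hqX hqa using hex
  let T : Finset (ℕ × ℤ × ℤ) := Icc 1 ⌊X⌋₊ ×ˢ (Icc (-⌊2 * X⌋) ⌊2 * X⌋ ×ˢ Icc (-⌊X⌋) ⌊X⌋)
  have habs : ∀ (z : ℤ) (Y : ℝ), |(z : ℝ)| ≤ Y → z ∈ Icc (-⌊Y⌋) ⌊Y⌋ := by
    intro z Y h
    rw [mem_Icc]
    obtain ⟨h1, h2⟩ := abs_le.1 h
    refine ⟨?_, Int.le_floor.2 h2⟩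
    have : -z ≤ ⌊Y⌋ := Int.le_floor.2 (by push_cast; linarith)
    lia
  have hcard : ((range N).filter fun k : ℕ => Major X N (k / N)).card ≤ T.card := by
    refine card_le_card_of_injOn (fun k => (q k, a k, (q k : ℤ) * k - a k * N)) ?_ ?_
    · intro k hk
      have hkN : k < N := mem_range.1 (mem_filter.1 hk).1
      have g1 := hq1 k hk
      have g2 := hqX k hk
      have g3 := hqa k hk
      simp only [T, mem_coe, mem_product]
      refine ⟨mem_Icc.2 ⟨g1, Nat.le_floor g2⟩, habs _ _ ?_, habs _ _ g3⟩
      have h3 : |(a k : ℝ)| * N ≤ 2 * X * N := by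
        have : (a k : ℝ) * N = q k * k - ((q k * k - a k * N : ℤ) : ℝ) := by push_cast; ring
        calc |(a k : ℝ)| * N = |(a k : ℝ) * N| := by rw [abs_mul, Nat.abs_cast]
          _ ≤ |(q k : ℝ) * k| + |((q k * k - a k * N : ℤ) : ℝ)| := by rw [this]; exact abs_sub _ _
          _ ≤ X * N + X * N := by
              rw [abs_mul, Nat.abs_cast, Nat.abs_cast]
              have : (k : ℝ) ≤ N := by exact_mod_cast hkN.le
              gcongr
              exact g3.trans (by nlinarith)
          _ = _ := by ring
      exact le_of_mul_le_mul_right h3 (by linarith)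
    · intro k hk k' _ h
      simp only [Prod.mk.injEq] at h
      obtain ⟨h1, h2, h3⟩ := h
      rw [← h1, ← h2] at h3
      have h4 : (q k : ℤ) * k = q k * k' := by linarith
      have h5 : (q k : ℤ) ≠ 0 := by have := hq1 k hk; lia
      exact_mod_cast mul_left_cancel₀ h5 h4
  have hfl : ∀ Y : ℝ, 0 ≤ Y → ((Icc (-⌊Y⌋) ⌊Y⌋).card : ℝ) ≤ 2 * Y + 1 := by
    intro Y hY
    have h0 : 0 ≤ ⌊Y⌋ := Int.floor_nonneg.2 hY
    rw [Int.card_Icc]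
    have h1 : (((⌊Y⌋ + 1 - -⌊Y⌋).toNat : ℤ) : ℝ) = 2 * ⌊Y⌋ + 1 := by
      rw [Int.toNat_of_nonneg (by lia)]; push_cast; ring
    have h2 : ((⌊Y⌋ + 1 - -⌊Y⌋).toNat : ℝ) = 2 * ⌊Y⌋ + 1 := by exact_mod_cast h1
    rw [h2]
    linarith [Int.floor_le Y]
  calc (((range N).filter fun k : ℕ => Major X N (k / N)).card : ℝ) ≤ T.card := by
        exact_mod_cast hcard
    _ ≤ X * ((2 * (2 * X) + 1) * (2 * X + 1)) := by
        simp only [T, card_product, Nat.card_Icc, Nat.add_sub_cancel]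
        push_cast
        gcongr
        · exact Nat.floor_le (by linarith)
        · exact hfl _ (by linarith)
        · exact hfl _ (by linarith)
    _ ≤ X * ((5 * X) * (3 * X)) := by gcongr <;> linarith
    _ = 15 * X ^ 3 := by ring

/-- The moment curve `n ↦ (n, n², …, n^d)`. -/
def curve (d : ℕ) (n : ℤ) : Fin d → ℤ := fun l => n ^ ((l : ℕ) + 1)

/-- The exponential sum `∑_{|n| ≤ P} e(∑ k_l n^l / P^l)`. -/
noncomputable def curveSum (d P : ℕ) (k : Fin d → ℕ) : ℂ :=
  ∑ n ∈ Ico (-(P : ℤ)) (P + 1), e (∑ l : Fin d, (k l : ℝ) / P ^ ((l : ℕ) + 1) * curve d n l)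

/-- By `weyl_coeff` a large sum makes every `k l / P ^ (l+1)` major, and `card_major_le` counts
these coordinate by coordinate with a bound free of `P`. -/
theorem card_curveSum_large (d : ℕ) : ∃ K : ℝ, ∃ C : ℕ, ∀ (P : ℕ) (H : ℝ), 1 ≤ P → 1 ≤ H →
    (((Fintype.piFinset fun l : Fin d => range (P ^ ((l : ℕ) + 1))).filter
      fun k => P / H ≤ ‖curveSum d P k‖).card : ℝ) ≤ K * H ^ C := by
  obtain ⟨K, hK, C, hW⟩ := weyl_coeff d
  refine ⟨(15 * K ^ 3) ^ d, 3 * C * d, fun P H hP hH => ?_⟩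
  classical
  set X := K * H ^ C with hX
  have hX1 : 1 ≤ X := one_le_mul_of_one_le_of_one_le hK (one_le_pow₀ hH)
  have hsub : ((Fintype.piFinset fun l : Fin d => range (P ^ ((l : ℕ) + 1))).filter
      fun k => P / H ≤ ‖curveSum d P k‖) ⊆ Fintype.piFinset fun l : Fin d =>
        (range (P ^ ((l : ℕ) + 1))).filter
          fun k : ℕ => Major X ((P ^ ((l : ℕ) + 1) : ℕ) : ℝ) (k / ((P ^ ((l : ℕ) + 1) : ℕ) : ℝ)) := by
    intro k hk
    obtain ⟨h1, h2⟩ := mem_filter.1 hk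
    rw [Fintype.mem_piFinset] at h1 ⊢
    intro l
    rw [mem_filter]
    refine ⟨h1 l, ?_⟩
    let c : ℕ → ℝ := fun j => if h : 1 ≤ j ∧ j - 1 < d then (k ⟨j - 1, h.2⟩ : ℝ) / P ^ j else 0
    have hc : ∀ l : Fin d, c (l + 1) = (k l : ℝ) / P ^ ((l : ℕ) + 1) := by
      intro l
      simp [c]
    have hc0 : c 0 = 0 := by simp [c]
    have hsum : curveSum d P k =
        ∑ x ∈ Ico (-(P : ℤ)) (P + 1), e (∑ j ∈ range (d + 1), c j * (x : ℝ) ^ j) := by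
      refine sum_congr rfl fun x _ => ?_
      rw [sum_range_succ', hc0, zero_mul, add_zero, ← Fin.sum_univ_eq_sum_range
        (fun j => c (j + 1) * (x : ℝ) ^ (j + 1))]
      congr 1
      refine sum_congr rfl fun l _ => ?_
      rw [hc, curve]; push_cast; ring
    rw [hsum] at h2
    have := hW c P _ _ H hP le_rfl le_rfl hH h2 (l + 1) (by lia) (by lia)
    rw [hc] at this
    exact_mod_cast this
  calc _ ≤ ((Fintype.piFinset fun l : Fin d => (range (P ^ ((l : ℕ) + 1))).filter
          fun k : ℕ => Major X ((P ^ ((l : ℕ) + 1) : ℕ) : ℝ) (k / ((P ^ ((l : ℕ) + 1) : ℕ) : ℝ))).card : ℝ) := by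
        exact_mod_cast card_le_card hsub
    _ = ∏ l : Fin d, (((range (P ^ ((l : ℕ) + 1))).filter
          fun k : ℕ => Major X ((P ^ ((l : ℕ) + 1) : ℕ) : ℝ) (k / ((P ^ ((l : ℕ) + 1) : ℕ) : ℝ))).card : ℝ) := by
        rw [Fintype.card_piFinset]; push_cast; rfl
    _ ≤ ∏ l : Fin d, (15 * X ^ 3) := by
        refine prod_le_prod (fun _ _ => Nat.cast_nonneg _) fun l _ => ?_
        exact card_major_le _ (Nat.one_le_pow _ _ hP) hX1
    _ = _ := by
        rw [prod_const, card_univ, Fintype.card_fin, hX]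
        rw [show 15 * (K * H ^ C) ^ 3 = 15 * K ^ 3 * H ^ (3 * C) by ring, mul_pow _ (H ^ (3 * C)),
          ← pow_mul]

theorem norm_curveSum_le (d P : ℕ) (hP : 1 ≤ P) (k : Fin d → ℕ) : ‖curveSum d P k‖ ≤ 3 * P := by
  refine (norm_sum_e_le_card _ _).trans ?_
  rw [Int.card_Ico]
  exact_mod_cast (by lia)

theorem curveSum_moment (d : ℕ) : ∃ K : ℝ, ∃ s₀ : ℕ, ∀ (P s : ℕ), 1 ≤ P → s₀ ≤ s →
    ∑ k ∈ Fintype.piFinset fun l : Fin d => range (P ^ ((l : ℕ) + 1)), ‖curveSum d P k‖ ^ s ≤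
      K * (3 * P) ^ s := by
  obtain ⟨K, C, h⟩ := card_curveSum_large d
  refine ⟨K * 2 ^ (C + 1), C + 1, fun P s hP hs => ?_⟩
  have hP' : (1 : ℝ) ≤ P := by exact_mod_cast hP
  have h1 : ∀ k, ‖curveSum d P k‖ / (3 * P) ≤ 1 := fun k => by
    rw [div_le_one (by positivity)]; exact norm_curveSum_le d P hP k
  have h2 := sum_pow_le_of_card_le (Fintype.piFinset fun l : Fin d => range (P ^ ((l : ℕ) + 1)))
    (fun k => ‖curveSum d P k‖ / (3 * P)) (fun _ _ => by positivity) (fun k _ => h1 k) (K := K)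
    (C := C) (by
      intro H hH
      refine le_trans ?_ (h P H hP hH)
      norm_cast
      refine card_le_card (monotone_filter_right _ fun k _ hk => ?_)
      rw [div_le_div_iff₀ (by linarith) (by positivity)] at hk
      show (P : ℝ) / H ≤ _
      rw [div_le_iff₀ (by linarith)]
      push_cast at hk
      linarith)
  calc _ = (∑ k ∈ Fintype.piFinset fun l : Fin d => range (P ^ ((l : ℕ) + 1)),
        (‖curveSum d P k‖ / (3 * P)) ^ s) * (3 * P) ^ s := by
        rw [sum_mul]
        refine sum_congr rfl fun k _ => ?_
        rw [div_pow]; field_simp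
    _ ≤ (∑ k ∈ Fintype.piFinset fun l : Fin d => range (P ^ ((l : ℕ) + 1)),
        (‖curveSum d P k‖ / (3 * P)) ^ (C + 1)) * (3 * P) ^ s := by
        refine mul_le_mul_of_nonneg_right (sum_le_sum fun k _ => ?_) (by positivity)
        exact pow_le_pow_of_le_one (by positivity) (h1 k) hs
    _ ≤ _ := by gcongr

/-- The pairs `(n, m)` with `|n|, |m| ≤ P`. -/
noncomputable def pairBox (P : ℕ) : Finset (ℤ × ℤ) := Ico (-(P : ℤ)) (P + 1) ×ˢ Ico (-(P : ℤ)) (P + 1)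

/-- A Vinogradov-type mean value estimate. -/
theorem vinogradov_count (d : ℕ) : ∃ K : ℝ, 1 ≤ K ∧ ∃ s : ℕ, 1 ≤ s ∧ ∀ (P : ℕ) (Z : Fin d → ℤ), 1 ≤ P →
    (((Fintype.piFinset fun _ : Fin s => pairBox P).filter
      fun u => ∀ l, ∑ j, (curve d (u j).2 l - curve d (u j).1 l) = Z l).card : ℝ) *
      ∏ l : Fin d, (P : ℝ) ^ ((l : ℕ) + 1) ≤ K * P ^ (2 * s) := by
  classical
  obtain ⟨K, s₀, hmom⟩ := curveSum_moment d
  refine ⟨max 1 (K * 3 ^ (2 * (s₀ + 1))), le_max_left _ _, s₀ + 1, by lia, fun P Z hP => ?_⟩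
  set s := s₀ + 1 with hs
  have hP' : (1 : ℝ) ≤ P := by exact_mod_cast hP
  set U := Fintype.piFinset fun _ : Fin s => pairBox P with hU
  set Ks := Fintype.piFinset fun l : Fin d => range (P ^ ((l : ℕ) + 1)) with hKs
  let h : (Fin s → ℤ × ℤ) → Fin d → ℤ := fun u l => ∑ j, (curve d (u j).2 l - curve d (u j).1 l)
  -- detect the congruences `h u ≡ Z`
  have hdet : ∀ u, ∑ k ∈ Ks, e (∑ l : Fin d, (k l : ℝ) / P ^ ((l : ℕ) + 1) * ((h u l - Z l : ℤ) : ℝ)) =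
      if ∀ l : Fin d, ((P ^ ((l : ℕ) + 1) : ℕ) : ℤ) ∣ h u l - Z l then
        ((∏ l : Fin d, (P : ℝ) ^ ((l : ℕ) + 1) : ℝ) : ℂ) else 0 := by
    intro u
    have h1 : ∀ k : Fin d → ℕ, e (∑ l : Fin d, (k l : ℝ) / P ^ ((l : ℕ) + 1) * ((h u l - Z l : ℤ) : ℝ)) =
        ∏ l, e (((k l : ℕ) : ℤ) / ((P ^ ((l : ℕ) + 1) : ℕ) : ℝ) * ((h u l - Z l : ℤ) : ℝ)) := by
      intro k
      rw [e_sum]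
      refine prod_congr rfl fun l _ => ?_
      push_cast; rfl
    simp only [h1]
    rw [hKs, ← prod_univ_sum (fun l : Fin d => range (P ^ ((l : ℕ) + 1)))
      (fun l k => e (((k : ℕ) : ℤ) / ((P ^ ((l : ℕ) + 1) : ℕ) : ℝ) * ((h u l - Z l : ℤ) : ℝ)))]
    have h2 : ∀ l : Fin d, ∑ k ∈ range (P ^ ((l : ℕ) + 1)),
        e (((k : ℕ) : ℤ) / ((P ^ ((l : ℕ) + 1) : ℕ) : ℝ) * ((h u l - Z l : ℤ) : ℝ)) =
        if ((P ^ ((l : ℕ) + 1) : ℕ) : ℤ) ∣ h u l - Z l then ((P : ℂ) ^ ((l : ℕ) + 1)) else 0 := by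
      intro l
      rw [sum_e_residue (Nat.one_le_pow _ _ hP)]
      push_cast; rfl
    simp only [h2]
    split_ifs with hall
    · rw [prod_congr rfl fun l _ => if_pos (hall l)]
      push_cast; rfl
    · push Not at hall
      obtain ⟨l, hl⟩ := hall
      exact prod_eq_zero (mem_univ l) (if_neg hl)
  -- the count as an exponential sum
  have hfac : ∀ k : Fin d → ℕ, ∑ u ∈ U, e (∑ l : Fin d, (k l : ℝ) / P ^ ((l : ℕ) + 1) * ((h u l - Z l : ℤ) : ℝ)) =
      e (-∑ l : Fin d, (k l : ℝ) / P ^ ((l : ℕ) + 1) * Z l) * ((‖curveSum d P k‖ ^ (2 * s) : ℝ) : ℂ) := by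
    intro k
    have h1 : ∀ u : Fin s → ℤ × ℤ, e (∑ l : Fin d, (k l : ℝ) / P ^ ((l : ℕ) + 1) * ((h u l - Z l : ℤ) : ℝ)) =
        e (-∑ l : Fin d, (k l : ℝ) / P ^ ((l : ℕ) + 1) * Z l) * ∏ j,
          e (∑ l : Fin d, (k l : ℝ) / P ^ ((l : ℕ) + 1) * curve d (u j).2 l -
            ∑ l : Fin d, (k l : ℝ) / P ^ ((l : ℕ) + 1) * curve d (u j).1 l) := by
      intro u
      rw [← e_sum, ← e_add]
      congr 1
      simp only [← sum_sub_distrib]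
      rw [sum_comm, ← sum_neg_distrib, ← sum_add_distrib]
      refine sum_congr rfl fun l _ => ?_
      simp only [h]
      push_cast
      simp only [sum_sub_distrib, ← mul_sum]
      ring
    simp only [h1]
    rw [← mul_sum]
    congr 1
    rw [hU, ← prod_univ_sum (fun _ : Fin s => pairBox P) (fun _ p =>
      e (∑ l : Fin d, (k l : ℝ) / P ^ ((l : ℕ) + 1) * curve d p.2 l -
            ∑ l : Fin d, (k l : ℝ) / P ^ ((l : ℕ) + 1) * curve d p.1 l)), prod_const, card_univ,
      Fintype.card_fin, pow_mul, Complex.ofReal_pow]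
    congr 1
    rw [← Complex.normSq_eq_norm_sq, Complex.normSq_eq_conj_mul_self, curveSum, map_sum, pairBox,
      sum_product, sum_mul_sum]
    refine sum_congr rfl fun x _ => sum_congr rfl fun y _ => ?_
    rw [conj_e, ← e_add]; congr 1; ring
  have htotal : ((((U.filter fun u => ∀ l : Fin d, ((P ^ ((l : ℕ) + 1) : ℕ) : ℤ) ∣ h u l - Z l).card : ℝ) *
      ∏ l : Fin d, (P : ℝ) ^ ((l : ℕ) + 1) : ℝ) : ℂ) =
      ∑ k ∈ Ks, e (-∑ l : Fin d, (k l : ℝ) / P ^ ((l : ℕ) + 1) * Z l) *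
        ((‖curveSum d P k‖ ^ (2 * s) : ℝ) : ℂ) := by
    simp only [← hfac]
    rw [sum_comm]
    simp only [hdet]
    rw [← sum_filter, sum_const, nsmul_eq_mul]
    push_cast; rfl
  have hnorm := congrArg norm htotal
  rw [Complex.norm_real, Real.norm_eq_abs, abs_of_nonneg (by positivity)] at hnorm
  -- The equations are relaxed to congruences modulo `P ^ (l+1)`, so only the grid frequencies `k l
  -- / P ^ (l+1)` enter. Their number is the product of powers of `P`, and the target `Z` enters
  -- only through a unimodular factor.
  calc _ ≤ ((U.filter fun u => ∀ l : Fin d, ((P ^ ((l : ℕ) + 1) : ℕ) : ℤ) ∣ h u l - Z l).card : ℝ) *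
      ∏ l : Fin d, (P : ℝ) ^ ((l : ℕ) + 1) := by
        gcongr with u _
        intro hu
        simp only [h, hu, sub_self, dvd_zero]
    _ ≤ ∑ k ∈ Ks, ‖curveSum d P k‖ ^ (2 * s) := by
        rw [hnorm]
        refine (norm_sum_le _ _).trans (sum_le_sum fun k _ => ?_)
        rw [norm_mul, norm_e, one_mul, Complex.norm_real, Real.norm_eq_abs,
          abs_of_nonneg (by positivity)]
    _ ≤ K * (3 * P) ^ (2 * s) := hmom P (2 * s) hP (by lia)
    _ = K * 3 ^ (2 * (s₀ + 1)) * P ^ (2 * s) := by rw [mul_pow, hs]; ring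
    _ ≤ _ := by gcongr; exact le_max_right _ _

end

/-! ### Twisted translations on `ℓ²(ℤ^d)` and the norm of their combinations -/

section

variable {d : ℕ}

/-- The bilinear form `∑ Θ_{ij} u_i v_j`. -/
noncomputable def form (Θ : Fin d → Fin d → ℝ) (u v : Fin d → ℤ) : ℝ := ∑ i, ∑ j, Θ i j * u i * v j

variable (Θ : Fin d → Fin d → ℝ)

theorem form_add_left (u u' v : Fin d → ℤ) : form Θ (u + u') v = form Θ u v + form Θ u' v := by
  simp only [form, ← sum_add_distrib, Pi.add_apply]
  refine sum_congr rfl fun i _ => sum_congr rfl fun j _ => ?_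
  push_cast; ring

theorem form_add_right (u v v' : Fin d → ℤ) : form Θ u (v + v') = form Θ u v + form Θ u v' := by
  simp only [form, ← sum_add_distrib, Pi.add_apply]
  refine sum_congr rfl fun i _ => sum_congr rfl fun j _ => ?_
  push_cast; ring

theorem form_neg_left (u v : Fin d → ℤ) : form Θ (-u) v = -form Θ u v := by
  simp [form]

theorem form_neg_right (u v : Fin d → ℤ) : form Θ u (-v) = -form Θ u v := by
  simp [form]

theorem form_sub_left (u u' v : Fin d → ℤ) : form Θ (u - u') v = form Θ u v - form Θ u' v := by
  rw [sub_eq_add_neg, form_add_left, form_neg_left, sub_eq_add_neg]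

theorem form_sub_right (u v v' : Fin d → ℤ) : form Θ u (v - v') = form Θ u v - form Θ u v' := by
  rw [sub_eq_add_neg, form_add_right, form_neg_right, sub_eq_add_neg]

theorem form_zero_right (u : Fin d → ℤ) : form Θ u 0 = 0 := by simp [form]

theorem form_zero_left (u : Fin d → ℤ) : form Θ 0 u = 0 := by simp [form]

/-- The Hilbert space `ℓ²(ℤ^d)`. -/
abbrev Ell2 (d : ℕ) : Type := lp (fun _ : Fin d → ℤ => ℂ) 2

theorem memℓp_twist (X : Fin d → ℤ) (ψ : Ell2 d) :
    Memℓp (fun U : Fin d → ℤ => e (-form Θ X (U - X)) * ψ (U - X)) 2 := by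
  rw [memℓp_gen_iff (by norm_num)]
  have h := (memℓp_gen_iff (by norm_num)).1 (lp.memℓp ψ)
  simp only [norm_mul, norm_e, one_mul]
  exact h.comp_injective (sub_left_injective (b := X))

/-- The twisted translation `(V_X ψ)(U) = e(-B(X, U - X)) ψ(U - X)` as an isometry. -/
noncomputable def twistIsometry (X : Fin d → ℤ) : Ell2 d →ₗᵢ[ℂ] Ell2 d where
  toFun := fun ψ => ⟨fun U => e (-form Θ X (U - X)) * ψ (U - X), memℓp_twist Θ X ψ⟩
  map_add' := by
    intro ψ φ
    ext U
    exact mul_add _ _ _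
  map_smul' := by
    intro c ψ
    ext U
    exact mul_left_comm _ _ _
  norm_map' := by
    intro ψ
    rw [lp.norm_eq_tsum_rpow (by norm_num), lp.norm_eq_tsum_rpow (by norm_num)]
    congr 1
    simp only [LinearMap.coe_mk, AddHom.coe_mk, norm_mul, norm_e, one_mul]
    exact (Equiv.subRight X).tsum_eq (fun U => ‖ψ U‖ ^ ((2 : ENNReal).toReal))

/-- The twisted translation as a bounded operator. -/
noncomputable def twist (X : Fin d → ℤ) : Ell2 d →L[ℂ] Ell2 d :=
  (twistIsometry Θ X).toContinuousLinearMap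

theorem twist_apply (X : Fin d → ℤ) (ψ : Ell2 d) (U : Fin d → ℤ) :
    twist Θ X ψ U = e (-form Θ X (U - X)) * ψ (U - X) := rfl

theorem norm_twist_apply (X : Fin d → ℤ) (ψ : Ell2 d) : ‖twist Θ X ψ‖ = ‖ψ‖ :=
  (twistIsometry Θ X).norm_map ψ

theorem norm_twist_le (X : Fin d → ℤ) : ‖twist Θ X‖ ≤ 1 :=
  ContinuousLinearMap.opNorm_le_bound _ zero_le_one fun ψ => by rw [norm_twist_apply, one_mul]

/-- Bilinearity of `form Θ` makes the twist a cocycle: multiplying the operators reproduces the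
quadratic term of the group law as a phase. -/
theorem twist_mul (X Y : Fin d → ℤ) :
    twist Θ X * twist Θ Y = e (-form Θ X Y) • twist Θ (X + Y) := by
  ext ψ U
  change twist Θ X (twist Θ Y ψ) U = e (-form Θ X Y) * twist Θ (X + Y) ψ U
  rw [twist_apply, twist_apply, twist_apply, ← mul_assoc, ← mul_assoc, ← e_add, ← e_add, sub_sub]
  congr 2
  simp only [form_sub_right, form_add_right, form_add_left]
  ring

theorem twist_zero : twist Θ (0 : Fin d → ℤ) = 1 := by
  ext ψ U
  simp [twist_apply, form_zero_left, e_zero]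

theorem star_twist (X : Fin d → ℤ) : star (twist Θ X) = e (-form Θ X X) • twist Θ (-X) := by
  have h1 : star (twist Θ X) * twist Θ X = 1 :=
    (ContinuousLinearMap.norm_map_iff_adjoint_comp_self _).1 (norm_twist_apply Θ X)
  have h2 : twist Θ X * (e (-form Θ X X) • twist Θ (-X)) = 1 := by
    rw [mul_smul_comm, twist_mul, smul_smul, ← e_add, form_neg_right, add_neg_cancel, add_neg_cancel,
      twist_zero]
    simp [e_zero]
  calc star (twist Θ X) = star (twist Θ X) * (twist Θ X * (e (-form Θ X X) • twist Θ (-X))) := by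
        rw [h2, mul_one]
    _ = _ := by rw [← mul_assoc, h1, one_mul]

theorem star_twist_mul (X Y : Fin d → ℤ) :
    star (twist Θ X) * twist Θ Y = e (form Θ X (Y - X)) • twist Θ (Y - X) := by
  rw [star_twist, smul_mul_assoc, twist_mul, smul_smul, ← e_add]
  congr 2
  · rw [form_neg_left, form_sub_right]; ring
  · abel

/-- The box `|Z_l| ≤ b_l`. -/
noncomputable def box (b : Fin d → ℕ) : Finset (Fin d → ℤ) := Fintype.piFinset fun l => Ico (-(b l : ℤ)) (b l + 1)

theorem mem_box {b : Fin d → ℕ} {Z : Fin d → ℤ} : Z ∈ box b ↔ ∀ l, -(b l : ℤ) ≤ Z l ∧ Z l ≤ b l := by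
  simp only [box, Fintype.mem_piFinset, mem_Ico, Int.lt_add_one_iff]

theorem sum_shift {M : Type*} [AddCommMonoid M] {S S' : Finset (Fin d → ℤ)} {G : (Fin d → ℤ) → M}
    (c : Fin d → ℤ) (h0 : ∀ Y, Y ∉ S → G Y = 0) (h : ∀ Y ∈ S, Y - c ∈ S') :
    ∑ Y ∈ S, G Y = ∑ X ∈ S', G (X + c) := by
  have h1 : ∑ Y ∈ S, G Y = ∑ X ∈ S.image (fun Y => Y - c), G (X + c) := by
    rw [sum_image (fun _ _ _ _ h => sub_left_injective h)]
    simp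
  rw [h1]
  refine sum_subset (image_subset_iff.2 h) fun X _ hX => h0 _ fun hmem => hX ?_
  exact mem_image.2 ⟨X + c, hmem, by simp⟩

/-- Bound `p` by `a`, apply Cauchy–Schwarz in `i`, expand the square in `j, j'` and bound the two
copies of `p'` by `a`; only the phase `E` survives. -/
theorem bilinear_cauchy_schwarz {ι : Type*} (S : Finset ι) (p p' : ι → ℂ) {a : ℝ}
    (hp : ∀ i ∈ S, ‖p i‖ ≤ a) (hp' : ∀ i ∈ S, ‖p' i‖ ≤ a) (E : ι → ι → ℝ) :
    ‖∑ i ∈ S, ∑ j ∈ S, p i * p' j * e (E i j)‖ ^ 2 ≤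
      a ^ 4 * (S.card * ∑ j ∈ S, ∑ j' ∈ S, ‖∑ i ∈ S, e (E i j - E i j')‖) := by
  rcases S.eq_empty_or_nonempty with rfl | ⟨i₀, hi₀⟩
  · simp
  have ha : 0 ≤ a := (norm_nonneg _).trans (hp i₀ hi₀)
  have h1 : ‖∑ i ∈ S, ∑ j ∈ S, p i * p' j * e (E i j)‖ ≤
      a * ∑ i ∈ S, ‖∑ j ∈ S, p' j * e (E i j)‖ := by
    rw [mul_sum]
    refine (norm_sum_le _ _).trans (sum_le_sum fun i hi => ?_)
    simp only [mul_assoc, ← mul_sum]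
    rw [norm_mul]
    gcongr
    exact hp i hi
  have h2 : (∑ i ∈ S, ‖∑ j ∈ S, p' j * e (E i j)‖) ^ 2 ≤
      S.card * ∑ i ∈ S, ‖∑ j ∈ S, p' j * e (E i j)‖ ^ 2 := sq_sum_le_card_mul_sum_sq
  have h3 : ((∑ i ∈ S, ‖∑ j ∈ S, p' j * e (E i j)‖ ^ 2 : ℝ) : ℂ) =
      ∑ j ∈ S, ∑ j' ∈ S, p' j * (starRingEnd ℂ) (p' j') * ∑ i ∈ S, e (E i j - E i j') := by
    push_cast
    have : ∀ i ∈ S, ((‖∑ j ∈ S, p' j * e (E i j)‖ : ℂ)) ^ 2 =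
        ∑ j ∈ S, ∑ j' ∈ S, p' j * (starRingEnd ℂ) (p' j') * e (E i j - E i j') := by
      intro i _
      rw [← Complex.mul_conj', map_sum, sum_mul_sum]
      refine sum_congr rfl fun j _ => sum_congr rfl fun j' _ => ?_
      rw [map_mul, conj_e, sub_eq_add_neg, e_add]; ring
    rw [sum_congr rfl this, sum_comm]
    refine sum_congr rfl fun j _ => ?_
    rw [sum_comm]
    refine sum_congr rfl fun j' _ => ?_
    rw [mul_sum]
  have h4 : ∑ i ∈ S, ‖∑ j ∈ S, p' j * e (E i j)‖ ^ 2 ≤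
      a ^ 2 * ∑ j ∈ S, ∑ j' ∈ S, ‖∑ i ∈ S, e (E i j - E i j')‖ := by
    have h5 : ∑ i ∈ S, ‖∑ j ∈ S, p' j * e (E i j)‖ ^ 2 =
        ‖((∑ i ∈ S, ‖∑ j ∈ S, p' j * e (E i j)‖ ^ 2 : ℝ) : ℂ)‖ := by
      rw [Complex.norm_real, Real.norm_eq_abs, abs_of_nonneg (sum_nonneg fun _ _ => by positivity)]
    rw [h5, h3, mul_sum]
    refine (norm_sum_le _ _).trans (sum_le_sum fun j hj => ?_)
    rw [mul_sum]
    refine (norm_sum_le _ _).trans (sum_le_sum fun j' hj' => ?_)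
    rw [norm_mul, norm_mul, RCLike.norm_conj, sq]
    gcongr
    · exact hp' j hj
    · exact hp' j' hj'
  calc _ ≤ (a * ∑ i ∈ S, ‖∑ j ∈ S, p' j * e (E i j)‖) ^ 2 := by gcongr
    _ = a ^ 2 * (∑ i ∈ S, ‖∑ j ∈ S, p' j * e (E i j)‖) ^ 2 := by ring
    _ ≤ a ^ 2 * (S.card * (a ^ 2 * ∑ j ∈ S, ∑ j' ∈ S, ‖∑ i ∈ S, e (E i j - E i j')‖)) := by
        gcongr
        exact h2.trans (by gcongr)
    _ = _ := by ring

/-- `∑_{Z', Z''} |∑_Z e(B(Z' - Z'', Z) - B(Z, Z' - Z''))|` over a box. -/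
noncomputable def altSum (b : Fin d → ℕ) : ℝ :=
  ∑ Z' ∈ box b, ∑ Z'' ∈ box b, ‖∑ Z ∈ box b, e (form Θ (Z' - Z'') Z - form Θ Z (Z' - Z''))‖

/-- The coefficient of `V_X` in `L* L`. -/
noncomputable def autoCorr (b : Fin d → ℕ) (m : (Fin d → ℤ) → ℂ) (X : Fin d → ℤ) : ℂ :=
  ∑ Z ∈ box b, (starRingEnd ℂ) (m Z) * m (Z + X) * e (form Θ Z X)

/-- The C*-identity followed by the triangle inequality, since `L* L` is again a combination of
twisted translations, by differences of points of the box. -/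
theorem norm_sq_twisted_le (b : Fin d → ℕ) (m : (Fin d → ℤ) → ℂ) (hm : ∀ Z, Z ∉ box b → m Z = 0) :
    ‖∑ Z ∈ box b, m Z • twist Θ Z‖ ^ 2 ≤ ∑ X ∈ box (fun l => 2 * b l), ‖autoCorr Θ b m X‖ := by
  rw [sq, ← CStarRing.norm_star_mul_self]
  have h1 : star (∑ Z ∈ box b, m Z • twist Θ Z) * ∑ Z ∈ box b, m Z • twist Θ Z =
      ∑ X ∈ box (fun l => 2 * b l), autoCorr Θ b m X • twist Θ X := by
    rw [star_sum, sum_mul_sum]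
    have h2 : ∀ Z ∈ box b, ∑ Z' ∈ box b, star (m Z • twist Θ Z) * (m Z' • twist Θ Z') =
        ∑ X ∈ box (fun l => 2 * b l),
          ((starRingEnd ℂ) (m Z) * m (Z + X) * e (form Θ Z X)) • twist Θ X := by
      intro Z hZ
      rw [sum_shift (S' := box (fun l => 2 * b l)) Z]
      · refine sum_congr rfl fun X _ => ?_
        rw [star_smul, smul_mul_smul_comm, star_twist_mul, smul_smul, add_sub_cancel_right,
          add_comm X Z]
        rfl
      · intro Y hY
        rw [hm Y hY, zero_smul, mul_zero]
      · intro Y hY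
        rw [mem_box] at *
        intro l
        have := hY l
        have := hZ l
        simp only [Pi.sub_apply]
        push_cast
        lia
    rw [sum_congr rfl h2, sum_comm]
    refine sum_congr rfl fun X _ => ?_
    rw [autoCorr, sum_smul]
  rw [h1]
  refine (norm_sum_le _ _).trans (sum_le_sum fun X _ => ?_)
  rw [norm_smul]
  exact mul_le_of_le_one_right (norm_nonneg _) (norm_twist_le Θ X)

/-- Substitute `T = X + Z + Z'`. For fixed `T` all weights split into a function of `Z` times a
function of `Z'`, and the only phase coupling the two is the commutator of `form Θ`; this is the
shape `bilinear_cauchy_schwarz` needs. -/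
theorem sum_autoCorr_sq (b : Fin d → ℕ) (m : (Fin d → ℤ) → ℂ) (hm : ∀ Z, Z ∉ box b → m Z = 0) :
    ((∑ X ∈ box (fun l => 2 * b l), ‖autoCorr Θ b m X‖ ^ 2 : ℝ) : ℂ) =
      ∑ T ∈ box (fun l => 4 * b l), ∑ Z ∈ box b, ∑ Z' ∈ box b,
        ((starRingEnd ℂ) (m Z * m (T - Z) * e (form Θ Z Z - form Θ Z T))) *
        (m Z' * m (T - Z') * e (form Θ Z' Z' - form Θ Z' T)) *
        e (form Θ Z' Z - form Θ Z Z') := by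
  have h1 : ∀ X, ((‖autoCorr Θ b m X‖ : ℂ)) ^ 2 = ∑ Z ∈ box b, ∑ Z' ∈ box b,
      (starRingEnd ℂ) (m Z) * m (Z + X) * e (form Θ Z X) *
      (m Z' * (starRingEnd ℂ) (m (Z' + X)) * e (-form Θ Z' X)) := by
    intro X
    rw [← Complex.mul_conj', autoCorr, map_sum, sum_mul_sum]
    refine sum_congr rfl fun Z _ => sum_congr rfl fun Z' _ => ?_
    simp only [map_mul, conj_e, Complex.conj_conj]
  push_cast
  simp only [h1]
  rw [sum_comm, sum_comm (s := box fun l => 4 * b l)]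
  refine sum_congr rfl fun Z hZ => ?_
  rw [sum_comm, sum_comm (s := box fun l => 4 * b l)]
  refine sum_congr rfl fun Z' hZ' => ?_
  rw [sum_shift (S' := box fun l => 4 * b l) (-(Z + Z'))]
  · refine sum_congr rfl fun T _ => ?_
    have e1 : Z + (T + -(Z + Z')) = T - Z' := by abel
    have e2 : Z' + (T + -(Z + Z')) = T - Z := by abel
    rw [e1, e2]
    simp only [map_mul, conj_e]
    have e3 : e (form Θ Z (T + -(Z + Z'))) * e (-form Θ Z' (T + -(Z + Z'))) =
        e (-(form Θ Z Z - form Θ Z T)) * e (form Θ Z' Z' - form Θ Z' T) *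
          e (form Θ Z' Z - form Θ Z Z') := by
      simp only [← e_add]
      congr 1
      simp only [form_add_right, form_neg_right]
      ring
    linear_combination (starRingEnd ℂ) (m Z) * m (T - Z') * m Z' * (starRingEnd ℂ) (m (T - Z)) * e3
  · intro X hX
    have : Z + X ∉ box b := by
      intro hc
      apply hX
      rw [mem_box] at *
      intro l
      have := hc l
      have := hZ l
      simp only [Pi.add_apply] at *
      push_cast
      lia
    rw [hm _ this]
    ring
  · intro X hX
    rw [mem_box] at *
    intro l
    have := hX l
    have := hZ l
    have := hZ' l
    simp only [Pi.sub_apply, Pi.neg_apply, Pi.add_apply]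
    push_cast at *
    lia

/-- Three squarings give the eighth power: the C*-identity, Cauchy–Schwarz over `X`, and
`bilinear_cauchy_schwarz` for each `T`. -/
theorem norm_twisted_pow_eight_le (b : Fin d → ℕ) (m : (Fin d → ℤ) → ℂ)
    (hm : ∀ Z, Z ∉ box b → m Z = 0) {A : ℝ} (hA : ∀ Z, ‖m Z‖ ≤ A) :
    ‖∑ Z ∈ box b, m Z • twist Θ Z‖ ^ 8 ≤
      ((box fun l => 4 * b l).card : ℝ) ^ 4 * A ^ 8 * ((box b).card * altSum Θ b) := by
  have hA0 : 0 ≤ A := (norm_nonneg _).trans (hA 0)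
  set V : ℝ := ((box fun l => 4 * b l).card : ℝ) with hV
  have hV2 : ((box fun l => 2 * b l).card : ℝ) ≤ V := by
    rw [hV]
    norm_cast
    refine card_le_card fun Z hZ => ?_
    rw [mem_box] at *
    intro l
    have := hZ l
    push_cast at *
    lia
  set Q : ℝ := (box b).card * altSum Θ b with hQ
  have hT : ∀ T, ‖∑ Z ∈ box b, ∑ Z' ∈ box b,
        ((starRingEnd ℂ) (m Z * m (T - Z) * e (form Θ Z Z - form Θ Z T))) *
        (m Z' * m (T - Z') * e (form Θ Z' Z' - form Θ Z' T)) *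
        e (form Θ Z' Z - form Θ Z Z')‖ ^ 2 ≤ A ^ 8 * Q := by
    intro T
    have hp : ∀ Z, ‖m Z * m (T - Z) * e (form Θ Z Z - form Θ Z T)‖ ≤ A ^ 2 := by
      intro Z
      rw [norm_mul, norm_mul, norm_e, mul_one, sq]
      gcongr
      · exact hA _
      · exact hA _
    have := bilinear_cauchy_schwarz (box b)
      (fun Z => (starRingEnd ℂ) (m Z * m (T - Z) * e (form Θ Z Z - form Θ Z T)))
      (fun Z => m Z * m (T - Z) * e (form Θ Z Z - form Θ Z T)) (a := A ^ 2)
      (fun Z _ => by rw [RCLike.norm_conj]; exact hp Z) (fun Z _ => hp Z)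
      (fun Z Z' => form Θ Z' Z - form Θ Z Z')
    convert this using 1
    rw [hQ, altSum, ← pow_mul]
    congr 2
    refine sum_congr rfl fun Z' _ => sum_congr rfl fun Z'' _ => ?_
    congr 1
    refine sum_congr rfl fun Z _ => ?_
    rw [form_sub_right, form_sub_left]
    congr 1; ring
  have hsq : ∑ X ∈ box (fun l => 2 * b l), ‖autoCorr Θ b m X‖ ^ 2 ≤ V * Real.sqrt (A ^ 8 * Q) := by
    have h1 : ∑ X ∈ box (fun l => 2 * b l), ‖autoCorr Θ b m X‖ ^ 2 =
        ‖((∑ X ∈ box (fun l => 2 * b l), ‖autoCorr Θ b m X‖ ^ 2 : ℝ) : ℂ)‖ := by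
      rw [Complex.norm_real, Real.norm_eq_abs, abs_of_nonneg (sum_nonneg fun _ _ => by positivity)]
    rw [h1, sum_autoCorr_sq Θ b m hm, hV, ← nsmul_eq_mul]
    refine (norm_sum_le _ _).trans (sum_le_card_nsmul _ _ _ fun T _ => ?_)
    exact Real.le_sqrt_of_sq_le (hT T)
  have hQ0 : 0 ≤ Q := by
    rw [hQ, altSum]; positivity
  have hN : (∑ X ∈ box (fun l => 2 * b l), ‖autoCorr Θ b m X‖) ^ 2 ≤ V ^ 2 * Real.sqrt (A ^ 8 * Q) := by
    refine sq_sum_le_card_mul_sum_sq.trans ?_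
    calc _ ≤ V * (V * Real.sqrt (A ^ 8 * Q)) := by gcongr
      _ = _ := by ring
  calc ‖∑ Z ∈ box b, m Z • twist Θ Z‖ ^ 8 = ((‖∑ Z ∈ box b, m Z • twist Θ Z‖ ^ 2) ^ 2) ^ 2 := by ring
    _ ≤ ((∑ X ∈ box (fun l => 2 * b l), ‖autoCorr Θ b m X‖) ^ 2) ^ 2 := by
        gcongr
        exact norm_sq_twisted_le Θ b m hm
    _ ≤ (V ^ 2 * Real.sqrt (A ^ 8 * Q)) ^ 2 := by gcongr
    _ = _ := by rw [mul_pow, Real.sq_sqrt (by positivity)]; ring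

end

/-! ### A large operator norm forces a major antisymmetric part -/

section

variable {d : ℕ} (Θ : Fin d → Fin d → ℝ)

theorem card_box (b : Fin d → ℕ) : ((box b).card : ℝ) = ∏ l, (2 * (b l : ℝ) + 1) := by
  rw [box, Fintype.card_piFinset]
  push_cast
  refine prod_congr rfl fun l _ => ?_
  rw [Int.card_Ico]
  have : ((b l : ℤ) + 1 - -(b l : ℤ)).toNat = 2 * b l + 1 := by lia
  rw [this]; push_cast; ring

/-- The coefficient of `Z_i` in `B(W, Z) - B(Z, W)`. -/
noncomputable def altCoeff (i : Fin d) (W : Fin d → ℤ) : ℝ := ∑ l, (Θ l i - Θ i l) * W l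

theorem form_sub_form (W Z : Fin d → ℤ) :
    form Θ W Z - form Θ Z W = ∑ i, altCoeff Θ i W * Z i := by
  rw [form, sum_comm, form, ← sum_sub_distrib]
  refine sum_congr rfl fun i _ => ?_
  rw [altCoeff, sum_mul, ← sum_sub_distrib]
  refine sum_congr rfl fun l _ => ?_
  ring

theorem altCoeff_update_sub (i j : Fin d) (W W' : Fin d → ℤ) (y : ℤ) :
    altCoeff Θ i (Function.update W j y - W') =
      (Θ j i - Θ i j) * y + altCoeff Θ i (Function.update W j 0 - W') := by
  classical
  simp only [altCoeff]
  rw [← add_sum_erase _ _ (mem_univ j), ← add_sum_erase (a := j) univ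
    (fun l => (Θ l i - Θ i l) * (((Function.update W j 0 - W') l : ℤ) : ℝ)) (mem_univ j), ← add_assoc]
  congr 1
  · simp only [Pi.sub_apply, Function.update_self]
    push_cast; ring
  · refine sum_congr rfl fun l hl => ?_
    simp only [Pi.sub_apply, Function.update_of_ne (ne_of_mem_erase hl)]

/-- Fibre the box over its coordinates other than `j`. -/
theorem sum_box_le (b : Fin d → ℕ) (j : Fin d) (f : (Fin d → ℤ) → ℝ) (hf : ∀ Z, 0 ≤ f Z) {T : ℝ}
    (hT : ∀ W : Fin d → ℤ, ∑ y ∈ Ico (-(b j : ℤ)) (b j + 1), f (Function.update W j y) ≤ T) :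
    ∑ Z ∈ box b, f Z ≤ (∏ l ∈ univ.erase j, (2 * (b l : ℝ) + 1)) * T := by
  classical
  have hmap : ∀ Z ∈ box b, Function.update Z j 0 ∈ box (Function.update b j 0) := by
    intro Z hZ
    rw [mem_box] at *
    intro l
    rcases eq_or_ne l j with rfl | h
    · simp
    · simpa [Function.update_of_ne h] using hZ l
  rw [← sum_fiberwise_of_maps_to hmap]
  calc _ ≤ ∑ _W ∈ box (Function.update b j 0), T := by
        refine sum_le_sum fun W _ => le_trans ?_ (hT W)
        have h1 : ∀ Z, Function.update Z j 0 = W → Function.update W j (Z j) = Z := by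
          intro Z h
          rw [← h]; simp
        calc _ = ∑ Z ∈ box b with Function.update Z j 0 = W, f (Function.update W j (Z j)) := by
              refine sum_congr rfl fun Z hZ => ?_
              rw [h1 Z (mem_filter.1 hZ).2]
          _ = ∑ y ∈ (box b |>.filter fun Z => Function.update Z j 0 = W).image (fun Z => Z j),
                f (Function.update W j y) := by
              rw [sum_image]
              intro Z hZ Z' hZ' h
              rw [← h1 Z (mem_filter.1 hZ).2, ← h1 Z' (mem_filter.1 hZ').2]
              exact congrArg _ h
          _ ≤ _ := by
              refine sum_le_sum_of_subset_of_nonneg ?_ fun _ _ _ => hf _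
              intro y hy
              obtain ⟨Z, hZ, rfl⟩ := mem_image.1 hy
              have := mem_box.1 (mem_filter.1 hZ).1 j
              rw [mem_Ico]; lia
    _ = _ := by
        rw [sum_const, nsmul_eq_mul, card_box, ← mul_prod_erase _ _ (mem_univ j)]
        simp only [Function.update_self, Nat.cast_zero, mul_zero, zero_add, one_mul]
        congr 1
        refine prod_congr rfl fun l hl => ?_
        rw [Function.update_of_ne (ne_of_mem_erase hl)]

/-- The commutator is linear in `Z`, so the inner sum is a product of one-variable geometric sums;
all but the `i`-th are bounded trivially. -/
theorem altSum_le (b : Fin d → ℕ) (i : Fin d) :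
    altSum Θ b ≤ (∏ l ∈ univ.erase i, (2 * (b l : ℝ) + 1)) * ∑ Z'' ∈ box b, ∑ Z' ∈ box b,
      ‖∑ z ∈ Ico (-(b i : ℤ)) (b i + 1), e (altCoeff Θ i (Z' - Z'') * z)‖ := by
  classical
  rw [altSum, sum_comm, mul_sum]
  refine sum_le_sum fun Z'' _ => ?_
  rw [mul_sum]
  refine sum_le_sum fun Z' _ => ?_
  have h1 : ∑ Z ∈ box b, e (form Θ (Z' - Z'') Z - form Θ Z (Z' - Z'')) =
      ∏ l, ∑ z ∈ Ico (-(b l : ℤ)) (b l + 1), e (altCoeff Θ l (Z' - Z'') * z) := by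
    rw [prod_univ_sum]
    refine sum_congr rfl fun Z _ => ?_
    rw [form_sub_form, e_sum]
  rw [h1, norm_prod, ← mul_prod_erase _ _ (mem_univ i), mul_comm]
  gcongr with l _
  refine (norm_sum_e_le_card _ _).trans (le_of_eq ?_)
  rw [Int.card_Ico]
  have : ((b l : ℤ) + 1 - -(b l : ℤ)).toNat = 2 * b l + 1 := by lia
  rw [this]; push_cast; ring

/-- A large norm makes `altSum` nearly maximal. Averaging freezes everything but one coordinate `y`
in direction `j`, and for many `y` the geometric sum in direction `i` is large. Its frequency is `(Θ
j i - Θ i j) y` plus a constant, so `major_of_recurrence` applies. -/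
theorem minor_inverse (d s : ℕ) (hs : 1 ≤ s) : ∃ K : ℝ, 1 ≤ K ∧ ∃ C : ℕ,
    ∀ (Θ : Fin d → Fin d → ℝ) (P : ℕ) (H A : ℝ) (m : (Fin d → ℤ) → ℂ), 1 ≤ P → 1 ≤ H → 0 < A →
      (∀ Z, Z ∉ box (fun l => 2 * s * P ^ ((l : ℕ) + 1)) → m Z = 0) → (∀ Z, ‖m Z‖ ≤ A) →
      A * (∏ l : Fin d, (P : ℝ) ^ ((l : ℕ) + 1)) / H ≤
        ‖∑ Z ∈ box (fun l => 2 * s * P ^ ((l : ℕ) + 1)), m Z • twist Θ Z‖ →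
      ∀ i j : Fin d, Major (K * H ^ C) (P ^ ((i : ℕ) + 1 + ((j : ℕ) + 1))) (Θ j i - Θ i j) := by
  classical
  -- The largest box used, `4b`, has sides `16 s P ^ (l+1) + 1`, at most `17 s P ^ (l+1)`.
  set c : ℝ := 17 * s with hc
  have hs' : (1 : ℝ) ≤ s := by exact_mod_cast hs
  have hc1 : 1 ≤ c := by linarith
  -- Chosen so that failure of the averaging step would bound `altSum` by half of its lower bound `V
  -- ^ 3 / (c ^ (5d) H ^ 8)`.
  set κ : ℝ := 2 * c ^ (8 * d) with hκ
  have hκ1 : 1 ≤ κ := by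
    have : 1 ≤ c ^ (8 * d) := one_le_pow₀ hc1
    linarith
  refine ⟨(512 * c ^ 5 * κ ^ 3) ^ (2 * d), ?_, 48 * d, ?_⟩
  · refine one_le_pow₀ ?_
    exact one_le_mul_of_one_le_of_one_le (one_le_mul_of_one_le_of_one_le (by norm_num)
      (one_le_pow₀ hc1)) (one_le_pow₀ hκ1)
  intro Θ P H A m hP hH hA hm hmA hbig i j
  have hP' : (1 : ℝ) ≤ P := by exact_mod_cast hP
  set b : Fin d → ℕ := fun l => 2 * s * P ^ ((l : ℕ) + 1) with hb
  set p : Fin d → ℝ := fun l => (P : ℝ) ^ ((l : ℕ) + 1) with hp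
  have hp1 : ∀ l, 1 ≤ p l := fun l => one_le_pow₀ hP'
  have hp0 : ∀ l, 0 < p l := fun l => by have := hp1 l; linarith
  set V : ℝ := ∏ l, p l with hV
  have hV0 : 0 < V := prod_pos fun l _ => hp0 l
  have hsp : ∀ l, 1 ≤ s * p l := fun l => one_le_mul_of_one_le_of_one_le hs' (hp1 l)
  have hbl : ∀ l, 2 * (b l : ℝ) + 1 ≤ c * p l := by
    intro l
    have := hsp l
    simp only [hb, hc]
    push_cast
    simp only [hp] at this ⊢
    nlinarith
  have hbox : ((box b).card : ℝ) ≤ c ^ d * V := by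
    rw [card_box]
    calc _ ≤ ∏ l, (c * p l) := prod_le_prod (fun _ _ => by positivity) fun l _ => hbl l
      _ = _ := by rw [prod_mul_distrib]; simp [hV]
  have hbox4 : ((box fun l => 4 * b l).card : ℝ) ≤ c ^ d * V := by
    rw [card_box]
    calc _ ≤ ∏ l, (c * p l) := by
          refine prod_le_prod (fun _ _ => by positivity) fun l _ => ?_
          have := hsp l
          simp only [hb, hc]
          push_cast
          simp only [hp] at this ⊢
          nlinarith
      _ = _ := by rw [prod_mul_distrib]; simp [hV]
  have hR : ∀ i, (∏ l ∈ univ.erase i, (2 * (b l : ℝ) + 1)) * p i ≤ c ^ d * V := by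
    intro i
    calc (∏ l ∈ univ.erase i, (2 * (b l : ℝ) + 1)) * p i
        ≤ (∏ l ∈ univ.erase i, (2 * (b l : ℝ) + 1)) * (c * p i) := by
          have := hp0 i
          gcongr
          nlinarith
      _ ≤ (∏ l ∈ univ.erase i, (c * p l)) * (c * p i) := by
          have := hp0 i
          gcongr with l
          exact hbl l
      _ = _ := by rw [mul_comm, mul_prod_erase _ (fun l => c * p l) (mem_univ i), prod_mul_distrib]; simp [hV]
  have halt0 : 0 ≤ altSum Θ b := by rw [altSum]; positivity
  have halt : V ^ 3 / (c ^ (5 * d) * H ^ 8) ≤ altSum Θ b := by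
    have h1 := (pow_le_pow_left₀ (by positivity) hbig 8).trans
      (norm_twisted_pow_eight_le Θ b m hm hmA)
    have h2 : ((box fun l => 4 * b l).card : ℝ) ^ 4 * A ^ 8 * ((box b).card * altSum Θ b) ≤
        (c ^ d * V) ^ 4 * A ^ 8 * ((c ^ d * V) * altSum Θ b) := by gcongr
    have h3 := h1.trans h2
    rw [div_le_iff₀ (by positivity)]
    have h4 : (A * V / H) ^ 8 = (A ^ 8 * V ^ 5) * (V ^ 3 / H ^ 8) := by ring
    have h5 : (c ^ d * V) ^ 4 * A ^ 8 * ((c ^ d * V) * altSum Θ b) =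
        (A ^ 8 * V ^ 5) * (c ^ (5 * d) * altSum Θ b) := by ring
    rw [h4, h5] at h3
    have h6 := le_of_mul_le_mul_left h3 (by positivity)
    rw [div_le_iff₀ (by positivity)] at h6
    linarith
  set T : ℝ := p i * p j / (κ * H ^ 8) with hT
  have hT0 : 0 < T := by have := hp0 i; have := hp0 j; positivity
  obtain ⟨W, Z'', hWZ⟩ : ∃ W Z'' : Fin d → ℤ, T ≤ ∑ y ∈ Ico (-(b j : ℤ)) (b j + 1),
      ‖∑ z ∈ Ico (-(b i : ℤ)) (b i + 1), e (altCoeff Θ i (Function.update W j y - Z'') * z)‖ := by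
    by_contra! hcon
    have h1 : altSum Θ b ≤ (∏ l ∈ univ.erase i, (2 * (b l : ℝ) + 1)) *
        ((c ^ d * V) * ((∏ l ∈ univ.erase j, (2 * (b l : ℝ) + 1)) * T)) := by
      refine (altSum_le Θ b i).trans ?_
      gcongr
      calc _ ≤ ∑ Z'' ∈ box b, (∏ l ∈ univ.erase j, (2 * (b l : ℝ) + 1)) * T :=
            sum_le_sum fun Z'' _ => sum_box_le b j (fun Z' =>
              ‖∑ z ∈ Ico (-(b i : ℤ)) (b i + 1), e (altCoeff Θ i (Z' - Z'') * z)‖)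
              (fun _ => norm_nonneg _) fun W => (hcon W Z'').le
        _ = (box b).card * ((∏ l ∈ univ.erase j, (2 * (b l : ℝ) + 1)) * T) := by
            rw [sum_const, nsmul_eq_mul]
        _ ≤ _ := by gcongr
    have h2 : (∏ l ∈ univ.erase i, (2 * (b l : ℝ) + 1)) *
        ((c ^ d * V) * ((∏ l ∈ univ.erase j, (2 * (b l : ℝ) + 1)) * T)) ≤
        (c ^ d * V) * (c ^ d * V) * (c ^ d * V) / (κ * H ^ 8) := by
      have e1 : (∏ l ∈ univ.erase i, (2 * (b l : ℝ) + 1)) *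
        ((c ^ d * V) * ((∏ l ∈ univ.erase j, (2 * (b l : ℝ) + 1)) * T)) =
          ((∏ l ∈ univ.erase i, (2 * (b l : ℝ) + 1)) * p i) *
          ((∏ l ∈ univ.erase j, (2 * (b l : ℝ) + 1)) * p j) * (c ^ d * V) / (κ * H ^ 8) := by
        rw [hT]; ring
      rw [e1]
      have hj := hp0 j
      have hij := mul_le_mul (hR i) (hR j) (by positivity) (by positivity)
      exact div_le_div_of_nonneg_right (mul_le_mul_of_nonneg_right hij (by positivity)) (by positivity)
    have h3 : (c ^ d * V) * (c ^ d * V) * (c ^ d * V) / (κ * H ^ 8) =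
        V ^ 3 / (c ^ (5 * d) * H ^ 8) / 2 := by
      rw [hκ]
      have : c ^ (8 * d) = c ^ (5 * d) * (c ^ d * c ^ d * c ^ d) := by ring
      rw [this]
      field_simp
    have h4 : 0 < V ^ 3 / (c ^ (5 * d) * H ^ 8) := by positivity
    linarith
  -- With at most `c * p j` values of `y`, those below this threshold account for at most half of
  -- `T`.
  set t : ℝ := p i / (2 * c * κ * H ^ 8) with ht
  have ht0 : 0 < t := by have := hp0 i; positivity
  set g : ℤ → ℝ := fun y =>
    ‖∑ z ∈ Ico (-(b i : ℤ)) (b i + 1), e (altCoeff Θ i (Function.update W j y - Z'') * z)‖ with hg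
  have hcardI : ∀ l, ((Ico (-(b l : ℤ)) (b l + 1)).card : ℝ) = 2 * (b l : ℝ) + 1 := by
    intro l
    rw [Int.card_Ico]
    have : ((b l : ℤ) + 1 - -(b l : ℤ)).toNat = 2 * b l + 1 := by lia
    rw [this]; push_cast; ring
  have hlarge := card_large_mul_ge _ g (M := c * p i) (t := t) (fun y _ => by
    refine (norm_sum_e_le_card _ _).trans ?_
    rw [hcardI]; exact hbl i) ht0.le hWZ
  set Y := (Ico (-(b j : ℤ)) (b j + 1)).filter fun y => t ≤ g y with hY
  have hYcard : p j / (2 * c * κ * H ^ 8) ≤ Y.card := by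
    have h1 : ((Ico (-(b j : ℤ)) (b j + 1)).card : ℝ) * t ≤ (c * p j) * t := by
      rw [hcardI]; gcongr; exact hbl j
    have h2 : T - (c * p j) * t = p j / (2 * c * κ * H ^ 8) * (c * p i) := by
      rw [hT, ht]; field_simp; ring
    have h3 : p j / (2 * c * κ * H ^ 8) * (c * p i) ≤ Y.card * (c * p i) := by linarith
    exact le_of_mul_le_mul_right h3 (by have := hp0 i; positivity)
  have hH8 : 1 ≤ H ^ 8 := one_le_pow₀ hH
  have hrec := major_of_recurrence (Y := Y) (A := -(b j : ℤ)) (N := 2 * b j + 1) (i := (i : ℕ) + 1)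
    (j := (j : ℕ) + 1) (P := P) (H := 2 * c ^ 2 * κ * H ^ 8) (X := c * κ * H ^ 8)
    (β := Θ j i - Θ i j) (c := altCoeff Θ i (Function.update W j 0 - Z''))
    (one_le_mul_of_one_le_of_one_le (one_le_mul_of_one_le_of_one_le (by
      have : 1 ≤ c ^ 2 := one_le_pow₀ hc1
      linarith) hκ1) hH8)
    (one_le_mul_of_one_le_of_one_le (one_le_mul_of_one_le_of_one_le hc1 hκ1) hH8) hP'
    (by lia) (by lia)
    (by
      simp only [hb]
      push_cast
      have := hsp j
      simp only [hp] at this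
      have h0 : (0 : ℝ) < (P : ℝ) ^ ((j : ℕ) + 1) := by positivity
      nlinarith)
    (by
      refine (filter_subset _ _).trans (Ico_subset_Ico le_rfl ?_)
      push_cast; lia)
    (by
      refine le_trans ?_ hYcard
      push_cast
      calc (2 * (b j : ℝ) + 1) / (2 * c ^ 2 * κ * H ^ 8) ≤ (c * p j) / (2 * c ^ 2 * κ * H ^ 8) := by
            gcongr; exact hbl j
        _ = _ := by field_simp)
    (by
      intro y hy
      have h1 := (mem_filter.1 hy).2
      have h2 : Near (1 / (2 * t)) (altCoeff Θ i (Function.update W j y - Z'')) := by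
        refine near_of_le_norm_sum_e (a := -(b i : ℤ)) (b := b i + 1) (c := 0) ht0 ?_
        simp only [add_zero]
        exact h1
      rw [altCoeff_update_sub] at h2
      refine h2.mono (le_of_eq ?_)
      rw [ht]
      simp only [hp]
      field_simp)
  refine hrec.mono ?_ (by positivity)
  have e1 : 128 * (2 * c ^ 2 * κ * H ^ 8) ^ 2 * (c * κ * H ^ 8) = 512 * c ^ 5 * κ ^ 3 * H ^ 24 := by ring
  have e2 : (512 * c ^ 5 * κ ^ 3) ^ (2 * d) * H ^ (48 * d) = (512 * c ^ 5 * κ ^ 3 * H ^ 24) ^ (2 * d) := by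
    rw [mul_pow _ (H ^ 24), ← pow_mul]; congr 2; ring
  rw [e1, e2]
  -- The exponent `i + 1 + (j + 1)` from the recurrence is at most `2d`.
  refine pow_le_pow_right₀ ?_ (by have := i.2; have := j.2; lia)
  exact one_le_mul_of_one_le_of_one_le (one_le_mul_of_one_le_of_one_le
    (one_le_mul_of_one_le_of_one_le (by norm_num)
      (one_le_pow₀ hc1)) (one_le_pow₀ hκ1)) (one_le_pow₀ hH)

end

/-! ### From the group to products of operators; the block estimate -/

section

variable {d : ℕ}

/-- The central frequencies `θ_{l₁ l₂}`, `l₂ ≥ 1`, as a strictly lower triangular matrix. -/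
noncomputable def thetaMat (θ : Y d → ℝ) (i j : Fin d) : ℝ :=
  if h : (j : ℕ) < i then θ ⟨((i : ℕ) + 1, (j : ℕ) + 1), mem_Y.2 ⟨by simpa using h, by simp⟩⟩
  else 0

/-- The index `(l + 1, 0)`. -/
def idx0 (l : Fin d) : Y d := ⟨((l : ℕ) + 1, 0), mem_Y.2 ⟨by simp, by simp⟩⟩

/-- `g` has integral horizontal part `u`. -/
def HasHoriz (g : G0 d) (u : Fin d → ℤ) : Prop := ∀ l, g.coord (idx0 l) = u l

theorem sum_cross (θ : Y d → ℝ) {g g' : G0 d} {u u' : Fin d → ℤ} (hg : HasHoriz g u)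
    (hg' : HasHoriz g' u') : ∑ l, G0.cross g g' l * θ l = form (thetaMat θ) u u' := by
  classical
  have h1 : ∑ l, G0.cross g g' l * θ l = ∑ l : Y d with l.1.2 ≠ 0, G0.cross g g' l * θ l := by
    rw [sum_filter]
    refine sum_congr rfl fun l _ => ?_
    split_ifs with h
    · rfl
    · have : l.1.2 = 0 := by simpa using h
      simp [G0.cross, this]
  have h2 : form (thetaMat θ) u u' =
      ∑ p : Fin d × Fin d with (p.2 : ℕ) < p.1, thetaMat θ p.1 p.2 * u p.1 * u' p.2 := by
    rw [form, sum_filter, Fintype.sum_prod_type]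
    refine sum_congr rfl fun i _ => sum_congr rfl fun j _ => ?_
    split_ifs with h
    · rfl
    · simp [thetaMat, h]
  rw [h1, h2]
  refine sum_bij' (i := fun (l : Y d) hl =>
      ((⟨l.1.1 - 1, by have := mem_Y.1 l.2; lia⟩, ⟨l.1.2 - 1, by have := mem_Y.1 l.2; lia⟩) : Fin d × Fin d))
    (j := fun p hp => (⟨((p.1 : ℕ) + 1, (p.2 : ℕ) + 1), mem_Y.2
      ⟨by simpa using (mem_filter.1 hp).2, by simp⟩⟩ : Y d)) ?_ ?_ ?_ ?_ ?_
  · intro l hl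
    have h1 := mem_Y.1 l.2
    have h2 := (mem_filter.1 hl).2
    simp only [mem_filter, mem_univ, true_and]
    lia
  · intro p hp
    simp
  · intro l hl
    have h1 := mem_Y.1 l.2
    have h2 := (mem_filter.1 hl).2
    apply Subtype.ext
    ext <;> simp <;> lia
  · intro p hp
    simp
  · intro l hl
    have h1 := mem_Y.1 l.2
    have h2 := (mem_filter.1 hl).2
    have e1 : fstIdx l = idx0 ⟨l.1.1 - 1, by lia⟩ := by
      apply Subtype.ext
      simp only [fstIdx, idx0]
      ext
      · simp; lia
      · simp
    have e2 : sndIdx l h2 = idx0 ⟨l.1.2 - 1, by lia⟩ := by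
      apply Subtype.ext
      simp only [sndIdx, idx0]
      ext
      · simp; lia
      · simp
    have e3 : l.1.2 - 1 < l.1.1 - 1 := by lia
    have e4 : ((l.1.1 - 1) + 1, (l.1.2 - 1) + 1) = l.1 := by
      ext <;> simp <;> lia
    rw [G0.cross, dif_neg h2, e1, e2, hg, hg', thetaMat, dif_pos e3]
    have e5 : ∀ h, θ ⟨((l.1.1 - 1) + 1, (l.1.2 - 1) + 1), h⟩ = θ l := by
      intro h
      congr 1
      exact Subtype.ext e4
    rw [e5]; ring

theorem pairing_mul (θ : Y d → ℝ) {g g' : G0 d} {u u' : Fin d → ℤ} (hg : HasHoriz g u)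
    (hg' : HasHoriz g' u') :
    pairing (g * g') θ = pairing g θ + pairing g' θ + form (thetaMat θ) u u' := by
  simp only [pairing, G0.mul_coord, add_mul, sum_add_distrib]
  rw [sum_cross θ hg hg']

theorem pairing_one (θ : Y d → ℝ) : pairing (1 : G0 d) θ = 0 := by
  simp [pairing, G0.one_coord]

theorem HasHoriz.mul {g g' : G0 d} {u u' : Fin d → ℤ} (hg : HasHoriz g u) (hg' : HasHoriz g' u') :
    HasHoriz (g * g') (u + u') := by
  intro l
  rw [G0.mul_coord, hg, hg']
  simp [G0.cross, idx0]

theorem hasHoriz_one : HasHoriz (1 : G0 d) 0 := by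
  intro l; simp [G0.one_coord]

theorem HasHoriz.inv {g : G0 d} {u : Fin d → ℤ} (hg : HasHoriz g u) : HasHoriz g⁻¹ (-u) := by
  intro l
  rw [G0.inv_coord, hg]
  simp [G0.cross, idx0]

theorem hasHoriz_A0 (n : ℤ) : HasHoriz (A0 d n) (curve d n) := by
  intro l
  simp [A0, idx0, curve]

/-- The ordered sum `∑_{j < k} B(h_j, h_k)`. -/
noncomputable def orderedForm (Θ : Fin d → Fin d → ℝ) : List (Fin d → ℤ) → ℝ
  | [] => 0
  | h :: t => form Θ h t.sum + orderedForm Θ t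

theorem list_prod_pairing {ι : Type*} (θ : Y d → ℝ) (gl : ι → G0 d) (hv : ι → Fin d → ℤ)
    (hgl : ∀ v, HasHoriz (gl v) (hv v)) (l : List ι) :
    HasHoriz (l.map gl).prod (l.map hv).sum ∧
    pairing (l.map gl).prod θ =
      (l.map fun v => pairing (gl v) θ).sum + orderedForm (thetaMat θ) (l.map hv) := by
  induction l with
  | nil => simp [hasHoriz_one, pairing_one, orderedForm]
  | cons v l ih =>
    simp only [List.map_cons, List.prod_cons, List.sum_cons, orderedForm]
    refine ⟨(hgl v).mul ih.1, ?_⟩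
    rw [pairing_mul θ (hgl v) ih.1, ih.2]
    ring

/-- The phase is the same `orderedForm` that `list_prod_pairing` finds in the central part of a
group product; this match is what lets operators model the exponential sum. -/
theorem list_prod_twist (Θ : Fin d → Fin d → ℝ) (l : List (Fin d → ℤ)) :
    (l.map (twist Θ)).prod = e (-orderedForm Θ l) • twist Θ l.sum := by
  induction l with
  | nil => simp [orderedForm, e_zero, twist_zero]
  | cons h t ih =>
    simp only [List.map_cons, List.prod_cons, List.sum_cons, orderedForm]
    rw [ih, mul_smul_comm, twist_mul, smul_smul, ← e_add]
    congr 2; ring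

theorem prod_ofFn_sum {R ι : Type*} [Ring R] {r : ℕ} (B : Finset ι) (f : Fin r → ι → R) :
    (List.ofFn fun j => ∑ v ∈ B, f j v).prod =
      ∑ u ∈ Fintype.piFinset fun _ : Fin r => B, (List.ofFn fun j => f j (u j)).prod := by
  induction r with
  | zero => simp
  | succ r ih =>
    simp only [List.ofFn_succ, List.prod_cons]
    rw [ih, sum_mul_sum, ← sum_product']
    refine sum_bij' (fun p _ => (Fin.cons p.1 p.2 : Fin (r + 1) → ι)) (fun u _ => (u 0, Fin.tail u))
      ?_ ?_ ?_ ?_ ?_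
    · intro p hp
      rw [mem_product, Fintype.mem_piFinset] at hp
      rw [Fintype.mem_piFinset]
      intro j
      refine Fin.cases ?_ (fun j => ?_) j
      · simpa using hp.1
      · simpa using hp.2 j
    · intro u hu
      rw [Fintype.mem_piFinset] at hu
      rw [mem_product, Fintype.mem_piFinset]
      exact ⟨hu 0, fun j => hu j.succ⟩
    · intro p _; simp
    · intro u _; simp
    · intro p _; simp

/-- The horizontal part of `A₀(n)⁻¹ A₀(m)` (for `σ = 1`) or `A₀(n) A₀(m)⁻¹` (for `σ = -1`). -/
def hvec (d : ℕ) (σ : ℤ) (v : ℤ × ℤ) : Fin d → ℤ := fun l => σ * (curve d v.2 l - curve d v.1 l)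

/-- The operator `∑_{n, m} F(n, m) V_{h(n, m)}`. -/
noncomputable def stepOp (Θ : Fin d → Fin d → ℝ) (σ : ℤ) (P : ℕ) (F : ℤ × ℤ → ℂ) :
    Ell2 d →L[ℂ] Ell2 d :=
  ∑ v ∈ pairBox P, F v • twist Θ (hvec d σ v)

theorem prod_stepOp (Θ : Fin d → Fin d → ℝ) (σ : ℤ) (P : ℕ) {r : ℕ} (F : Fin r → ℤ × ℤ → ℂ) :
    (List.ofFn fun j => stepOp Θ σ P (F j)).prod =
      ∑ u ∈ Fintype.piFinset fun _ : Fin r => pairBox P,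
        ((∏ j, F j (u j)) * e (-orderedForm Θ (List.ofFn fun j => hvec d σ (u j)))) •
          twist Θ (∑ j, hvec d σ (u j)) := by
  simp only [stepOp]
  rw [prod_ofFn_sum]
  refine sum_congr rfl fun u hu => ?_
  clear hu
  have h1 : (List.ofFn fun j => twist Θ (hvec d σ (u j))).prod =
      e (-orderedForm Θ (List.ofFn fun j => hvec d σ (u j))) • twist Θ (∑ j, hvec d σ (u j)) := by
    have := list_prod_twist Θ (List.ofFn fun j => hvec d σ (u j))
    rwa [List.map_ofFn, List.sum_ofFn] at this
  rw [mul_smul, ← h1]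
  clear h1
  induction r with
  | zero => simp
  | succ r ih =>
    simp only [List.ofFn_succ, List.prod_cons]
    rw [ih (fun j => F j.succ) (fun j => u j.succ), Fin.prod_univ_succ, smul_mul_smul_comm]

theorem abs_curve_le {P : ℕ} {n : ℤ} (hn : n ∈ Ico (-(P : ℤ)) (P + 1)) (l : Fin d) :
    |curve d n l| ≤ (P : ℤ) ^ ((l : ℕ) + 1) := by
  rw [mem_Ico] at hn
  rw [curve, abs_pow]
  exact pow_le_pow_left₀ (abs_nonneg _) (abs_le.2 ⟨by lia, by lia⟩) _

theorem sum_hvec_mem_box {σ : ℤ} (hσ : |σ| = 1) {P r : ℕ} {u : Fin r → ℤ × ℤ}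
    (hu : u ∈ Fintype.piFinset fun _ : Fin r => pairBox P) :
    ∑ j, hvec d σ (u j) ∈ box (fun l : Fin d => 2 * r * P ^ ((l : ℕ) + 1)) := by
  rw [mem_box]
  intro l
  rw [← abs_le]
  push_cast
  rw [Finset.sum_apply]
  calc |∑ j, hvec d σ (u j) l| ≤ ∑ j : Fin r, 2 * (P : ℤ) ^ ((l : ℕ) + 1) := by
        refine (abs_sum_le_sum_abs _ _).trans (sum_le_sum fun j _ => ?_)
        have h1 := Fintype.mem_piFinset.1 hu j
        rw [pairBox, mem_product] at h1
        rw [hvec, abs_mul, hσ, one_mul]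
        have h2 := abs_curve_le h1.1 l
        have h3 := abs_curve_le h1.2 l
        exact (abs_sub _ _).trans (by linarith)
    _ = _ := by rw [sum_const, card_univ, Fintype.card_fin, nsmul_eq_mul]; ring

theorem list_prod_norm_le {E : Type*} [NormedRing E] (hone : ‖(1 : E)‖ ≤ 1) {p : E → Prop} {A a : ℝ} {s : ℕ}
    (hA : ∀ l : List E, l.length = s → (∀ x ∈ l, p x) → ‖l.prod‖ ≤ A) (hA0 : 0 ≤ A) (ha0 : 0 ≤ a)
    (ha : ∀ x, p x → ‖x‖ ≤ a) (q t : ℕ) (l : List E) (hl : l.length = s * q + t)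
    (hp : ∀ x ∈ l, p x) : ‖l.prod‖ ≤ A ^ q * a ^ t := by
  induction q generalizing l with
  | zero =>
    rw [pow_zero, one_mul]
    simp only [mul_zero, zero_add] at hl
    induction t generalizing l with
    | zero => rw [List.length_eq_zero_iff.1 hl]; simpa using hone
    | succ t ih =>
      match l, hl with
      | x :: l, hl =>
        rw [List.prod_cons, pow_succ']
        refine (norm_mul_le _ _).trans ?_
        have h1 := ih l (fun y hy => hp y (List.mem_cons_of_mem _ hy)) (by simpa using hl)
        have h2 := ha x (hp x List.mem_cons_self)
        gcongr
  | succ q ih =>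
    have h1 := hA (l.take s) (by rw [List.length_take, hl, Nat.mul_succ]; lia)
      fun x hx => hp x (List.mem_of_mem_take hx)
    have h2 := ih (l.drop s) (by rw [List.length_drop, hl, Nat.mul_succ]; lia)
      fun x hx => hp x (List.mem_of_mem_drop hx)
    rw [← List.prod_take_mul_prod_drop l s, pow_succ']
    refine (norm_mul_le _ _).trans ?_
    rw [mul_assoc]
    gcongr

/-- Blocks of `s` step operators have small norm unless all alternating frequencies are major. -/
theorem norm_block_le (d : ℕ) : ∃ K : ℝ, 1 ≤ K ∧ ∃ C s : ℕ, 1 ≤ s ∧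
    ∀ (Θ : Fin d → Fin d → ℝ) (P : ℕ) (H : ℝ) (σ : ℤ), |σ| = 1 → 1 ≤ P → 1 ≤ H →
      (∃ i j : Fin d, ¬ Major (K * H ^ C) (P ^ ((i : ℕ) + 1 + ((j : ℕ) + 1))) (Θ j i - Θ i j)) →
      ∀ F : Fin s → ℤ × ℤ → ℂ, (∀ j v, ‖F j v‖ ≤ 1) →
        ‖(List.ofFn fun j => stepOp Θ σ P (F j)).prod‖ ≤ K * P ^ (2 * s) / H := by
  classical
  obtain ⟨K₁, hK₁, s, hs, hcount⟩ := vinogradov_count d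
  obtain ⟨K₂, hK₂, C, hmin⟩ := minor_inverse d s hs
  refine ⟨max K₁ K₂, hK₁.trans (le_max_left _ _), C, s, hs, ?_⟩
  intro Θ P H σ hσ hP hH hex F hF
  obtain ⟨i, j, hij⟩ := hex
  by_contra! hcon
  have hP' : (1 : ℝ) ≤ P := by exact_mod_cast hP
  set V : ℝ := ∏ l : Fin d, (P : ℝ) ^ ((l : ℕ) + 1) with hV
  have hV0 : 0 < V := prod_pos fun l _ => by positivity
  set U := Fintype.piFinset fun _ : Fin s => pairBox P with hU
  let c : (Fin s → ℤ × ℤ) → ℂ := fun u =>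
    (∏ j, F j (u j)) * e (-orderedForm Θ (List.ofFn fun j => hvec d σ (u j)))
  -- Collecting terms by total displacement `Z` turns the block into one combination of twisted
  -- translations.
  let m : (Fin d → ℤ) → ℂ := fun Z => ∑ u ∈ U with ∑ j, hvec d σ (u j) = Z, c u
  have hc : ∀ u, ‖c u‖ ≤ 1 := by
    intro u
    simp only [c]
    rw [norm_mul, norm_e, mul_one, norm_prod]
    exact prod_le_one (fun _ _ => norm_nonneg _) fun j _ => hF j _
  have hprod : (List.ofFn fun j => stepOp Θ σ P (F j)).prod =
      ∑ Z ∈ box (fun l : Fin d => 2 * s * P ^ ((l : ℕ) + 1)), m Z • twist Θ Z := by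
    rw [prod_stepOp, ← sum_fiberwise_of_maps_to (fun u hu => sum_hvec_mem_box hσ hu)]
    refine sum_congr rfl fun Z _ => ?_
    simp only [m]
    rw [sum_smul]
    refine sum_congr rfl fun u hu => ?_
    rw [(mem_filter.1 hu).2]
  have hm0 : ∀ Z, Z ∉ box (fun l : Fin d => 2 * s * P ^ ((l : ℕ) + 1)) → m Z = 0 := by
    intro Z hZ
    refine sum_eq_zero fun u hu => ?_
    obtain ⟨h1, h2⟩ := mem_filter.1 hu
    exact absurd (h2 ▸ sum_hvec_mem_box hσ h1) hZ
  -- The mean value estimate spreads the `P ^ (2s)` terms evenly over the roughly `V` available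
  -- displacements. This is what fixes the block length `s`.
  have hm : ∀ Z, ‖m Z‖ ≤ K₁ * P ^ (2 * s) / V := by
    intro Z
    rw [le_div_iff₀ hV0]
    refine le_trans ?_ (hcount P (fun l => σ * Z l) hP)
    gcongr
    calc ‖m Z‖ ≤ ∑ u ∈ U with ∑ j, hvec d σ (u j) = Z, 1 :=
          (norm_sum_le _ _).trans (sum_le_sum fun u _ => hc u)
      _ = ((U.filter fun u => ∑ j, hvec d σ (u j) = Z).card : ℝ) := by simp
      _ ≤ _ := by
          norm_cast
          refine card_le_card (monotone_filter_right _ fun u _ hu l => ?_)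
          rw [← hu, Finset.sum_apply, mul_sum]
          refine sum_congr rfl fun j _ => ?_
          have : σ * σ = 1 := by
            rcases (abs_eq (by norm_num)).1 hσ with rfl | rfl <;> norm_num
          rw [hvec, ← mul_assoc, this, one_mul]
  refine hij ((hmin Θ P H (K₁ * P ^ (2 * s) / V) m hP hH (by positivity) hm0 hm ?_ i j).mono ?_
    (by positivity))
  · rw [← hprod, div_mul_cancel₀ _ hV0.ne']
    refine le_trans ?_ hcon.le
    gcongr
    exact le_max_left _ _
  · gcongr
    exact le_max_right _ _

end

/-! ### The case of a minor central frequency -/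

section

variable {d : ℕ}

theorem IsCutoff.abs_le_one {r P : ℕ} {φ ψ : Fin r → ℝ → ℝ} (h : IsCutoff P φ ψ) (j : Fin r) (x : ℝ) :
    |φ j x| ≤ 1 ∧ |ψ j x| ≤ 1 := by
  have h1 := h.bound j x
  have h2 : Set.indicator (Set.Icc (-(P : ℝ)) P) (fun _ => (1 : ℝ)) x ≤ 1 :=
    Set.indicator_le_self' (fun _ _ => zero_le_one) x
  constructor <;> linarith [abs_nonneg (φ j x), abs_nonneg (ψ j x)]

theorem IsCutoff.eq_zero {r P : ℕ} {φ ψ : Fin r → ℝ → ℝ} (h : IsCutoff P φ ψ) (j : Fin r) {x : ℝ}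
    (hx : x ∉ Set.Icc (-(P : ℝ)) P) : φ j x = 0 ∧ ψ j x = 0 := by
  have h1 := h.bound j x
  rw [Set.indicator_of_notMem hx] at h1
  constructor <;> rw [← abs_nonpos_iff] <;> linarith [abs_nonneg (φ j x), abs_nonneg (ψ j x)]

theorem notMem_Icc_of_notMem_Ico {P : ℕ} {n : ℤ} (h : n ∉ Ico (-(P : ℤ)) (P + 1)) :
    (n : ℝ) ∉ Set.Icc (-(P : ℝ)) P := by
  intro hc
  apply h
  rw [mem_Ico]
  have h1 : -(P : ℤ) ≤ n := by exact_mod_cast hc.1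
  have h2 : n ≤ (P : ℤ) := by exact_mod_cast hc.2
  lia

/-- The family of group elements `A₀(n)⁻¹ A₀(m)` or `A₀(n) A₀(m)⁻¹` is encoded by `gl`, with `E` the
corresponding ordered product. -/
structure IsModel (d r : ℕ) (σ : ℤ) (gl : ℤ × ℤ → G0 d)
    (E : (Fin r → ℝ) → (Fin r → ℝ) → G0 d) : Prop where
  abs_sign : |σ| = 1
  horiz : ∀ v, HasHoriz (gl v) (hvec d σ v)
  prod_eq : ∀ u : Fin r → ℤ × ℤ, E (fun j => ((u j).1 : ℝ)) (fun j => ((u j).2 : ℝ)) =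
    (List.ofFn fun j => gl (u j)).prod

theorem isModel_D (d r : ℕ) :
    IsModel d r 1 (fun v => (A0 d v.1)⁻¹ * A0 d v.2) (D d r) where
  abs_sign := by norm_num
  horiz v := by
    convert (hasHoriz_A0 v.1).inv.mul (hasHoriz_A0 v.2) using 1
    ext l
    simp only [hvec, Pi.add_apply, Pi.neg_apply]; ring
  prod_eq _ := rfl

theorem isModel_Dtilde (d r : ℕ) :
    IsModel d r (-1) (fun v => A0 d v.1 * (A0 d v.2)⁻¹) (Dtilde d r) where
  abs_sign := by norm_num
  horiz v := by
    convert (hasHoriz_A0 v.1).mul (hasHoriz_A0 v.2).inv using 1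
    ext l
    simp only [hvec, Pi.add_apply, Pi.neg_apply]; ring
  prod_eq _ := rfl

variable {r : ℕ} {σ : ℤ} {gl : ℤ × ℤ → G0 d} {E : (Fin r → ℝ) → (Fin r → ℝ) → G0 d}

theorem IsModel.pairing_eq (hE : IsModel d r σ gl E) (θ : Y d → ℝ) (u : Fin r → ℤ × ℤ) :
    pairing (E (fun j => ((u j).1 : ℝ)) (fun j => ((u j).2 : ℝ))) θ =
      ∑ j, pairing (gl (u j)) θ +
        orderedForm (thetaMat θ) (List.ofFn fun j => hvec d σ (u j)) := by
  have := (list_prod_pairing θ gl (hvec d σ) hE.horiz (List.ofFn u)).2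
  rw [List.map_ofFn, List.map_ofFn, List.map_ofFn, List.sum_ofFn] at this
  rw [hE.prod_eq]
  exact this

theorem expSum_eq_sum {P : ℕ} {φ ψ : Fin r → ℝ → ℝ} (hφ : IsCutoff P φ ψ)
    (E : (Fin r → ℝ) → (Fin r → ℝ) → G0 d) (θ : Y d → ℝ) :
    expSum E φ ψ θ = ∑ u ∈ Fintype.piFinset fun _ : Fin r => pairBox P,
      (∏ j, ((φ j (u j).1 * ψ j (u j).2 : ℝ) : ℂ)) *
        e (-pairing (E (fun j => ((u j).1 : ℝ)) (fun j => ((u j).2 : ℝ))) θ) := by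
  rw [expSum, ← (Equiv.arrowProdEquivProdArrow (Fin r) (fun _ => ℤ) (fun _ => ℤ)).tsum_eq]
  rw [tsum_eq_sum (s := Fintype.piFinset fun _ : Fin r => pairBox P)]
  · refine sum_congr rfl fun u _ => ?_
    simp only [Equiv.arrowProdEquivProdArrow_apply]
    rw [e]
    push_cast
    rw [prod_mul_distrib, mul_assoc, mul_comm]
    congr 2
    ring
  · intro u hu
    rw [Fintype.mem_piFinset] at hu
    push Not at hu
    obtain ⟨j, hj⟩ := hu
    rw [pairBox, mem_product, not_and_or] at hj
    simp only [Equiv.arrowProdEquivProdArrow_apply]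
    rcases hj with hj | hj
    · have : ∏ j, φ j ((u j).1 : ℝ) = 0 :=
        prod_eq_zero (mem_univ j) (hφ.eq_zero j (notMem_Icc_of_notMem_Ico hj)).1
      rw [this]; simp
    · have : ∏ j, ψ j ((u j).2 : ℝ) = 0 :=
        prod_eq_zero (mem_univ j) (hφ.eq_zero j (notMem_Icc_of_notMem_Ico hj)).2
      rw [this]; simp

theorem card_pairBox_le {P : ℕ} (hP : 1 ≤ P) : ((pairBox P).card : ℝ) ≤ 9 * P ^ 2 := by
  rw [pairBox, card_product, Int.card_Ico]
  have : ((P : ℤ) + 1 - -(P : ℤ)).toNat = 2 * P + 1 := by lia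
  rw [this]
  have hP' : (1 : ℝ) ≤ P := by exact_mod_cast hP
  push_cast
  nlinarith

theorem norm_expSum_le {P : ℕ} (hP : 1 ≤ P) {φ ψ : Fin r → ℝ → ℝ} (hφ : IsCutoff P φ ψ)
    (E : (Fin r → ℝ) → (Fin r → ℝ) → G0 d) (θ : Y d → ℝ) :
    ‖expSum E φ ψ θ‖ ≤ 9 ^ r * P ^ (2 * r) := by
  rw [expSum_eq_sum hφ]
  calc _ ≤ ∑ u ∈ Fintype.piFinset fun _ : Fin r => pairBox P, (1 : ℝ) := by
        refine (norm_sum_le _ _).trans (sum_le_sum fun u _ => ?_)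
        rw [norm_mul, norm_e, mul_one, norm_prod]
        refine prod_le_one (fun _ _ => norm_nonneg _) fun j _ => ?_
        rw [Complex.norm_real, Real.norm_eq_abs, abs_mul]
        exact mul_le_one₀ (hφ.abs_le_one j _).1 (abs_nonneg _) (hφ.abs_le_one j _).2
    _ = ((pairBox P).card : ℝ) ^ r := by simp
    _ ≤ (9 * P ^ 2) ^ r := by gcongr; exact card_pairBox_le hP
    _ = _ := by rw [mul_pow, pow_mul]

/-- Apply the product to the delta at `0` and add up its values on the box. A twisted translation by
`X` carries this delta to the delta at `X` with no extra phase, because `form Θ X 0 = 0`, so each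
term appears exactly once. The power of `P` in the box size does not depend on `r`. -/
theorem IsModel.norm_expSum_le_opNorm (hE : IsModel d r σ gl E) {P : ℕ} {φ ψ : Fin r → ℝ → ℝ}
    (hφ : IsCutoff P φ ψ) (θ : Y d → ℝ) :
    ‖expSum E φ ψ θ‖ ≤ (box (fun l : Fin d => 2 * r * P ^ ((l : ℕ) + 1))).card *
      ‖(List.ofFn fun j => stepOp (thetaMat θ) σ P
        (fun v => ((φ j v.1 * ψ j v.2 : ℝ) : ℂ) * e (-pairing (gl v) θ))).prod‖ := by
  classical
  set L := (List.ofFn fun j => stepOp (thetaMat θ) σ P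
        (fun v => ((φ j v.1 * ψ j v.2 : ℝ) : ℂ) * e (-pairing (gl v) θ))).prod with hL
  let δ : Ell2 d := lp.single 2 0 (1 : ℂ)
  have hδ : ‖δ‖ = 1 := by simp [δ, lp.norm_single]
  have key : expSum E φ ψ θ = ∑ U ∈ box (fun l : Fin d => 2 * r * P ^ ((l : ℕ) + 1)), (L δ) U := by
    rw [expSum_eq_sum hφ, hL, prod_stepOp]
    have h1 : ∀ U : Fin d → ℤ, ((∑ u ∈ Fintype.piFinset fun _ : Fin r => pairBox P,
        ((∏ j, ((φ j (u j).1 * ψ j (u j).2 : ℝ) : ℂ) * e (-pairing (gl (u j)) θ)) *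
          e (-orderedForm (thetaMat θ) (List.ofFn fun j => hvec d σ (u j)))) •
          twist (thetaMat θ) (∑ j, hvec d σ (u j))) δ) U =
        ∑ u ∈ Fintype.piFinset fun _ : Fin r => pairBox P,
          if ∑ j, hvec d σ (u j) = U then
            ((∏ j, ((φ j (u j).1 * ψ j (u j).2 : ℝ) : ℂ) * e (-pairing (gl (u j)) θ)) *
          e (-orderedForm (thetaMat θ) (List.ofFn fun j => hvec d σ (u j)))) else 0 := by
      intro U
      rw [_root_.sum_apply, lp.coeFn_sum, Finset.sum_apply]
      refine sum_congr rfl fun u _ => ?_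
      have h2 : twist (thetaMat θ) (∑ j, hvec d σ (u j)) δ U =
          if ∑ j, hvec d σ (u j) = U then 1 else 0 := by
        rw [twist_apply]
        split_ifs with h
        · rw [h, sub_self, form_zero_right, neg_zero, e_zero, one_mul]
          simp [δ]
        · have : U - ∑ j, hvec d σ (u j) ≠ 0 := fun hc => h (sub_eq_zero.1 hc).symm
          simp only [δ]
          rw [lp.single_apply_ne _ _ _ this, mul_zero]
      change _ * (twist (thetaMat θ) (∑ j, hvec d σ (u j)) δ U) = _
      rw [h2]
      split_ifs <;> simp
    simp only [h1]
    rw [sum_comm]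
    refine sum_congr rfl fun u hu => ?_
    rw [sum_ite_eq, if_pos (sum_hvec_mem_box hE.abs_sign hu), hE.pairing_eq, neg_add, e_add,
      ← sum_neg_distrib, e_sum, ← mul_assoc, prod_mul_distrib]
  rw [key, ← nsmul_eq_mul]
  refine (norm_sum_le _ _).trans (sum_le_card_nsmul _ _ _ fun U _ => ?_)
  calc ‖(L δ) U‖ ≤ ‖L δ‖ := lp.norm_apply_le_norm (by norm_num) _ _
    _ ≤ ‖L‖ * ‖δ‖ := L.le_opNorm δ
    _ = ‖L‖ := by rw [hδ, mul_one]

/-- If some central frequency is not major, the exponential sum has power savings in `r`. -/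
theorem central_minor_bound (d : ℕ) : ∃ K : ℝ, 1 ≤ K ∧ ∃ C s : ℕ, 1 ≤ s ∧
    ∀ (r : ℕ) (σ : ℤ) (gl : ℤ × ℤ → G0 d) (E : (Fin r → ℝ) → (Fin r → ℝ) → G0 d),
      IsModel d r σ gl E → 1 ≤ r → ∀ (P : ℕ) (H : ℝ) (φ ψ : Fin r → ℝ → ℝ) (θ : Y d → ℝ),
      1 ≤ P → 1 ≤ H → IsCutoff P φ ψ →
      (∃ l : Y d, l.1.2 ≠ 0 ∧ ¬ Major (K * H ^ C) (P ^ (l.1.1 + l.1.2)) (θ l)) →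
      ‖expSum E φ ψ θ‖ ≤ (5 * r) ^ d * (9 * K) ^ r * (P ^ (d * d) * P ^ (2 * r) / H ^ (r / s)) := by
  obtain ⟨K, hK, C, s, hs, hblock⟩ := norm_block_le d
  refine ⟨K, hK, C, s, hs, ?_⟩
  intro r σ gl E hE hr P H φ ψ θ hP hH hφ ⟨l, hl0, hl⟩
  have hP' : (1 : ℝ) ≤ P := by exact_mod_cast hP
  have hY := mem_Y.1 l.2
  -- The matrix is strictly lower triangular, so the antisymmetric difference at this position is
  -- exactly `θ l`.
  have hmin : ∃ i j : Fin d, ¬ Major (K * H ^ C) (P ^ ((i : ℕ) + 1 + ((j : ℕ) + 1)))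
      (thetaMat θ j i - thetaMat θ i j) := by
    refine ⟨⟨l.1.2 - 1, by lia⟩, ⟨l.1.1 - 1, by lia⟩, ?_⟩
    have e1 : l.1.2 - 1 < l.1.1 - 1 := by lia
    have e2 : l.1.2 - 1 + 1 = l.1.2 := by lia
    have e3 : l.1.1 - 1 + 1 = l.1.1 := by lia
    rw [thetaMat, thetaMat, dif_pos e1, dif_neg (by simp; lia), sub_zero]
    have e5 : ∀ h, θ ⟨((l.1.1 - 1) + 1, (l.1.2 - 1) + 1), h⟩ = θ l := by
      intro h
      congr 1
      exact Subtype.ext (by ext <;> simp [e2, e3])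
    rw [e5]
    simp only [e2, e3]
    rwa [add_comm]
  set Θ := thetaMat θ
  let p : (Ell2 d →L[ℂ] Ell2 d) → Prop := fun x => ∃ F : ℤ × ℤ → ℂ, (∀ v, ‖F v‖ ≤ 1) ∧ x = stepOp Θ σ P F
  have hA : ∀ l : List (Ell2 d →L[ℂ] Ell2 d), l.length = s → (∀ x ∈ l, p x) →
      ‖l.prod‖ ≤ K * P ^ (2 * s) / H := by
    intro l hl hp
    subst hl
    have h1 : ∀ j : Fin l.length, p (l.get j) := fun j => hp _ (List.get_mem l j)
    choose F hF1 hF2 using h1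
    have h2 : l = List.ofFn fun j => stepOp Θ σ P (F j) := by
      conv_lhs => rw [← List.ofFn_get l]
      congr 1
      ext1 j
      exact hF2 j
    have h3 := hblock Θ P H σ hE.abs_sign hP hH hmin F hF1
    rwa [← h2] at h3
  have ha : ∀ x, p x → ‖x‖ ≤ 9 * P ^ 2 := by
    rintro x ⟨F, hF, rfl⟩
    refine le_trans ?_ (card_pairBox_le hP)
    calc _ ≤ ∑ v ∈ pairBox P, (1 : ℝ) := by
          refine (norm_sum_le _ _).trans (sum_le_sum fun v _ => ?_)
          rw [norm_smul]
          exact mul_le_one₀ (hF v) (norm_nonneg _) (norm_twist_le _ _)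
      _ = _ := by simp
  -- Each of the `r / s` full blocks saves `H`; the `r % s` leftover operators are bounded
  -- trivially.
  have hop := list_prod_norm_le (ContinuousLinearMap.norm_id_le) hA (by positivity) (by positivity) ha (r / s) (r % s)
    (List.ofFn fun j => stepOp Θ σ P
        (fun v => ((φ j v.1 * ψ j v.2 : ℝ) : ℂ) * e (-pairing (gl v) θ)))
    (by rw [List.length_ofFn, Nat.div_add_mod]) (by
      intro x hx
      obtain ⟨j, rfl⟩ := (List.mem_ofFn' _ _).1 hx
      refine ⟨_, fun v => ?_, rfl⟩
      rw [norm_mul, norm_e, mul_one, Complex.norm_real, Real.norm_eq_abs, abs_mul]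
      exact mul_le_one₀ (hφ.abs_le_one j _).1 (abs_nonneg _) (hφ.abs_le_one j _).2)
  have hbox : ((box (fun l : Fin d => 2 * r * P ^ ((l : ℕ) + 1))).card : ℝ) ≤ (5 * r) ^ d * P ^ (d * d) := by
    rw [card_box]
    calc _ ≤ ∏ l : Fin d, (5 * (r : ℝ) * P ^ d) := by
          refine prod_le_prod (fun _ _ => by positivity) fun l _ => ?_
          have h1 : (P : ℝ) ^ ((l : ℕ) + 1) ≤ P ^ d := pow_le_pow_right₀ hP' (by have := l.2; lia)
          have hr' : (1 : ℝ) ≤ r := by exact_mod_cast hr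
          have h2 : (1 : ℝ) ≤ r * P ^ d := one_le_mul_of_one_le_of_one_le hr' (one_le_pow₀ hP')
          push_cast
          have h3 : (r : ℝ) * P ^ ((l : ℕ) + 1) ≤ r * P ^ d := by gcongr
          linarith
      _ = _ := by rw [prod_const, card_univ, Fintype.card_fin, mul_pow, ← pow_mul]
  have hr2 : s * (r / s) + r % s = r := Nat.div_add_mod r s
  calc _ ≤ _ := hE.norm_expSum_le_opNorm hφ θ
    _ ≤ ((5 * r) ^ d * P ^ (d * d)) * ((K * P ^ (2 * s) / H) ^ (r / s) * (9 * P ^ 2) ^ (r % s)) := by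
        gcongr
    _ = (5 * r) ^ d * (K ^ (r / s) * 9 ^ (r % s)) * (P ^ (d * d) * P ^ (2 * (s * (r / s) + r % s)) / H ^ (r / s)) := by
        have h1 : (K * P ^ (2 * s) / H) ^ (r / s) = K ^ (r / s) * P ^ (2 * s * (r / s)) / H ^ (r / s) := by
          rw [div_pow, mul_pow, ← pow_mul]
        have h2 : (9 * (P : ℝ) ^ 2) ^ (r % s) = 9 ^ (r % s) * P ^ (2 * (r % s)) := by
          rw [mul_pow, ← pow_mul]
        rw [h1, h2, mul_add 2, pow_add, ← mul_assoc 2]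
        ring
    _ ≤ _ := by
        rw [hr2, mul_pow 9 K r, mul_comm (9 ^ r)]
        gcongr
        · exact Nat.div_le_self r s
        · norm_num
        · exact Nat.mod_le r s

end

/-! ### Multipliers that can be separated from product weights -/

section

variable {ι : Type*} [Fintype ι] [DecidableEq ι]

/-- `F` tested against products of weights of size `B_i` on a box is at most `c ∏ B_i`. -/
def Tame (Q : ℕ) (a b : ι → ℤ) (F : (ι → ℤ) → ℂ) (c : ℝ) : Prop :=
  ∀ (w : ι → ℤ → ℂ) (B : ι → ℝ), (∀ i, Small Q (a i) (b i) (w i) (B i)) →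
    ‖∑ x ∈ Fintype.piFinset fun i => Ico (a i) (b i), F x * ∏ i, w i (x i)‖ ≤ c * ∏ i, B i

variable {Q : ℕ} {a b : ι → ℤ} {F G : (ι → ℤ) → ℂ} {c c' : ℝ}

/-- On each of the residue classes modulo `Q` the function `g` is constant, and the remaining sum
factors into one-variable sums over residue classes. -/
theorem tame_periodic (hQ : 1 ≤ Q) (g : (ι → ℤ) → ℂ) (hg : ∀ x, ‖g x‖ ≤ 1)
    (hper : ∀ x, g (fun i => x i % Q) = g x) : Tame Q a b g (Q ^ Fintype.card ι) := by
  intro w B hw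
  have hB : 0 ≤ ∏ i, B i := prod_nonneg fun i _ => (hw i).nonneg
  have hmap : ∀ x ∈ Fintype.piFinset fun i => Ico (a i) (b i),
      (fun i => x i % (Q : ℤ)) ∈ Fintype.piFinset fun _ : ι => Ico (0 : ℤ) Q := by
    intro x _
    rw [Fintype.mem_piFinset]
    intro i
    rw [mem_Ico]
    exact ⟨Int.emod_nonneg _ (by lia), Int.emod_lt_of_pos _ (by lia)⟩
  rw [← sum_fiberwise_of_maps_to hmap]
  calc _ ≤ ∑ _z ∈ Fintype.piFinset fun _ : ι => Ico (0 : ℤ) Q, ∏ i, B i := by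
        refine (norm_sum_le _ _).trans (sum_le_sum fun z hz => ?_)
        have hz' : ∀ i, z i % Q = z i := fun i => by
          have := mem_Ico.1 (Fintype.mem_piFinset.1 hz i)
          exact Int.emod_eq_of_lt this.1 this.2
        have h1 : ∑ x ∈ Fintype.piFinset (fun i => Ico (a i) (b i)) with (fun i => x i % (Q : ℤ)) = z,
            g x * ∏ i, w i (x i) = g z * ∏ i, ∑ x ∈ Ico (a i) (b i) with x % Q = z i % Q, w i x := by
          rw [prod_univ_sum, mul_sum]
          refine sum_congr ?_ fun x hx => ?_
          · ext x
            simp only [mem_filter, Fintype.mem_piFinset, funext_iff, hz']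
            exact ⟨fun h i => ⟨h.1 i, h.2 i⟩, fun h => ⟨fun i => (h i).1, fun i => (h i).2⟩⟩
          · have h2 : (fun i => x i % (Q : ℤ)) = z := by
              ext i
              have := (mem_filter.1 (Fintype.mem_piFinset.1 hx i)).2
              rw [this, hz']
            rw [← hper x, h2]
        rw [h1, norm_mul, norm_prod]
        calc _ ≤ 1 * ∏ i, B i := by
              gcongr with i _
              · exact hg z
              · exact (hw i).residue hQ _
          _ = _ := one_mul _
    _ = _ := by simp

/-- A factor depending on one variable is absorbed into the weight of that variable by
`Small.mul_bv`. -/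
theorem Tame.mul_single (hF : Tame Q a b F c) (i : ι) {u : ℤ → ℂ} (hc' : 0 ≤ c')
    (hu : BVle (a i) (b i) u c') : Tame Q a b (fun x => u (x i) * F x) (c' * c) := by
  intro w B hw
  have h := hF (Function.update w i (fun x => u x * w i x)) (Function.update B i (c' * B i)) (by
    intro j
    rcases eq_or_ne j i with rfl | hj
    · simpa using (hw j).mul_bv hc' hu
    · simpa [Function.update_of_ne hj] using hw j)
  have h1 : ∏ j, Function.update B i (c' * B i) j = c' * ∏ j, B j := by
    rw [← mul_prod_erase _ _ (mem_univ i), ← mul_prod_erase univ B (mem_univ i),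
      Function.update_self, mul_assoc]
    congr 2
    exact prod_congr rfl fun j hj => Function.update_of_ne (ne_of_mem_erase hj) _ _
  have h2 : ∀ x : ι → ℤ, ∏ j, Function.update w i (fun x => u x * w i x) j (x j) =
      u (x i) * ∏ j, w j (x j) := by
    intro x
    rw [← mul_prod_erase _ _ (mem_univ i), ← mul_prod_erase univ (fun j => w j (x j)) (mem_univ i),
      Function.update_self, mul_assoc]
    congr 2
    exact prod_congr rfl fun j hj => by rw [Function.update_of_ne (ne_of_mem_erase hj)]
  rw [h1] at h
  simp only [h2] at h
  convert h using 1
  · congr 1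
    exact sum_congr rfl fun x _ => by ring
  · ring

theorem Tame.const_mul (hF : Tame Q a b F c) (z : ℂ) : Tame Q a b (fun x => z * F x) (‖z‖ * c) := by
  intro w B hw
  simp only [mul_assoc, ← mul_sum]
  rw [norm_mul]
  gcongr
  exact hF w B hw

theorem Tame.sum {τ : Type*} (s : Finset τ) {F : τ → (ι → ℤ) → ℂ} {c : τ → ℝ}
    (hF : ∀ t ∈ s, Tame Q a b (F t) (c t)) :
    Tame Q a b (fun x => ∑ t ∈ s, F t x) (∑ t ∈ s, c t) := by
  intro w B hw
  simp only [sum_mul]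
  rw [sum_comm]
  exact (norm_sum_le _ _).trans (sum_le_sum fun t ht => hF t ht w B hw)

theorem Tame.mono (hF : Tame Q a b F c) (h : c ≤ c') : Tame Q a b F c' := by
  intro w B hw
  have hB : 0 ≤ ∏ i, B i := prod_nonneg fun i _ => (hw i).nonneg
  exact (hF w B hw).trans (by gcongr)

/-- Expand `e (ρ x)` in its power series. Multiplying by `ρ` a total of `k` times costs `M ^ k`, and
the factorials sum these costs to an exponential; this handles a phase that does not itself split
into one-variable factors. -/
theorem Tame.exp (hF : Tame Q a b F c) (ρ : (ι → ℤ) → ℝ) {M : ℝ}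
    (hρ : ∀ (G : (ι → ℤ) → ℂ) (c' : ℝ), 0 ≤ c' → Tame Q a b G c' →
      Tame Q a b (fun x => ρ x * G x) (M * c')) (hM : 0 ≤ M) (hc : 0 ≤ c) :
    Tame Q a b (fun x => e (ρ x) * F x) (Real.exp (2 * Real.pi * M) * c) := by
  have hpow : ∀ k : ℕ, Tame Q a b (fun x => (ρ x : ℂ) ^ k * F x) (M ^ k * c) := by
    intro k
    induction k with
    | zero => simpa using hF
    | succ k ih =>
      convert hρ _ _ (by positivity) ih using 1
      · ext x; ring
      · ring
  intro w B hw
  have hterm : ∀ x, HasSum (fun k : ℕ => (2 * Real.pi * Complex.I * ρ x) ^ k / (k.factorial : ℂ))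
      (e (ρ x)) := by
    intro x
    rw [e, Complex.exp_eq_exp_ℂ]
    exact NormedSpace.expSeries_div_hasSum_exp _
  have hsum : HasSum (fun k : ℕ => ∑ x ∈ Fintype.piFinset fun i => Ico (a i) (b i),
      (2 * Real.pi * Complex.I * ρ x) ^ k / (k.factorial : ℂ) * (F x * ∏ i, w i (x i)))
      (∑ x ∈ Fintype.piFinset fun i => Ico (a i) (b i), e (ρ x) * (F x * ∏ i, w i (x i))) :=
    hasSum_sum fun x _ => (hterm x).mul_right _
  have hbound : HasSum (fun k : ℕ => (2 * Real.pi * M) ^ k / (k.factorial : ℝ) * (c * ∏ i, B i))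
      (Real.exp (2 * Real.pi * M) * (c * ∏ i, B i)) := by
    refine HasSum.mul_right _ ?_
    rw [Real.exp_eq_exp_ℝ]
    exact NormedSpace.expSeries_div_hasSum_exp _
  simp only [mul_assoc (e _)]
  rw [← hsum.tsum_eq, mul_assoc (Real.exp _) c]
  refine tsum_of_norm_bounded hbound fun k => ?_
  have h1 : ∑ x ∈ Fintype.piFinset fun i => Ico (a i) (b i),
      (2 * Real.pi * Complex.I * ρ x) ^ k / (k.factorial : ℂ) * (F x * ∏ i, w i (x i)) =
      (2 * Real.pi * Complex.I) ^ k / (k.factorial : ℂ) *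
        ∑ x ∈ Fintype.piFinset fun i => Ico (a i) (b i), (ρ x : ℂ) ^ k * F x * ∏ i, w i (x i) := by
    rw [mul_sum]
    refine sum_congr rfl fun x _ => ?_
    rw [mul_pow _ (ρ x : ℂ)]; ring
  rw [h1, norm_mul, norm_div, norm_pow, norm_mul, norm_mul, Complex.norm_I, Complex.norm_real,
    Complex.norm_ofNat, Complex.norm_natCast, mul_one, Real.norm_eq_abs, abs_of_pos Real.pi_pos]
  calc _ ≤ (2 * Real.pi) ^ k / k.factorial * (M ^ k * c * ∏ i, B i) := by
        have := Real.pi_pos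
        gcongr
        exact hpow k w B hw
    _ = _ := by rw [mul_pow _ M]; ring

theorem Small.subinterval {A B A' B' : ℤ} {w : ℤ → ℂ} {D : ℝ} (h : Small Q A B w D) (hA : A ≤ A')
    (hB : B' ≤ B) : Small Q A' B' w D :=
  fun a' b' h1 h2 k => h a' b' (hA.trans h1) (h2.trans hB) k

/-- Tameness on all cells of a partition into intervals of length `w` gives tameness. -/
theorem tame_of_cells {P W N : ℕ} (hW : 1 ≤ W) (hN : 2 * P / W + 1 ≤ N)
    (hF : ∀ k : ι → ℕ, Tame Q (fun i => -(P : ℤ) + k i * W)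
      (fun i => min (-(P : ℤ) + k i * W + W) (P + 1)) F c) :
    Tame Q (fun _ : ι => -(P : ℤ)) (fun _ => (P : ℤ) + 1) F (N ^ Fintype.card ι * c) := by
  intro w B hw
  have hB : 0 ≤ ∏ i, B i := prod_nonneg fun i _ => (hw i).nonneg
  let cell : (ι → ℤ) → ι → ℕ := fun x i => ((x i + P) / (W : ℤ)).toNat
  have hcell : ∀ y : ℤ, y ∈ Ico (-(P : ℤ)) (P + 1) → ∀ k : ℕ,
      ((y + P) / (W : ℤ)).toNat = k ↔ -(P : ℤ) + k * W ≤ y ∧ y < -(P : ℤ) + k * W + W := by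
    intro y hy k
    rw [mem_Ico] at hy
    have h0 : 0 ≤ (y + P) / (W : ℤ) := Int.ediv_nonneg (by lia) (by lia)
    have h1 : ((y + P) / (W : ℤ)).toNat = k ↔ (y + P) / (W : ℤ) = k := by lia
    rw [h1, Int.ediv_eq_iff_of_pos (by lia)]
    constructor
    · rintro ⟨h2, h3⟩
      constructor <;> nlinarith
    · rintro ⟨h2, h3⟩
      constructor <;> nlinarith
  have hmap : ∀ x ∈ Fintype.piFinset fun _ : ι => Ico (-(P : ℤ)) (P + 1),
      cell x ∈ Fintype.piFinset fun _ : ι => range N := by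
    intro x hx
    rw [Fintype.mem_piFinset] at *
    intro i
    have h1 := mem_Ico.1 (hx i)
    rw [mem_range]
    refine lt_of_lt_of_le ?_ hN
    have h2 : (x i + P) / (W : ℤ) ≤ (2 * P : ℤ) / W := Int.ediv_le_ediv (by lia) (by lia)
    have h3 : ((2 * P / W : ℕ) : ℤ) = (2 * P : ℤ) / W := by push_cast; rfl
    simp only [cell]
    lia
  rw [← sum_fiberwise_of_maps_to hmap]
  calc _ ≤ ∑ _k ∈ Fintype.piFinset fun _ : ι => range N, c * ∏ i, B i := by
        refine (norm_sum_le _ _).trans (sum_le_sum fun k _ => ?_)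
        refine le_trans (le_of_eq ?_) (hF k w B fun i => (hw i).subinterval (by
          have : 0 ≤ (k i : ℤ) * W := by positivity
          lia) (min_le_right _ _))
        congr 1
        refine sum_congr ?_ fun _ _ => rfl
        ext x
        simp only [mem_filter, Fintype.mem_piFinset, funext_iff]
        constructor
        · rintro ⟨h1, h2⟩ i
          have h3 := (hcell (x i) (h1 i) (k i)).1 (h2 i)
          have h4 := mem_Ico.1 (h1 i)
          rw [mem_Ico, lt_min_iff]
          exact ⟨h3.1, h3.2, h4.2⟩
        · intro h
          have h1 : ∀ i, x i ∈ Ico (-(P : ℤ)) (P + 1) := by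
            intro i
            have := mem_Ico.1 (h i)
            rw [lt_min_iff] at this
            rw [mem_Ico]
            have h2 : 0 ≤ (k i : ℤ) * W := by positivity
            exact ⟨by lia, this.2.2⟩
          refine ⟨h1, fun i => (hcell (x i) (h1 i) (k i)).2 ?_⟩
          have := mem_Ico.1 (h i)
          rw [lt_min_iff] at this
          exact ⟨this.1, this.2.1⟩
    _ = _ := by simp [mul_assoc]

/-- Differences of powers have small variation on short intervals. -/
theorem bvle_pow_sub {P : ℕ} {A B z : ℤ} {δ : ℝ} (hA : -(P : ℤ) ≤ A) (hB : B ≤ P + 1)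
    (hz : z ∈ Ico A B) (hδ : ((B - A : ℤ) : ℝ) ≤ δ + 1) (n : ℕ) :
    BVle A B (fun x => (((x : ℝ) ^ (n + 1) - (z : ℝ) ^ (n + 1) : ℝ) : ℂ))
      (2 * (n + 1) * P ^ n * δ) := by
  have habs : ∀ y : ℤ, y ∈ Ico A B → |(y : ℝ)| ≤ P := by
    intro y hy
    rw [mem_Ico] at hy
    rw [← Int.cast_abs]; exact_mod_cast abs_le.2 ⟨by lia, by lia⟩
  intro x hx
  have h1 : ‖(((x : ℝ) ^ (n + 1) - (z : ℝ) ^ (n + 1) : ℝ) : ℂ)‖ ≤ (n + 1) * P ^ n * δ := by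
    rw [Complex.norm_real, Real.norm_eq_abs]
    refine (abs_pow_sub_pow_le_mul (habs x hx) (habs z hz) n).trans ?_
    gcongr
    rw [mem_Ico] at hx hz
    have h2 : |x - z| ≤ B - A - 1 := abs_le.2 ⟨by lia, by lia⟩
    have h3 : ((|x - z| : ℤ) : ℝ) ≤ ((B - A - 1 : ℤ) : ℝ) := by exact_mod_cast h2
    push_cast at h3 hδ
    linarith
  have h2 : ∑ y ∈ Ico A (B - 1), ‖(((((y + 1 : ℤ) : ℝ)) ^ (n + 1) - (z : ℝ) ^ (n + 1) : ℝ) : ℂ) -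
      (((y : ℝ) ^ (n + 1) - (z : ℝ) ^ (n + 1) : ℝ) : ℂ)‖ ≤ (n + 1) * P ^ n * δ := by
    calc _ ≤ ∑ y ∈ Ico A (B - 1), ((n + 1) * P ^ n : ℝ) := by
          refine sum_le_sum fun y hy => ?_
          rw [mem_Ico] at hy
          rw [← Complex.ofReal_sub, sub_sub_sub_cancel_right, Complex.norm_real, Real.norm_eq_abs]
          refine (abs_pow_sub_pow_le_mul (habs (y + 1) (mem_Ico.2 (by lia)))
            (habs y (mem_Ico.2 (by lia))) n).trans (le_of_eq ?_)
          push_cast; simp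
      _ = (Ico A (B - 1)).card * ((n + 1) * P ^ n : ℝ) := by rw [sum_const, nsmul_eq_mul]
      _ ≤ δ * ((n + 1) * P ^ n : ℝ) := by
          gcongr
          rw [mem_Ico] at hx
          rw [Int.card_Ico]
          have h3 : ((B - 1 - A).toNat : ℤ) = B - 1 - A := Int.toNat_of_nonneg (by lia)
          have h4 : ((B - 1 - A).toNat : ℝ) = ((B - 1 - A : ℤ) : ℝ) := by
            have : (((B - 1 - A).toNat : ℤ) : ℝ) = ((B - 1 - A : ℤ) : ℝ) := by rw [h3]
            exact_mod_cast this
          rw [h4]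
          push_cast at hδ ⊢
          linarith
      _ = _ := by ring
  calc _ ≤ (n + 1) * P ^ n * δ + (n + 1) * P ^ n * δ := add_le_add h1 h2
    _ = _ := by ring

end

/-! ### Explicit coordinates of the ordered products; variation of the cutoffs -/

section

variable {d r : ℕ}

theorem G0.cross_mul_right (x y z : G0 d) (l : Y d) :
    G0.cross x (y * z) l = G0.cross x y l + G0.cross x z l := by
  unfold G0.cross
  split_ifs with hl
  · simp
  · rw [G0.mul_coord, G0.cross, dif_pos (sndIdx_snd l hl)]; ring

theorem G0.cross_prod_right (x : G0 d) (l : Y d) (g : Fin r → G0 d) :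
    G0.cross x (List.ofFn g).prod l = ∑ k, G0.cross x (g k) l := by
  induction r with
  | zero => simp [G0.cross, G0.one_coord]
  | succ r ih => rw [List.ofFn_succ, List.prod_cons, G0.cross_mul_right, ih, Fin.sum_univ_succ]

theorem G0.prod_coord (l : Y d) (g : Fin r → G0 d) :
    (List.ofFn g).prod.coord l =
      ∑ j, (g j).coord l + ∑ j, ∑ k, if j < k then G0.cross (g j) (g k) l else 0 := by
  induction r with
  | zero => simp [G0.one_coord]
  | succ r ih =>
    rw [List.ofFn_succ, List.prod_cons, G0.mul_coord, ih, G0.cross_prod_right, Fin.sum_univ_succ,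
      Fin.sum_univ_succ (fun j => ∑ k, if j < k then G0.cross (g j) (g k) l else 0)]
    simp only [Fin.sum_univ_succ (fun k => if _ < k then G0.cross _ (g k) l else 0),
      Fin.succ_lt_succ_iff, Fin.succ_pos, lt_irrefl, if_false, if_true, Fin.not_lt_zero, zero_add]
    ring

/-- The coordinates of `E` are signed power sums, respectively quadratic forms in powers, of the
variables `x (j, false)` and `x (j, true)`. -/
structure IsQuadratic (d r : ℕ) (σ : Fin r × Bool → ℤ) (ε : Fin r × Bool → Fin r × Bool → ℤ)
    (E : (Fin r → ℝ) → (Fin r → ℝ) → G0 d) : Prop where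
  abs_sign : ∀ i, |σ i| = 1
  abs_coeff : ∀ i j, |ε i j| ≤ 1
  coord_zero : ∀ (x : Fin r × Bool → ℤ) (l : Y d), l.1.2 = 0 →
    (E (fun j => x (j, false)) (fun j => x (j, true))).coord l = ∑ i, σ i * (x i : ℝ) ^ l.1.1
  coord_ne : ∀ (x : Fin r × Bool → ℤ) (l : Y d), l.1.2 ≠ 0 →
    (E (fun j => x (j, false)) (fun j => x (j, true))).coord l =
      ∑ i, ∑ j, ε i j * ((x i : ℝ) ^ l.1.1 * (x j : ℝ) ^ l.1.2)

/-- The coefficients of the quadratic forms in the coordinates of `D` and `D̃`. -/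
def quadCoeff {r : ℕ} (t : Bool) (i j : Fin r × Bool) : ℤ :=
  if i.1 < j.1 then (if i.2 = j.2 then 1 else -1)
  else if i.1 = j.1 then
    (if i.2 = j.2 then (if i.2 = t then 1 else 0) else (if i.2 then 0 else -1))
  else 0

theorem abs_quadCoeff_le (t : Bool) (i j : Fin r × Bool) : |quadCoeff t i j| ≤ 1 := by
  unfold quadCoeff
  split_ifs <;> norm_num

/-- Pairs `j < k` contribute products of increments for both ordered products. Inside one pair the
inverted letter, recorded by `t`, contributes the square term of `G0.inv_coord`. -/
theorem sum_quadCoeff (t : Bool) (f g : Fin r × Bool → ℝ) :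
    ∑ i, ∑ j, quadCoeff t i j * (f i * g j) =
      ∑ j, (f (j, t) * g (j, t) - f (j, false) * g (j, true)) +
      ∑ j, ∑ k, if j < k then (f (j, true) - f (j, false)) * (g (k, true) - g (k, false)) else 0 := by
  simp only [Fintype.sum_prod_type, Fintype.sum_bool]
  rw [← sum_add_distrib]
  refine sum_congr rfl fun j _ => ?_
  rw [← sum_add_distrib]
  have : f (j, t) * g (j, t) - f (j, false) * g (j, true) =
      ∑ k, if j = k then f (j, t) * g (j, t) - f (j, false) * g (j, true) else 0 := by simp
  rw [this, ← sum_add_distrib]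
  refine sum_congr rfl fun k _ => ?_
  rcases lt_trichotomy j k with h | rfl | h
  · simp [quadCoeff, h, h.ne]; ring
  · cases t <;> simp [quadCoeff] <;> ring
  · simp [quadCoeff, h.not_gt, h.ne']

theorem isQuadratic_D (d r : ℕ) :
    IsQuadratic d r (fun i => if i.2 then 1 else -1) (quadCoeff false) (D d r) where
  abs_sign i := by cases i.2 <;> simp
  abs_coeff := abs_quadCoeff_le _
  coord_zero x l hl := by
    rw [D, G0.prod_coord, Fintype.sum_prod_type]
    simp [G0.cross, hl, G0.mul_coord, G0.inv_coord, A0]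
    exact sum_congr rfl fun _ _ => by ring
  coord_ne x l hl := by
    rw [sum_quadCoeff false (fun i => (x i : ℝ) ^ l.1.1) (fun i => (x i : ℝ) ^ l.1.2), D,
      G0.prod_coord]
    congr 1
    · refine sum_congr rfl fun j _ => ?_
      simp [G0.cross, hl, G0.mul_coord, G0.inv_coord, A0, fstIdx, sndIdx]
      ring
    · refine sum_congr rfl fun j _ => sum_congr rfl fun k _ => ?_
      simp [G0.cross, hl, G0.mul_coord, G0.inv_coord, A0, fstIdx, sndIdx]
      split_ifs <;> ring

theorem isQuadratic_Dtilde (d r : ℕ) :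
    IsQuadratic d r (fun i => if i.2 then -1 else 1) (quadCoeff true) (Dtilde d r) where
  abs_sign i := by cases i.2 <;> simp
  abs_coeff := abs_quadCoeff_le _
  coord_zero x l hl := by
    rw [Dtilde, G0.prod_coord, Fintype.sum_prod_type]
    simp [G0.cross, hl, G0.mul_coord, G0.inv_coord, A0]
    exact sum_congr rfl fun _ _ => by ring
  coord_ne x l hl := by
    rw [sum_quadCoeff true (fun i => (x i : ℝ) ^ l.1.1) (fun i => (x i : ℝ) ^ l.1.2), Dtilde,
      G0.prod_coord]
    congr 1
    · refine sum_congr rfl fun j _ => ?_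
      simp [G0.cross, hl, G0.mul_coord, G0.inv_coord, A0, fstIdx, sndIdx]
      ring
    · refine sum_congr rfl fun j _ => sum_congr rfl fun k _ => ?_
      simp [G0.cross, hl, G0.mul_coord, G0.inv_coord, A0, fstIdx, sndIdx]
      split_ifs <;> ring

theorem sum_abs_sub_le_integral {f : ℝ → ℝ} (hf : ContDiff ℝ 1 f) {A B : ℤ} (hAB : A ≤ B) :
    ∑ y ∈ Ico A B, |f ((y + 1 : ℤ) : ℝ) - f y| ≤ ∫ x in (A : ℝ)..B, |deriv f x| := by
  have hc : Continuous fun x => |deriv f x| := (hf.continuous_deriv le_rfl).abs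
  induction B, hAB using Int.leInduction with
  | base => simp
  | succ B hAB ih =>
    have h1 : Ico A (B + 1) = insert B (Ico A B) := by
      ext y; simp only [mem_Ico, mem_insert]; lia
    rw [h1, sum_insert (by simp), ← intervalIntegral.integral_add_adjacent_intervals
      (hc.intervalIntegrable A B) (hc.intervalIntegrable B _), add_comm]
    gcongr
    have h2 : ∫ x in (B : ℝ)..((B + 1 : ℤ) : ℝ), deriv f x = f ((B + 1 : ℤ) : ℝ) - f B :=
      intervalIntegral.integral_deriv_eq_sub (fun x _ => hf.differentiable one_ne_zero x)
        ((hf.continuous_deriv le_rfl).intervalIntegrable _ _)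
    rw [← h2]
    exact intervalIntegral.abs_integral_le_integral_abs (by simp)

theorem IsCutoff.bvle {P : ℕ} {φ ψ : Fin r → ℝ → ℝ} (h : IsCutoff P φ ψ) (j : Fin r) (A B : ℤ) :
    BVle A B (fun x => (φ j x : ℂ)) 2 ∧ BVle A B (fun x => (ψ j x : ℂ)) 2 := by
  have hcs : HasCompactSupport (φ j) ∧ HasCompactSupport (ψ j) :=
    ⟨HasCompactSupport.intro isCompact_Icc fun x hx => (h.eq_zero j hx).1,
      HasCompactSupport.intro isCompact_Icc fun x hx => (h.eq_zero j hx).2⟩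
  -- Integrability of the derivatives, needed to split the integral in the variation hypothesis,
  -- comes from the compact support forced by the pointwise bound.
  have hi : ∀ f : ℝ → ℝ, ContDiff ℝ 1 f → HasCompactSupport f →
      MeasureTheory.Integrable fun x => |deriv f x| := fun f hf hs =>
    ((hf.continuous_deriv le_rfl).integrable_of_hasCompactSupport hs.deriv).abs
  have hv := h.variation j
  rw [MeasureTheory.integral_add (hi _ (h.contDiff_left j) hcs.1)
    (hi _ (h.contDiff_right j) hcs.2)] at hv
  have h0 : ∀ f : ℝ → ℝ, 0 ≤ ∫ x, |deriv f x| := fun f =>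
    MeasureTheory.integral_nonneg fun _ => abs_nonneg _
  have key : ∀ f : ℝ → ℝ, ContDiff ℝ 1 f → HasCompactSupport f → (∀ x, |f x| ≤ 1) →
      ∫ x, |deriv f x| ≤ 1 → BVle A B (fun x => (f x : ℂ)) 2 := by
    intro f hf hs h1 h2 x hx
    rw [mem_Ico] at hx
    have h3 : ∑ y ∈ Ico A (B - 1), ‖((f ((y + 1 : ℤ) : ℝ) : ℝ) : ℂ) - (f y : ℂ)‖ ≤ 1 := by
      simp only [← Complex.ofReal_sub, Complex.norm_real, Real.norm_eq_abs]
      refine (sum_abs_sub_le_integral hf (by lia)).trans (le_trans ?_ h2)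
      rw [intervalIntegral.integral_of_le (by exact_mod_cast (by lia : A ≤ B - 1))]
      exact MeasureTheory.setIntegral_le_integral (hi f hf hs)
        (Filter.Eventually.of_forall fun _ => abs_nonneg _)
    have h4 : ‖(f x : ℂ)‖ ≤ 1 := by
      rw [Complex.norm_real]; exact h1 x
    calc _ ≤ (1 : ℝ) + 1 := add_le_add h4 h3
      _ = 2 := by norm_num
  exact ⟨key _ (h.contDiff_left j) hcs.1 (fun x => (h.abs_le_one j x).1) (by linarith [h0 (ψ j)]),
    key _ (h.contDiff_right j) hcs.2 (fun x => (h.abs_le_one j x).2) (by linarith [h0 (φ j)])⟩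

end

/-! ### Tameness of the central phase with major frequencies -/

section

theorem e_div_congr {Q : ℕ} {a b : ℤ} (hQ : 1 ≤ Q) (h : a ≡ b [ZMOD Q]) :
    e ((a : ℝ) / Q) = e ((b : ℝ) / Q) := by
  obtain ⟨c, hc⟩ := h.dvd
  have hQ' : (Q : ℝ) ≠ 0 := by exact_mod_cast (by lia : Q ≠ 0)
  have hb : (b : ℝ) = a + Q * c := by
    have : b = a + Q * c := by linarith
    exact_mod_cast this
  rw [hb, add_div, mul_div_cancel_left₀ _ hQ', e_add_int]

theorem Major.neg {X T t : ℝ} (h : Major X T t) : Major X T (-t) := by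
  obtain ⟨q, h1, h2, h3⟩ := h
  exact ⟨q, h1, h2, by rw [mul_neg]; exact h3.neg⟩

theorem Major.exists_near {X T t : ℝ} (h : Major X T t) :
    ∃ q : ℕ, 1 ≤ q ∧ (q : ℝ) ≤ X ∧ ∃ a : ℤ, |t - a / q| ≤ X / T := by
  obtain ⟨q, h1, h2, a, ha⟩ := h
  refine ⟨q, h1, h2, a, ?_⟩
  have hq : (1 : ℝ) ≤ q := by exact_mod_cast h1
  refine le_trans ?_ ha
  have : q * t - a = q * (t - a / q) := by field_simp
  rw [this, abs_mul, Nat.abs_cast]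
  exact le_mul_of_one_le_left (abs_nonneg _) hq

variable {ι : Type*} [Fintype ι] [DecidableEq ι] {Q : ℕ} {a b : ι → ℤ} {c : ℝ}
  {G : (ι → ℤ) → ℂ}

theorem tame_of_isEmpty {i : ι} (h : b i ≤ a i) (hc : 0 ≤ c) : Tame Q a b G c := by
  intro w B hw
  have h1 : (Fintype.piFinset fun i => Ico (a i) (b i)) = ∅ := by
    rw [Fintype.piFinset_eq_empty]
    exact ⟨i, Ico_eq_empty_of_le h⟩
  rw [h1, sum_empty, norm_zero]
  exact mul_nonneg hc (prod_nonneg fun i _ => (hw i).nonneg)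

theorem Tame.add {G' : (ι → ℤ) → ℂ} {c' : ℝ} (h : Tame Q a b G c) (h' : Tame Q a b G' c') :
    Tame Q a b (fun x => G x + G' x) (c + c') := by
  intro w B hw
  simp only [add_mul, sum_add_distrib]
  exact (norm_add_le _ _).trans (add_le_add (h w B hw) (h' w B hw))

/-- Multiplication by the increment of `x_i^{m+1} x_j^{n+1}` on a short cell. -/
theorem Tame.mul_pow_sub {P : ℕ} {X : ℝ} {z : ι → ℤ} (hX : 1 ≤ X) (ha : ∀ i, -(P : ℤ) ≤ a i)
    (hb : ∀ i, b i ≤ P + 1) (hz : ∀ i, z i ∈ Ico (a i) (b i))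
    (hlen : ∀ i, ((b i - a i : ℤ) : ℝ) ≤ P / X + 1) (hG : Tame Q a b G c) (hc : 0 ≤ c)
    (i j : ι) {d m n : ℕ} (hm : m + 1 ≤ d) (hn : n + 1 ≤ d) :
    Tame Q a b (fun x => (((x i : ℝ) ^ (m + 1) * (x j : ℝ) ^ (n + 1) -
      (z i : ℝ) ^ (m + 1) * (z j : ℝ) ^ (n + 1) : ℝ) : ℂ) * G x)
      (8 * d ^ 2 * (P ^ (m + 1 + (n + 1)) / X) * c) := by
  have habs : ∀ i, |(z i : ℝ)| ≤ P := by
    intro i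
    have h1 := mem_Ico.1 (hz i)
    have h2 := ha i
    have h3 := hb i
    rw [← Int.cast_abs]; exact_mod_cast abs_le.2 ⟨by lia, by lia⟩
  have hδ : (0 : ℝ) ≤ P / X := by positivity
  have hi : BVle (a i) (b i) (fun x => (((x : ℝ) ^ (m + 1) - (z i : ℝ) ^ (m + 1) : ℝ) : ℂ))
      (2 * (m + 1) * P ^ m * (P / X)) := bvle_pow_sub (ha i) (hb i) (hz i) (hlen i) m
  have hj : BVle (a j) (b j) (fun x => (((x : ℝ) ^ (n + 1) - (z j : ℝ) ^ (n + 1) : ℝ) : ℂ))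
      (2 * (n + 1) * P ^ n * (P / X)) := bvle_pow_sub (ha j) (hb j) (hz j) (hlen j) n
  have hj' := hG.mul_single j (by positivity) hj
  -- The increment is split as `uv - st = (u-s)(v-t) + s(v-t) + t(u-s)`: every factor is a constant
  -- or a one-variable increment, small on the cell.
  have h1 := hj'.mul_single i (by positivity) hi
  have h2 := hj'.const_mul (((z i : ℝ) ^ (m + 1) : ℝ) : ℂ)
  have h3 := (hG.mul_single i (by positivity) hi).const_mul (((z j : ℝ) ^ (n + 1) : ℝ) : ℂ)
  have h4 := (h1.add h2).add h3
  have hz' : ∀ (i : ι) (k : ℕ), ‖(((z i : ℝ) ^ k : ℝ) : ℂ)‖ ≤ (P : ℝ) ^ k := by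
    intro i k
    rw [Complex.norm_real, norm_pow]
    exact pow_le_pow_left₀ (abs_nonneg _) (habs i) _
  have h5 : (fun x : ι → ℤ => (((x i : ℝ) ^ (m + 1) * (x j : ℝ) ^ (n + 1) -
      (z i : ℝ) ^ (m + 1) * (z j : ℝ) ^ (n + 1) : ℝ) : ℂ) * G x) = _ :=
    funext fun x => by
      rw [show ∀ u v s t : ℝ, u * v - s * t = (u - s) * (v - t) + s * (v - t) + t * (u - s) by
        intros; ring, Complex.ofReal_add, Complex.ofReal_add, Complex.ofReal_mul,
        Complex.ofReal_mul, Complex.ofReal_mul, add_mul, add_mul, mul_assoc, mul_assoc, mul_assoc]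
  rw [h5]
  refine h4.mono ?_
  have hm' : (m : ℝ) + 1 ≤ d := by exact_mod_cast hm
  have hn' : (n : ℝ) + 1 ≤ d := by exact_mod_cast hn
  have hd : (1 : ℝ) ≤ d := le_trans (by linarith [Nat.cast_nonneg (α := ℝ) m]) hm'
  have hX' : 1 / X ≤ 1 := (div_le_one (by linarith)).2 hX
  calc _ ≤ 2 * d * P ^ m * (P / X) * (2 * d * P ^ n * (P / X) * c) +
        P ^ (m + 1) * (2 * d * P ^ n * (P / X) * c) + P ^ (n + 1) * (2 * d * P ^ m * (P / X) * c) := by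
        gcongr
        · exact hz' _ _
        · exact hz' _ _
    _ = (4 * (d * d) * (1 / X) + 4 * (d * 1)) * (P ^ (m + 1 + (n + 1)) / X * c) := by
        field_simp; ring
    _ ≤ (4 * (d * d) * 1 + 4 * (d * d)) * (P ^ (m + 1 + (n + 1)) / X * c) := by gcongr
    _ = _ := by ring

/-- The central part of the phase is tame when all central frequencies are major. -/
theorem tame_central {d P : ℕ} {X : ℝ} (hP : 1 ≤ P) (hX : 1 ≤ X) (ε : ι → ι → ℤ) (hε : ∀ i j, |ε i j| ≤ 1)
    (θ : Y d → ℝ) (hθ : ∀ l : Y d, l.1.2 ≠ 0 → Major X (P ^ (l.1.1 + l.1.2)) (θ l)) :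
    ∃ Q : ℕ, 1 ≤ Q ∧ (Q : ℝ) ≤ X ^ (Y d).card ∧
      Tame Q (fun _ : ι => -(P : ℤ)) (fun _ => (P : ℤ) + 1)
        (fun x => e (-∑ l : Y d, if l.1.2 = 0 then 0 else
          (∑ i, ∑ j, ε i j * ((x i : ℝ) ^ l.1.1 * (x j : ℝ) ^ l.1.2)) * θ l))
        ((3 * X) ^ Fintype.card ι *
          (Real.exp (2 * Real.pi * ((Y d).card * (Fintype.card ι ^ 2 * (8 * d ^ 2)))) *
            Q ^ Fintype.card ι)) := by
  have hex : ∀ l : Y d, ∃ q : ℕ, 1 ≤ q ∧ (q : ℝ) ≤ X ∧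
      ∃ a : ℤ, l.1.2 ≠ 0 → |θ l - a / q| ≤ X / P ^ (l.1.1 + l.1.2) := by
    intro l
    by_cases hl : l.1.2 = 0
    · exact ⟨1, le_rfl, by simpa using hX, 0, fun h => absurd hl h⟩
    · obtain ⟨q, h1, h2, a, h3⟩ := (hθ l hl).exists_near
      exact ⟨q, h1, h2, a, fun _ => h3⟩
  choose q hq1 hqX A hA using hex
  have hP' : (1 : ℝ) ≤ P := by exact_mod_cast hP
  -- A common denominator for the rational approximations to all central frequencies.
  set Q : ℕ := ∏ l, q l with hQ
  have hQ1 : 1 ≤ Q := Nat.one_le_iff_ne_zero.2 (prod_ne_zero_iff.2 fun l _ => by have := hq1 l; lia)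
  have hQX : (Q : ℝ) ≤ X ^ (Y d).card := by
    rw [hQ, Nat.cast_prod]
    calc _ ≤ ∏ _l : Y d, X := prod_le_prod (fun _ _ => by positivity) fun l _ => hqX l
      _ = _ := by simp
  refine ⟨Q, hQ1, hQX, ?_⟩
  let A' : Y d → ℤ := fun l => A l * ∏ l' ∈ univ.erase l, (q l' : ℤ)
  have hA' : ∀ l, (A l : ℝ) / q l = A' l / Q := by
    intro l
    have h1 : (q l : ℝ) ≠ 0 := by exact_mod_cast (by have := hq1 l; lia : q l ≠ 0)
    have h2 : (Q : ℝ) ≠ 0 := by exact_mod_cast (by lia : Q ≠ 0)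
    rw [div_eq_div_iff h1 h2, hQ, ← mul_prod_erase univ q (mem_univ l)]
    push_cast
    simp only [A']
    push_cast
    ring
  let num : (ι → ℤ) → ℤ := fun x => -∑ l : Y d, if l.1.2 = 0 then 0 else
    (∑ i, ∑ j, ε i j * (x i ^ l.1.1 * x j ^ l.1.2)) * A' l
  let g : (ι → ℤ) → ℂ := fun x => e ((num x : ℝ) / Q)
  have hgper : ∀ x : ι → ℤ, g (fun i => x i % Q) = g x := by
    intro x
    refine e_div_congr hQ1 ?_
    have h1 : ∀ i, x i % Q ≡ x i [ZMOD Q] := fun i => Int.mod_modEq _ _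
    refine Int.ModEq.neg (Int.ModEq.sum fun l _ => ?_)
    split_ifs
    · rfl
    · refine Int.ModEq.mul_right _ (Int.ModEq.sum fun i _ => Int.ModEq.sum fun j _ => ?_)
      exact Int.ModEq.mul_left _ (((h1 i).pow _).mul ((h1 j).pow _))
  let β : Y d → ℝ := fun l => θ l - A l / q l
  set M : ℝ := (Y d).card * (Fintype.card ι ^ 2 * (8 * d ^ 2)) with hM
  have hM0 : 0 ≤ M := by positivity
  -- Integers in a cell of width `W` differ by at most `W - 1 ≤ P / X`. On such a cell the monomials
  -- vary by `O(P ^ (l₁+l₂) / X)`, which cancels the error `X / P ^ (l₁+l₂)` of the approximations.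
  set W : ℕ := ⌊P / X⌋₊ + 1 with hW
  have hδ : (0 : ℝ) ≤ P / X := by positivity
  have hWle : (W : ℝ) ≤ P / X + 1 := by
    rw [hW]; push_cast; linarith [Nat.floor_le hδ]
  have hWlt : P / X < (W : ℝ) := by rw [hW]; push_cast; exact Nat.lt_floor_add_one _
  have hcell : ∀ a b : ι → ℤ, (∀ i, -(P : ℤ) ≤ a i) → (∀ i, b i ≤ P + 1) →
      (∀ i, ((b i - a i : ℤ) : ℝ) ≤ P / X + 1) →
      Tame Q a b (fun x => e (-∑ l : Y d, if l.1.2 = 0 then 0 else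
          (∑ i, ∑ j, ε i j * ((x i : ℝ) ^ l.1.1 * (x j : ℝ) ^ l.1.2)) * θ l))
        (Real.exp (2 * Real.pi * M) * Q ^ Fintype.card ι) := by
    intro a b ha hb hlen
    -- Empty cells are treated apart, because below the corner `a` serves as base point and has to
    -- lie in the cell.
    by_cases hne : ∃ i, b i ≤ a i
    · obtain ⟨i, hi⟩ := hne
      exact tame_of_isEmpty hi (by positivity)
    push Not at hne
    let ρ : (ι → ℤ) → ℝ := fun x => ∑ l : Y d, if l.1.2 = 0 then 0 else ∑ i, ∑ j, (-β l * ε i j) *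
      ((x i : ℝ) ^ l.1.1 * (x j : ℝ) ^ l.1.2 - (a i : ℝ) ^ l.1.1 * (a j : ℝ) ^ l.1.2)
    have hρ : ∀ (G : (ι → ℤ) → ℂ) (c' : ℝ), 0 ≤ c' → Tame Q a b G c' →
        Tame Q a b (fun x => ρ x * G x) (M * c') := by
      intro G c' hc' hG
      have h1 : ∀ l : Y d, Tame Q a b (fun x => (((if l.1.2 = 0 then 0 else ∑ i, ∑ j, (-β l * ε i j) *
          ((x i : ℝ) ^ l.1.1 * (x j : ℝ) ^ l.1.2 - (a i : ℝ) ^ l.1.1 * (a j : ℝ) ^ l.1.2) : ℝ)) : ℂ) *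
          G x) (Fintype.card ι ^ 2 * (8 * d ^ 2) * c') := by
        intro l
        split_ifs with hl
        · have := hG.const_mul 0
          refine Tame.mono (c := ‖(0 : ℂ)‖ * c') (by simpa using this) ?_
          rw [norm_zero, zero_mul]; positivity
        have hY := mem_Y.1 l.2
        obtain ⟨m, hm⟩ : ∃ m, l.1.1 = m + 1 := ⟨l.1.1 - 1, by lia⟩
        obtain ⟨n, hn⟩ : ∃ n, l.1.2 = n + 1 := ⟨l.1.2 - 1, by lia⟩
        have h2 : Tame Q a b (fun x => ∑ i, ∑ j, ((-β l * ε i j : ℝ) : ℂ) *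
          ((((x i : ℝ) ^ (m + 1) * (x j : ℝ) ^ (n + 1) - (a i : ℝ) ^ (m + 1) * (a j : ℝ) ^ (n + 1) : ℝ) : ℂ) *
            G x)) (∑ _i : ι, ∑ _j : ι, 8 * d ^ 2 * c') := by
          refine Tame.sum _ fun i _ => Tame.sum _ fun j _ => ?_
          refine ((hG.mul_pow_sub hX ha hb (fun i => mem_Ico.2 ⟨le_rfl, hne i⟩) hlen hc' i j
            (d := d) (m := m) (n := n) (by lia) (by lia)).const_mul _).mono ?_
          rw [Complex.norm_real, Real.norm_eq_abs, abs_mul, abs_neg]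
          have h3 : |(ε i j : ℝ)| ≤ 1 := by exact_mod_cast hε i j
          have h4 := hA l hl
          rw [hm, hn] at h4
          calc _ ≤ X / P ^ (m + 1 + (n + 1)) * 1 * (8 * d ^ 2 * (P ^ (m + 1 + (n + 1)) / X) * c') := by
                gcongr
            _ = _ := by field_simp
        refine Tame.mono (c := ∑ _i : ι, ∑ _j : ι, 8 * (d : ℝ) ^ 2 * c') ?_ (le_of_eq ?_)
        · convert h2 using 2 with x
          rw [hm, hn]
          push_cast
          simp only [sum_mul]
          exact sum_congr rfl fun i _ => sum_congr rfl fun j _ => by ring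
        · simp only [sum_const, card_univ, nsmul_eq_mul]; ring
      have h5 := Tame.sum univ fun l _ => h1 l
      refine Tame.mono (c := ∑ _l : Y d, Fintype.card ι ^ 2 * (8 * (d : ℝ) ^ 2) * c') ?_ (le_of_eq ?_)
      · convert h5 using 2 with x
        simp only [ρ]
        rw [Complex.ofReal_sum, sum_mul]
      · simp only [sum_const, card_univ, Fintype.card_coe, nsmul_eq_mul, hM]; ring
    -- On the cell the phase is the rational part `g`, the slow part `ρ` measured from the corner,
    -- and a constant phase restored in the next step.
    have h6 := Tame.exp (tame_periodic (a := a) (b := b) hQ1 g (fun x => (norm_e _).le) hgper) ρ hρ hM0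
      (by positivity)
    have h7 := h6.const_mul (e (-∑ l : Y d, if l.1.2 = 0 then 0 else
      (∑ i, ∑ j, ε i j * ((a i : ℝ) ^ l.1.1 * (a j : ℝ) ^ l.1.2)) * β l))
    rw [norm_e, one_mul] at h7
    convert h7 using 2 with x
    simp only [g]
    rw [← e_add, ← e_add]
    congr 1
    simp only [num, ρ]
    push_cast
    rw [← sum_neg_distrib, ← sum_neg_distrib, ← sum_neg_distrib, sum_div, ← sum_add_distrib,
      ← sum_add_distrib]
    refine sum_congr rfl fun l _ => ?_
    by_cases hl : l.1.2 = 0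
    · simp [hl]
    simp only [hl, if_false]
    have h8 : θ l = A' l / Q + β l := by rw [← hA']; simp only [β]; ring
    have h9 : ∑ i, ∑ j, (-β l * ε i j) *
        ((x i : ℝ) ^ l.1.1 * (x j : ℝ) ^ l.1.2 - (a i : ℝ) ^ l.1.1 * (a j : ℝ) ^ l.1.2) =
        -(∑ i, ∑ j, ε i j * ((x i : ℝ) ^ l.1.1 * (x j : ℝ) ^ l.1.2)) * β l +
        (∑ i, ∑ j, ε i j * ((a i : ℝ) ^ l.1.1 * (a j : ℝ) ^ l.1.2)) * β l := by
      rw [← add_mul, neg_add_eq_sub, ← sum_sub_distrib, sum_mul]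
      refine sum_congr rfl fun i _ => ?_
      rw [← sum_sub_distrib, sum_mul]
      exact sum_congr rfl fun j _ => by ring
    rw [h9, h8]
    ring
  set N : ℕ := 2 * P / W + 1 with hN
  have hNX : (N : ℝ) ≤ 3 * X := by
    have h1 : ((2 * P / W : ℕ) : ℝ) ≤ ((2 * P : ℕ) : ℝ) / W := Nat.cast_div_le
    have h2 : ((2 * P : ℕ) : ℝ) / W ≤ 2 * X := by
      rw [div_le_iff₀ (by positivity)]
      rw [div_lt_iff₀ (by positivity)] at hWlt
      push_cast
      linarith
    rw [hN]; push_cast at h1 h2 ⊢; linarith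
  refine (tame_of_cells (W := W) (N := N) (by lia) le_rfl fun k => hcell _ _ (fun i => ?_)
    (fun i => min_le_right _ _) (fun i => ?_)).mono (by gcongr)
  · have : 0 ≤ (k i : ℤ) * W := by positivity
    lia
  · refine le_trans ?_ hWle
    have h1 : min (-(P : ℤ) + k i * W + W) (P + 1) ≤ -(P : ℤ) + k i * W + W := min_le_left _ _
    have h2 : min (-(P : ℤ) + k i * W + W) (P + 1) - (-(P : ℤ) + k i * W) ≤ W := by linarith
    exact_mod_cast h2

end

/-! ### The case of a minor horizontal frequency -/

section

variable {d r : ℕ}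

theorem sum_horizontal (f : Y d → ℝ) :
    ∑ l : Y d, (if l.1.2 = 0 then f l else 0) = ∑ i : Fin d, f (idx0 i) := by
  rw [← sum_filter]
  symm
  refine sum_bij (fun i _ => idx0 i) ?_ ?_ ?_ ?_
  · intro i _; simp [idx0]
  · intro i _ j _ h
    have := congrArg (fun l : Y d => l.1.1) h
    simp only [idx0] at this
    ext; lia
  · intro l hl
    have h1 := mem_Y.1 l.2
    have h2 : l.1.2 = 0 := (mem_filter.1 hl).2
    refine ⟨⟨l.1.1 - 1, by lia⟩, mem_univ _, ?_⟩
    apply Subtype.ext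
    simp only [idx0]
    ext
    · simp; lia
    · simp [h2]
  · intro i _; rfl

/-- Exponential sums with a minor horizontal frequency are small. -/
theorem small_horizontal (d : ℕ) : ∃ K : ℝ, 1 ≤ K ∧ ∃ C : ℕ,
    ∀ (Q P : ℕ) (Z H : ℝ) (s : ℤ) (θ : Y d → ℝ), |s| = 1 → 1 ≤ P → 1 ≤ H → 1 ≤ Q → (Q : ℝ) ≤ Z →
      (∃ l : Y d, l.1.2 = 0 ∧ ¬ Major (K * H ^ C * Z) (P ^ l.1.1) (θ l)) →
      Small Q (-(P : ℤ)) (P + 1)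
        (fun x => e (-∑ l : Y d, if l.1.2 = 0 then s * (x : ℝ) ^ l.1.1 * θ l else 0)) (P / H) := by
  obtain ⟨K, hK, C, hweyl⟩ := weyl_coeff d
  refine ⟨K, hK, C, ?_⟩
  intro Q P Z H s θ hs hP hH hQ hQZ ⟨l, hl0, hl⟩ a' b' ha hb k
  by_contra! hcon
  have hY := mem_Y.1 l.2
  have hP' : (1 : ℝ) ≤ P := by exact_mod_cast hP
  -- The twist `k / Q` required by `Small` sits in the linear coefficient; it is removed at the end
  -- at the cost of the factor `Z ≥ Q`.
  let c : ℕ → ℝ := fun m => (if h : m - 1 < d ∧ 1 ≤ m then -s * θ (idx0 ⟨m - 1, h.1⟩) else 0) +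
    (if m = 1 then (k : ℝ) / Q else 0)
  have hc : ∀ x : ℤ, e (-∑ l : Y d, if l.1.2 = 0 then s * (x : ℝ) ^ l.1.1 * θ l else 0) *
      e (k / Q * x) = e (∑ m ∈ range (d + 1), c m * (x : ℝ) ^ m) := by
    intro x
    rw [← e_add, sum_horizontal, sum_range_succ']
    congr 1
    have h0 : c 0 = 0 := by simp [c]
    rw [h0, zero_mul, add_zero]
    simp only [c, add_mul, sum_add_distrib]
    congr 1
    · rw [← sum_neg_distrib, Finset.sum_range]
      refine sum_congr rfl fun i _ => ?_
      rw [dif_pos (by simp)]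
      simp only [idx0, add_tsub_cancel_right]
      ring
    · rw [sum_eq_single 0]
      · simp
      · intro m _ hm; simp [hm]
      · intro h; simp at h; lia
  simp only [hc] at hcon
  have h1 := hweyl c P a' b' H hP ha hb hH hcon.le l.1.1 (by lia) hY.2
  have h2 : c l.1.1 = -s * θ l + (if l.1.1 = 1 then (k : ℝ) / Q else 0) := by
    simp only [c]
    rw [dif_pos (by lia)]
    congr 3
    apply Subtype.ext
    simp only [idx0]
    ext
    · simp; lia
    · simp [hl0]
  have h3 : Major (K * H ^ C * Z) (P ^ l.1.1) (-s * θ l) := by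
    rw [h2] at h1
    refine Major.of_add_div (n := Q) (k := if l.1.1 = 1 then k else 0) hQ hQZ (by positivity) ?_
    split_ifs at h1 ⊢
    · exact h1
    · simpa using h1
  apply hl
  rcases (abs_eq (by norm_num)).1 hs with rfl | rfl
  · simpa using h3.neg
  · simpa using h3

/-- If all central frequencies are major and some horizontal one is not, the exponential sum is
small. -/
theorem horizontal_minor_bound (d : ℕ) : ∃ K : ℝ, 1 ≤ K ∧ ∃ C : ℕ, ∀ r : ℕ, ∃ M : ℝ, 0 < M ∧
    ∀ (σ : Fin r × Bool → ℤ) (ε : Fin r × Bool → Fin r × Bool → ℤ)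
      (E : (Fin r → ℝ) → (Fin r → ℝ) → G0 d), IsQuadratic d r σ ε E →
    ∀ (P : ℕ) (X : ℝ) (φ ψ : Fin r → ℝ → ℝ) (θ : Y d → ℝ), 1 ≤ P → 1 ≤ X → IsCutoff P φ ψ →
      (∀ l : Y d, l.1.2 ≠ 0 → Major X (P ^ (l.1.1 + l.1.2)) (θ l)) →
      (∃ l : Y d, l.1.2 = 0 ∧ ¬ Major (K * X ^ C) (P ^ l.1.1) (θ l)) →
      ‖expSum E φ ψ θ‖ ≤ M * (P ^ (2 * r) / X ^ r) := by
  obtain ⟨K, hK, C, hsmall⟩ := small_horizontal d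
  set n := (Y d).card with hn
  -- A Weyl saving of `X ^ (n+2)` needs a frequency that is not major at level `K (X ^ (n+2)) ^ C *
  -- X ^ n`, the last factor bounding `Q`.
  refine ⟨K, hK, (n + 2) * C + n, fun r => ⟨6 ^ (2 * r) *
    Real.exp (2 * Real.pi * (n * (Fintype.card (Fin r × Bool) ^ 2 * (8 * d ^ 2)))),
    by positivity, ?_⟩⟩
  intro σ ε E hE P X φ ψ θ hP hX hφ hmaj hmin
  have hX0 : 0 < X := by linarith
  obtain ⟨Q, hQ1, hQX, htame⟩ := tame_central hP hX ε hE.abs_coeff θ hmaj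
  let u : Fin r × Bool → ℤ → ℂ := fun i x => if i.2 then (ψ i.1 x : ℂ) else (φ i.1 x : ℂ)
  let w : Fin r × Bool → ℤ → ℂ := fun i x =>
    u i x * e (-∑ l : Y d, if l.1.2 = 0 then σ i * (x : ℝ) ^ l.1.1 * θ l else 0)
  have hw : ∀ i, Small Q (-(P : ℤ)) (P + 1) (w i) (2 * (P / X ^ (n + 2))) := by
    intro i
    refine Small.mul_bv (by norm_num) ?_ (hsmall Q P (X ^ n) (X ^ (n + 2)) (σ i) θ (hE.abs_sign i) hP
      (one_le_pow₀ hX) hQ1 hQX ?_)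
    · simp only [u]
      split_ifs
      · exact (hφ.bvle i.1 _ _).2
      · exact (hφ.bvle i.1 _ _).1
    · rw [← pow_mul, mul_assoc, ← pow_add]; exact hmin
  have hsum : expSum E φ ψ θ = ∑ x ∈ Fintype.piFinset fun _ : Fin r × Bool => Ico (-(P : ℤ)) (P + 1),
      e (-∑ l : Y d, if l.1.2 = 0 then 0 else
          (∑ i, ∑ j, ε i j * ((x i : ℝ) ^ l.1.1 * (x j : ℝ) ^ l.1.2)) * θ l) * ∏ i, w i (x i) := by
    rw [expSum_eq_sum hφ]
    refine sum_bij' (fun v _ i => if i.2 then (v i.1).2 else (v i.1).1)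
      (fun x _ j => (x (j, false), x (j, true))) ?_ ?_ ?_ ?_ ?_
    · intro v hv
      rw [Fintype.mem_piFinset] at hv ⊢
      intro i
      have := mem_product.1 (hv i.1)
      split_ifs
      · exact this.2
      · exact this.1
    · intro x hx
      rw [Fintype.mem_piFinset] at hx ⊢
      exact fun j => mem_product.2 ⟨hx _, hx _⟩
    · intro v _; rfl
    · intro x _
      ext ⟨j, b⟩
      cases b <;> rfl
    · intro v _
      set x : Fin r × Bool → ℤ := fun i => if i.2 then (v i.1).2 else (v i.1).1 with hx
      have h1 : ∏ i, u i (x i) = ∏ j, ((φ j (v j).1 * ψ j (v j).2 : ℝ) : ℂ) := by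
        rw [Fintype.prod_prod_type]
        refine prod_congr rfl fun j _ => ?_
        simp [u, hx, mul_comm]
      have h2 : pairing (E (fun j => ((v j).1 : ℝ)) (fun j => ((v j).2 : ℝ))) θ =
          (∑ l : Y d, if l.1.2 = 0 then 0 else
          (∑ i, ∑ j, ε i j * ((x i : ℝ) ^ l.1.1 * (x j : ℝ) ^ l.1.2)) * θ l) +
          ∑ i, ∑ l : Y d, if l.1.2 = 0 then σ i * (x i : ℝ) ^ l.1.1 * θ l else 0 := by
        rw [sum_comm, ← sum_add_distrib, pairing]
        refine sum_congr rfl fun l _ => ?_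
        by_cases hl : l.1.2 = 0
        · have := hE.coord_zero x l hl
          simp only [hl, if_true, zero_add, ← sum_mul]
          rw [← this]; rfl
        · have := hE.coord_ne x l hl
          simp only [hl, if_false, sum_const_zero, add_zero]
          rw [← this]; rfl
      simp only [w]
      rw [prod_mul_distrib, h1, h2, neg_add, e_add, ← e_sum, sum_neg_distrib]
      ring
  rw [hsum]
  refine (htame w _ hw).trans ?_
  have hcard : Fintype.card (Fin r × Bool) = 2 * r := by simp [mul_comm]
  rw [prod_const, card_univ, hcard]
  set R := Real.exp (2 * Real.pi * (n * ((2 * r : ℕ) ^ 2 * (8 * d ^ 2))))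
  -- Per variable, the cells cost `3X` and the residues `X ^ n`; against the saving `X ^ (n+2)` a
  -- factor `1 / X` remains.
  calc _ ≤ (3 * X) ^ (2 * r) * (R * (X ^ n) ^ (2 * r)) * (2 * (P / X ^ (n + 2))) ^ (2 * r) := by
        gcongr
    _ = R * (3 * X * X ^ n * (2 * (P / X ^ (n + 2)))) ^ (2 * r) := by
        rw [mul_pow (3 * X * X ^ n), mul_pow (3 * X)]; ring
    _ = R * (6 * P / X) ^ (2 * r) := by
        congr 2
        rw [pow_add]; field_simp; norm_num
    _ = 6 ^ (2 * r) * R * (P ^ (2 * r) / X ^ (2 * r)) := by rw [div_pow, mul_pow]; ring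
    _ ≤ _ := by
        gcongr
        lia

end

/-! ### Choice of parameters and conclusion -/

section

variable {d r : ℕ}

/-- Compare `a/q` with a competing `b/q'`, `q' ≤ X`. If they are equal, coprimality gives `q ∣ q'`,
against `q ≥ P ^ ε > X`. If they differ, the nonzero integer `q' a - b q` has absolute value at most
`2X / P ^ ε < 1`. -/
theorem not_major_of_approx {P k : ℕ} {X t ε : ℝ} (hP : 1 ≤ P) (hX : 2 * X < (P : ℝ) ^ ε) {a : ℤ} {q : ℕ}
    (hq : 1 ≤ q) (haq : IsCoprime a (q : ℤ)) (ht : |t - (a : ℝ) / q| ≤ 1 / (q : ℝ) ^ 2)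
    (hlow : (P : ℝ) ^ ε ≤ q) (hup : (q : ℝ) ≤ (P : ℝ) ^ ((k : ℝ) - ε)) : ¬ Major X (P ^ k) t := by
  rintro ⟨q', h1, h2, b, hb⟩
  have hP0 : (0 : ℝ) < P := by exact_mod_cast hP
  have hq0 : (0 : ℝ) < q := by exact_mod_cast hq
  have hPε : 0 < (P : ℝ) ^ ε := Real.rpow_pos_of_pos hP0 _
  have hX0 : 0 ≤ X := (Nat.cast_nonneg q').trans h2
  by_cases hab : (q' : ℤ) * a = b * q
  · have h3 : (q : ℤ) ∣ q' := haq.symm.dvd_of_dvd_mul_right ⟨b, by rw [hab]; ring⟩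
    have h4 : (q : ℝ) ≤ q' := by exact_mod_cast Nat.le_of_dvd h1 (by exact_mod_cast h3)
    linarith
  · have h3 : (1 : ℝ) ≤ |(q' : ℝ) * a - b * q| := by
      have : 1 ≤ |(q' : ℤ) * a - b * q| := Int.one_le_abs (sub_ne_zero.2 hab)
      exact_mod_cast this
    have h4 : (q' : ℝ) * a - b * q = q * ((q' * t - b) - q' * (t - a / q)) := by
      field_simp; ring
    have h5 : (P : ℝ) ^ k = (P : ℝ) ^ ((k : ℝ) - ε) * (P : ℝ) ^ ε := by
      rw [← Real.rpow_add hP0, sub_add_cancel, Real.rpow_natCast]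
    have h6 : q * (X / P ^ k) ≤ X / (P : ℝ) ^ ε := by
      rw [h5, mul_div_assoc', div_le_div_iff₀ (by positivity) hPε]
      calc q * X * (P : ℝ) ^ ε ≤ (P : ℝ) ^ ((k : ℝ) - ε) * X * (P : ℝ) ^ ε := by gcongr
        _ = _ := by ring
    have h7 : q * (q' * (1 / (q : ℝ) ^ 2)) ≤ X / (P : ℝ) ^ ε := by
      calc q * (q' * (1 / (q : ℝ) ^ 2)) = q' / q := by field_simp
        _ ≤ _ := by gcongr
    have h8 : |(q' : ℝ) * a - b * q| ≤ q * (X / P ^ k) + q * (q' * (1 / (q : ℝ) ^ 2)) := by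
      rw [h4, abs_mul, Nat.abs_cast, ← mul_add]
      gcongr
      refine (abs_sub _ _).trans (add_le_add hb ?_)
      rw [abs_mul, Nat.abs_cast]
      gcongr
    have h9 : X / (P : ℝ) ^ ε + X / (P : ℝ) ^ ε < 1 := by
      rw [← add_div, div_lt_one hPε]; linarith
    linarith

/-- The exponential sum estimate for both ordered products at once. -/
theorem expSum_bound (d : ℕ) : ∃ Cbar : ℝ, 0 < Cbar ∧ ∀ r : ℕ, 1 ≤ r → ∃ C : ℝ, 0 < C ∧
    ∀ (s : ℤ) (gl : ℤ × ℤ → G0 d) (σ : Fin r × Bool → ℤ) (c : Fin r × Bool → Fin r × Bool → ℤ)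
      (E : (Fin r → ℝ) → (Fin r → ℝ) → G0 d), IsModel d r s gl E → IsQuadratic d r σ c E →
    ∀ ε : ℝ, 0 < ε → ε ≤ 1 / 2 → ∀ P : ℕ, 1 ≤ P → ∀ φ ψ : Fin r → ℝ → ℝ, IsCutoff P φ ψ →
    ∀ θ : Y d → ℝ, (∃ l : Y d, ∃ a : ℤ, ∃ q : ℕ, 1 ≤ q ∧ IsCoprime a (q : ℤ) ∧
        |θ l - (a : ℝ) / (q : ℝ)| ≤ 1 / (q : ℝ) ^ 2 ∧ (P : ℝ) ^ ε ≤ (q : ℝ) ∧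
        (q : ℝ) ≤ (P : ℝ) ^ ((l.1.1 : ℝ) + (l.1.2 : ℝ) - ε)) →
      ‖expSum E φ ψ θ‖ ≤ C * ((P : ℝ) ^ (2 * r) * (P : ℝ) ^ (Cbar - (r : ℝ) * ε / Cbar)) := by
  obtain ⟨K₁, hK₁, C₁, s, hs, hcen⟩ := central_minor_bound d
  obtain ⟨K₂, hK₂, C₂, hhor⟩ := horizontal_minor_bound d
  -- Makes `H ^ ((C₁+1)(C₂+1))` equal to `P ^ (ε/2)`, leaving the other half of `P ^ ε` to dominate
  -- the constant `K'`. The exponents `C₁ + 1` and `C₂ + 1` ensure `H ≤ X ≤ K₂ X ^ (C₂+1)` even if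
  -- `C₁` or `C₂` is zero.
  set N : ℕ := 2 * ((C₁ + 1) * (C₂ + 1)) with hN
  set K' : ℝ := 2 * (K₂ * K₁ ^ (C₂ + 1)) with hK'
  have hN1 : 1 ≤ N := by
    have : 1 ≤ (C₁ + 1) * (C₂ + 1) := Nat.mul_pos (by lia) (by lia)
    lia
  have hN' : (1 : ℝ) ≤ N := by exact_mod_cast hN1
  have hs' : (1 : ℝ) ≤ s := by exact_mod_cast hs
  have hsN : (1 : ℝ) ≤ s * N := one_le_mul_of_one_le_of_one_le hs' hN'
  -- Here `d * d` pays for the box, `s * N` is the rate of saving per variable, and `2` covers the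
  -- rounding of `r / s` and the comparison with `ε / 2` for small `P`.
  refine ⟨(d * d : ℕ) + 2 + s * N, by positivity, fun r hr => ?_⟩
  obtain ⟨M, hM, hhor⟩ := hhor r
  set Cb : ℝ := (d * d : ℕ) + 2 + s * N with hCb
  have hd0 : (0 : ℝ) ≤ (d * d : ℕ) := Nat.cast_nonneg _
  have hCb0 : 0 < Cb := by positivity
  refine ⟨9 ^ r * K' ^ r + (5 * r) ^ d * (9 * K₁) ^ r + M, by positivity, ?_⟩
  intro s' gl σ c E hE hE' ε hε hε2 P hP φ ψ hφ θ ⟨l, a, q, hq, haq, ht, hlow, hup⟩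
  have hP' : (1 : ℝ) ≤ P := by exact_mod_cast hP
  have hP0 : (0 : ℝ) < P := by linarith
  have hr' : (1 : ℝ) ≤ r := by exact_mod_cast hr
  set T : ℝ := (P : ℝ) ^ (2 * r) * (P : ℝ) ^ (Cb - (r : ℝ) * ε / Cb) with hT
  have hT0 : 0 ≤ T := by positivity
  have hexp : r * ε / Cb ≤ r * ε / (s * N) := by
    gcongr; linarith
  -- reduction of a bound to a comparison of exponents
  have hfin : ∀ c₀ y : ℝ, 0 ≤ c₀ → y ≤ Cb - r * ε / Cb →
      c₀ * (P ^ (2 * r) * (P : ℝ) ^ y) ≤ c₀ * T := by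
    intro c₀ y hc₀ hy
    rw [hT]
    gcongr
  -- When `P ^ (ε/2)` is bounded the claimed saving is at most a constant depending on `d` and `r`,
  -- and the trivial bound suffices.
  by_cases hsml : (P : ℝ) ^ (ε / 2) ≤ K'
  · have h1 : (1 : ℝ) ≤ K' ^ r * (P : ℝ) ^ (-(r * (ε / 2))) := by
      rw [Real.rpow_neg hP0.le, ← div_eq_mul_inv, one_le_div (by positivity), mul_comm (r : ℝ),
        Real.rpow_mul hP0.le, Real.rpow_natCast]
      gcongr
    have h2 : r * ε / Cb ≤ r * (ε / 2) := by
      rw [mul_div_assoc]; gcongr; linarith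
    calc ‖expSum E φ ψ θ‖ ≤ 9 ^ r * P ^ (2 * r) * 1 := by
          rw [mul_one]; exact norm_expSum_le hP hφ E θ
      _ ≤ 9 ^ r * P ^ (2 * r) * (K' ^ r * (P : ℝ) ^ (-(r * (ε / 2)))) := by gcongr
      _ = 9 ^ r * K' ^ r * (P ^ (2 * r) * (P : ℝ) ^ (-(r * (ε / 2)))) := by ring
      _ ≤ 9 ^ r * K' ^ r * T := hfin _ _ (by positivity) (by linarith)
      _ ≤ _ := by
          gcongr
          have : 0 ≤ (5 * (r : ℝ)) ^ d * (9 * K₁) ^ r := by positivity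
          linarith
  push Not at hsml
  set H : ℝ := (P : ℝ) ^ (ε / N) with hH
  have hH1 : 1 ≤ H := Real.one_le_rpow hP' (by positivity)
  set X : ℝ := K₁ * H ^ (C₁ + 1) with hX
  have hHX : H ≤ X := by
    calc H = 1 * H ^ 1 := by ring
      _ ≤ _ := by
        rw [hX]; gcongr
        lia
  have hX1 : 1 ≤ X := hH1.trans hHX
  have hZ : 2 * (K₂ * X ^ (C₂ + 1)) < (P : ℝ) ^ ε := by
    have h1 : H ^ ((C₁ + 1) * (C₂ + 1)) = (P : ℝ) ^ (ε / 2) := by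
      rw [hH, ← Real.rpow_natCast, ← Real.rpow_mul hP0.le]
      congr 1
      rw [hN]; push_cast; field_simp
    have h2 : 2 * (K₂ * X ^ (C₂ + 1)) = K' * (P : ℝ) ^ (ε / 2) := by
      rw [hX, mul_pow, ← pow_mul, h1, hK']; ring
    have h3 : (P : ℝ) ^ ε = (P : ℝ) ^ (ε / 2) * (P : ℝ) ^ (ε / 2) := by
      rw [← Real.rpow_add hP0, add_halves]
    rw [h2, h3]
    gcongr
  have hXZ : X ≤ K₂ * X ^ (C₂ + 1) := by
    calc X = 1 * X ^ 1 := by ring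
      _ ≤ _ := by
        gcongr
        lia
  have hup' : (q : ℝ) ≤ (P : ℝ) ^ (((l.1.1 + l.1.2 : ℕ) : ℝ) - ε) := by push_cast; exact hup
  have hlm := not_major_of_approx hP hZ hq haq ht hlow hup'
  -- If all central frequencies are major, the given frequency, which is not, must be horizontal.
  by_cases hall : ∀ l : Y d, l.1.2 ≠ 0 → Major X (P ^ (l.1.1 + l.1.2)) (θ l)
  · have hl0 : l.1.2 = 0 := by
      by_contra hne
      exact hlm ((hall l hne).mono hXZ (by positivity))
    rw [hl0, add_zero] at hlm
    have h1 := hhor σ c E hE' P X φ ψ θ hP hX1 hφ hall ⟨l, hl0, fun h => hlm (h.mono (by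
      gcongr
      lia) (by positivity))⟩
    calc _ ≤ _ := h1
      _ ≤ M * (P ^ (2 * r) / H ^ r) := by gcongr
      _ = M * (P ^ (2 * r) * (P : ℝ) ^ (-(r * ε / N))) := by
          rw [hH, ← Real.rpow_natCast (_ ^ (ε / N)), ← Real.rpow_mul hP0.le, Real.rpow_neg hP0.le, div_eq_mul_inv]
          congr 4
          ring
      _ ≤ M * T := by
          refine hfin _ _ hM.le ?_
          have : r * ε / (s * N) ≤ r * ε / N := by
            gcongr
            exact le_mul_of_one_le_left (by positivity) hs'
          linarith
      _ ≤ _ := by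
          gcongr
          have : 0 ≤ 9 ^ r * K' ^ r + (5 * (r : ℝ)) ^ d * (9 * K₁) ^ r := by positivity
          linarith
  · push Not at hall
    obtain ⟨l', hl'0, hl'⟩ := hall
    have h1 := hcen r s' gl E hE hr P H φ ψ θ hP hH1 hφ ⟨l', hl'0, fun h => hl' (h.mono (by
      rw [hX]
      gcongr
      lia) (by positivity))⟩
    have h2 : (r : ℝ) / s - 1 ≤ (r / s : ℕ) := by
      have h3 : r < s * (r / s + 1) := Nat.lt_mul_div_succ r (by lia)
      have h4 : (r : ℝ) < s * ((r / s : ℕ) + 1) := by exact_mod_cast h3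
      have h5 : (r : ℝ) / s < (r / s : ℕ) + 1 := by
        rw [div_lt_iff₀ (by linarith)]; linarith
      linarith
    calc _ ≤ _ := h1
      _ = (5 * r) ^ d * (9 * K₁) ^ r *
          (P ^ (2 * r) * (P : ℝ) ^ ((d * d : ℕ) - ε / N * (r / s : ℕ))) := by
          rw [hH, ← Real.rpow_natCast (_ ^ _), ← Real.rpow_mul hP0.le, Real.rpow_sub hP0,
            Real.rpow_natCast]
          ring
      _ ≤ (5 * r) ^ d * (9 * K₁) ^ r * T := by
          refine hfin _ _ (by positivity) ?_
          have h6 : ε / N * ((r : ℝ) / s - 1) ≤ ε / N * (r / s : ℕ) := by gcongr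
          have h7 : ε / N ≤ 1 := (div_le_one (by linarith)).2 (by linarith)
          have h8 : ε / N * ((r : ℝ) / s - 1) = r * ε / (s * N) - ε / N := by
            field_simp
          linarith
      _ ≤ _ := by
          gcongr
          have : 0 ≤ 9 ^ r * K' ^ r := by positivity
          linarith

end

end StepTwo

theorem mainTheorem8 (d : ℕ) (hd : 1 ≤ d) :
    ∃ Cbar : ℝ, 0 < Cbar ∧
      ∀ r : ℕ, 1 ≤ r →
        ∃ C : ℝ, 0 < C ∧
          ∀ ε : ℝ, 0 < ε → ε ≤ 1 / 2 →
          ∀ P : ℕ, 1 ≤ P →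
          ∀ φ ψ : Fin r → ℝ → ℝ, StepTwo.IsCutoff P φ ψ →
          ∀ θ : StepTwo.Y d → ℝ,
            (∃ l : StepTwo.Y d, ∃ a : ℤ, ∃ q : ℕ, 1 ≤ q ∧ IsCoprime a (q : ℤ) ∧
              |θ l - (a : ℝ) / (q : ℝ)| ≤ 1 / (q : ℝ) ^ 2 ∧
              (P : ℝ) ^ ε ≤ (q : ℝ) ∧
              (q : ℝ) ≤ (P : ℝ) ^ ((l.1.1 : ℝ) + (l.1.2 : ℝ) - ε)) →
            ‖StepTwo.S φ ψ θ‖ + ‖StepTwo.Stilde φ ψ θ‖ ≤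
              C * ((P : ℝ) ^ (2 * r) * (P : ℝ) ^ (Cbar - (r : ℝ) * ε / Cbar)) := by
  obtain ⟨Cbar, hCbar, hr⟩ := StepTwo.expSum_bound d
  refine ⟨Cbar, hCbar, fun r hr1 => ?_⟩
  obtain ⟨C, hC, h⟩ := hr r hr1
  refine ⟨2 * C, by positivity, fun ε hε hε2 P hP φ ψ hφ θ hθ => ?_⟩
  have h1 := h _ _ _ _ _ (StepTwo.isModel_D d r) (StepTwo.isQuadratic_D d r) ε hε hε2 P hP φ ψ hφ θ hθ
  have h2 := h _ _ _ _ _ (StepTwo.isModel_Dtilde d r) (StepTwo.isQuadratic_Dtilde d r) ε hε hε2 P hP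
    φ ψ hφ θ hθ
  unfold StepTwo.S StepTwo.Stilde
  linarith
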